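/- \textbf{Conventions.} $\log$ is the base-2 logarithm, $\ln$ the natural one. A function $f:\mathbb N\to\mathbb R_{\ge 0}$ is negligible if for every $C>0$ one has $f(\lambda)\le\lambda^{-C}$ for all large $\lambda$. An \emph{efficient (PPT) algorithm} is a probabilistic algorithm whose worst-case number of steps is bounded by a polynomial in the security parameter $\lambda$ (and in the length of the string to be decoded, for $\mathsf{Dec}$); drawing a uniformly random entry of a list and tossing a coin count as one step. Coins are fair for adversaries; the algorithms of the code may toss coins of bias $q$. Throughout, ``efficient'' can be read as uniform or as nonuniform (polynomial-size advice); the theorem holds for either reading, used consistently. \textbf{Weak PRFs.} Let $\ell(\lambda),n(\lambda)\le\mathrm{poly}(\lambda)$ with $n(\lambda)\ge\lambda^{\varepsilon}$ for some $\varepsilon>0$ and all large $\lambda$. Let $\mathcal F=\{F_s:\{0,1\}^{n(\lambda)}\to\{0,1\}\}_{s\in\{0,1\}^{\ell(\lambda)}}$, $\lambda\in\mathbb N$, be an efficiently computable family ($n$, $\ell$ and $(1^\lambda,s,x)\mapsto F_s(x)$ are computable in deterministic polynomial time). It is a weak PRF with noise level $q$ if every PPT adversary, given $1^\lambda$ and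 $1^{n(\lambda)}$, has negligible advantage in distinguishing the following two oracles: the one that answers each call by $(x,F_s(x)\oplus e)$ with fresh $x\sim\mathrm{Unif}(\{0,1\}^{n(\lambda)})$ and $e\sim\mathrm{Ber}(q)$, for a uniformly random $s$; and the one that answers by $(x,f(x))$ with fresh uniform $x$, for a uniformly random function $f$. It is $\tau$-local if each $F_s$ depends on at most $\tau(\lambda)$ input bits. \textbf{Construction.} Given $m(\lambda)$, let $N=3m(n+1)^2$ and let $(\pi\circ x)_i=x_{\pi(i)}$. $\mathsf{Key}(1^\lambda)$ returns $(s,z,\pi)$ with independent uniform $s\in\{0,1\}^{\ell}$, $z\in\{0,1\}^N$ and a uniform permutation $\pi$ of $[N]$. $\mathsf{Enc}(1^\lambda,(s,z,\pi),\emptyset)$ samples $x_1,\dots,x_m\sim\mathrm{Unif}(\{0,1\}^n)$, $e_1,\dots,e_m\sim\mathrm{Ber}(q)$ and $r\sim\mathrm{Unif}(\{0,1\}^{N-(n+1)m})$, all independent, and returns $\pi\circ(a\oplus z)$ with $a=((x_1,F_s(x_1)\oplus e_1),\dots,(x_m,F_s(x_m)\oplus e_m),r)$. $\mathsf{Dec}(1^\lambda,(s,z,\pi),y)$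 returns $\perp$ if $|y|\ne N$; otherwise it reads $((x_1,w_1),\dots,(x_m,w_m))$ off the first $(n+1)m$ bits of $(\pi^{-1}\circ y)\oplus z$ and returns $\emptyset$ if $\#\{j: w_j=F_s(x_j)\}>\frac m2+\ln(m)\sqrt m$, and $\perp$ otherwise. \textbf{Theorem.} There is a constant $C_0>0$ such that the following holds. Let $0<p<\frac12$, $0\le q<\frac12$, and let $\mathcal F$ be as above, a weak PRF family with noise level $q$ that is $\tau$-local for some $\tau(\lambda)\le\log n(\lambda)$. Let $m(\lambda)\le\mathrm{poly}(\lambda)$ be any integer sequence with $$m(\lambda)\ \ge\ C_0\,(1-2q)^{-4}\,n(\lambda)^{4\log\frac1{1-2p}}\quad\text{for all }\lambda,$$ such that $m(\lambda)$ and $\lfloor \frac m2+\ln(m)\sqrt m\rfloor$ are computable from $1^\lambda$ in polynomial time (no restriction in the nonuniform reading). Then $\mathsf{PRFPRC}[\mathcal F,p,q]=(\mathsf{Key},\mathsf{Enc},\mathsf{Dec})$ is a zero-bit secret-key pseudorandom code over $\{0,1\}$, with key length and block length $\mathrm{poly}(\lambda)$: \begin{itemize} \item $\mathsf{Key},\mathsf{Enc},\mathsf{Dec}$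 are PPT algorithms. \item Soundness: there is a negligible $\nu$ with $\Pr_{\mathsf{sk}}[\mathsf{Dec}(1^\lambda,\mathsf{sk},y)=\perp]\ge1-\nu(\lambda)$ for all $\lambda$ and all $y\in\{0,1\}^*$. \item Undetectability: every PPT adversary, given $1^\lambda$, has negligible advantage in distinguishing the oracle $\mathsf{Enc}(1^\lambda,\mathsf{sk},\cdot)$, $\mathsf{sk}\gets\mathsf{Key}(1^\lambda)$, from an oracle that answers each call by a fresh uniform string in $\{0,1\}^{N(\lambda)}$. \item Robustness to all $p$-substitution-bounded channels (random maps $\mathcal E:\{0,1\}^*\to\{0,1\}^*$ whose output has the length of the input $y$ and differs from it in at most $p|y|$ positions, almost surely): there is a negligible $\nu$ with $\Pr[\mathsf{Dec}(1^\lambda,\mathsf{sk},\mathcal E(\mathsf{Enc}(1^\lambda,\mathsf{sk},\emptyset)))=\emptyset]\ge 1-\nu(\lambda)$ for all $\lambda$ and all such $\mathcal E$. \item Robustness to all $p$-weakly-substitution-bounded channels: for every negligible $\nu$ there is a negligible $\nu'$ such that the same probability is at least $1-\nu'(\lambda)$ for all $\lambda$ and every channel $\mathcal E$ such that, for every $k$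 and uniform $y\in\{0,1\}^k$, with probability at least $1-\nu(k)$ the string $\mathcal E(y)$ has length $k$ and differs from $y$ in at most $pk$ positions. \end{itemize} -/

import Mathlib

namespace PRFCode

/-! ### A probabilistic machine model with a step count

Imperative `while` programs over binary trees (a model of computation which is polynomially
equivalent to Turing machines), extended with random choices and oracle calls. -/

/-- The data manipulated by programs: binary trees. -/
inductive Data : Type
  | nil : Data
  | cons (a b : Data) : Data

namespace Data

/-- Number of nodes. -/
def size : Data → ℕ
  | nil => 1
  | cons a b => a.size + b.size + 1

/-- The tree representing a list of trees. -/
def ofList : List Data → Data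
  | [] => nil
  | a :: l => cons a (ofList l)

/-- The list of trees that a tree represents. -/
def toList : Data → List Data
  | nil => []
  | cons a b => a :: b.toList

def hd : Data → Data
  | nil => nil
  | cons a _ => a

def tl : Data → Data
  | nil => nil
  | cons _ b => b

/-- Truth value of a tree: `nil` is `0`, everything else is `1`. -/
def toBool : Data → Bool
  | nil => false
  | cons _ _ => true

def ofBool : Bool → Data
  | false => nil
  | true => cons nil nil

/-- The tree representing a bit string. -/
def ofBits (l : List Bool) : Data := ofList (l.map ofBool)

/-- The bit string that a tree represents. -/
def toBits (d : Data) : List Bool := d.toList.map toBool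

/-- The unary representation `1^k` of a natural number. -/
def unary (k : ℕ) : Data := ofBits (List.replicate k true)

end Data

/-- Programs; a program has registers `0, 1, 2, …`, each of them holding a tree. -/
inductive Cmd : Type
  /-- `x := nil` -/
  | setNil (x : ℕ) : Cmd
  /-- `x := y` -/
  | copy (x y : ℕ) : Cmd
  /-- `x := cons y z` -/
  | cons (x y z : ℕ) : Cmd
  /-- `x := hd y` -/
  | hd (x y : ℕ) : Cmd
  /-- `x := tl y` -/
  | tl (x y : ℕ) : Cmd
  /-- `x :=` the outcome of a fresh toss of the coin -/
  | coin (x : ℕ) : Cmd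
  /-- `x :=` a uniformly random entry of the list `y` (`nil` if that list is empty) -/
  | choose (x y : ℕ) : Cmd
  /-- `x :=` the answer of the oracle to the query `y` -/
  | query (x y : ℕ) : Cmd
  | seq (c d : Cmd) : Cmd
  /-- run `c` if `x` is not `nil`, and `d` otherwise -/
  | ite (x : ℕ) (c d : Cmd) : Cmd
  /-- run `c` as long as `x` is not `nil` -/
  | while (x : ℕ) (c : Cmd) : Cmd

/-- Programs that neither make random choices nor call an oracle. -/
def Cmd.IsDeterministic : Cmd → Prop
  | .coin _ => False
  | .choose _ _ => False
  | .query _ _ => False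
  | .seq c d => c.IsDeterministic ∧ d.IsDeterministic
  | .ite _ c d => c.IsDeterministic ∧ d.IsDeterministic
  | .while _ c => c.IsDeterministic
  | _ => True

/-- Contents of the registers. -/
abbrev Store : Type := ℕ → Data

/-- The commands that remain to be executed, and the store. -/
abbrev Config : Type := List Cmd × Store

/-- An oracle answers every query by a fresh random bit string. -/
abbrev Oracle : Type := Data → PMF (List Bool)

/-- The Bernoulli distribution: `true` with probability `q` (for `0 ≤ q ≤ 1`). -/
noncomputable def ber (q : ℝ) : PMF Bool :=
  PMF.ofFintype (fun b => if b then min (ENNReal.ofReal q) 1 else 1 - min (ENNReal.ofReal q) 1)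
    (by simp)

/-- A uniformly random bit string of length `k`. -/
noncomputable def unifBits (k : ℕ) : PMF (Fin k → Bool) := PMF.uniformOfFintype _

/-- A uniformly random entry of a list, `nil` if it is empty. -/
noncomputable def pick : List Data → PMF Data
  | [] => PMF.pure Data.nil
  | a :: l => (PMF.uniformOfFintype (Fin (l.length + 1))).map fun i => (a :: l).get i

/-- One step of computation, with oracle `O` and a coin of bias `β`. A configuration with no
remaining command has halted. -/
noncomputable def step (β : ℝ) (O : Oracle) : Config → PMF Config
  | ([], σ) => PMF.pure ([], σ)
  | (.setNil x :: k, σ) => PMF.pure (k, Function.update σ x Data.nil)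
  | (.copy x y :: k, σ) => PMF.pure (k, Function.update σ x (σ y))
  | (.cons x y z :: k, σ) => PMF.pure (k, Function.update σ x (Data.cons (σ y) (σ z)))
  | (.hd x y :: k, σ) => PMF.pure (k, Function.update σ x (σ y).hd)
  | (.tl x y :: k, σ) => PMF.pure (k, Function.update σ x (σ y).tl)
  | (.coin x :: k, σ) => (ber β).map fun b => (k, Function.update σ x (Data.ofBool b))
  | (.choose x y :: k, σ) => (pick (σ y).toList).map fun d => (k, Function.update σ x d)
  | (.query x y :: k, σ) => (O (σ y)).map fun l => (k, Function.update σ x (Data.ofBits l))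
  | (.seq c d :: k, σ) => PMF.pure (c :: d :: k, σ)
  | (.ite x c d :: k, σ) => PMF.pure ((if (σ x).toBool then c else d) :: k, σ)
  | (.while x c :: k, σ) =>
      PMF.pure (if (σ x).toBool then c :: .while x c :: k else k, σ)

/-- `t` steps of computation. -/
noncomputable def run (β : ℝ) (O : Oracle) : ℕ → Config → PMF Config
  | 0, C => PMF.pure C
  | t + 1, C => (step β O C).bind (run β O t)

/-- The initial configuration: the inputs are in the registers `0, 1, 2, …`. -/
def start (c : Cmd) (inputs : List Data) : Config := ([c], fun i => inputs.getD i Data.nil)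

/-- For all outcomes of the random choices, `c` halts after at most `t` steps. -/
def HaltsWithin (β : ℝ) (O : Oracle) (c : Cmd) (inputs : List Data) (t : ℕ) : Prop :=
  ∀ C ∈ (run β O t (start c inputs)).support, C.1 = []

/-- Distribution of the contents of register `0` after `t` steps. -/
noncomputable def outputAfter (β : ℝ) (O : Oracle) (c : Cmd) (inputs : List Data) (t : ℕ) :
    PMF Data :=
  (run β O t (start c inputs)).map fun C => C.2 0

/-- The oracle of programs that have no oracle. -/
noncomputable def noOracle : Oracle := fun _ => PMF.pure []

/-! ### Asymptotics, and efficient algorithms -/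

/-- Negligible functions of the security parameter. -/
def Negligible (f : ℕ → ℝ) : Prop :=
  (∀ lam, 0 ≤ f lam) ∧ ∀ C : ℝ, 0 < C → ∃ lam₀ : ℕ, ∀ lam > lam₀, f lam ≤ (lam : ℝ) ^ (-C)

/-- `f(λ) ≤ poly(λ)`. -/
def PolyBounded (f : ℕ → ℕ) : Prop := ∃ P : Polynomial ℕ, ∀ lam, f lam ≤ P.eval lam

/-- Which auxiliary inputs `a(λ)` an efficient algorithm may be equipped with: in the nonuniform
setting any sequence of polynomial size, in the uniform setting only constant sequences (such a
sequence can be written into the program). -/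
def AdviceOK (nonuniform : Bool) (a : ℕ → Data) : Prop :=
  PolyBounded (fun lam => (a lam).size) ∧ (nonuniform = false → ∀ lam, a lam = a 0)

/-- The random function which on the security parameter `λ` and on the further input `i`, presented
to the program as the list of data `inp λ i`, has an output of law `out λ i`, is computed by a
probabilistic program with a coin of bias `β`, in time polynomial in `size λ i`. -/
def IsPPT (nonuniform : Bool) (β : ℝ) {I : ℕ → Type} (inp : ∀ lam, I lam → List Data)
    (size : ∀ lam, I lam → ℕ) (out : ∀ lam, I lam → PMF Data) : Prop :=
  ∃ (c : Cmd) (a : ℕ → Data) (P : Polynomial ℕ), AdviceOK nonuniform a ∧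
    ∀ (lam : ℕ) (i : I lam),
      let inputs := Data.unary lam :: a lam :: inp lam i
      let t := P.eval (size lam i)
      HaltsWithin β noOracle c inputs t ∧ outputAfter β noOracle c inputs t = out lam i

/-- The function `out` is computed by a deterministic program in time polynomial in `λ`. -/
def IsPolyTime (nonuniform : Bool) {I : ℕ → Type} (inp : ∀ lam, I lam → List Data)
    (out : ∀ lam, I lam → Data) : Prop :=
  ∃ (c : Cmd) (a : ℕ → Data) (P : Polynomial ℕ), c.IsDeterministic ∧ AdviceOK nonuniform a ∧
    ∀ (lam : ℕ) (i : I lam),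
      let inputs := Data.unary lam :: a lam :: inp lam i
      let t := P.eval lam
      HaltsWithin 0 noOracle c inputs t ∧
        outputAfter 0 noOracle c inputs t = PMF.pure (out lam i)

/-- `1^λ ↦ 1^{f(λ)}` is computable in time polynomial in `λ`. -/
def IsConstructible (nonuniform : Bool) (f : ℕ → ℕ) : Prop :=
  IsPolyTime nonuniform (I := fun _ => Unit) (fun _ _ => []) (fun lam _ => Data.unary (f lam))

/-- A probabilistic (fair coins) polynomial-time oracle algorithm. -/
structure Adversary where
  prog : Cmd
  advice : ℕ → Data
  time : Polynomial ℕ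

namespace Adversary

/-- The data handed to the adversary: `1^λ`, its auxiliary input, and `extra`. -/
def inputs (A : Adversary) (extra : ℕ → List Data) (lam : ℕ) : List Data :=
  Data.unary lam :: A.advice lam :: extra lam

/-- `A` runs in polynomial time, whatever the answers in `{0,1}^{w(λ)}` of its oracle are. -/
def IsPPT (nonuniform : Bool) (A : Adversary) (extra : ℕ → List Data) (w : ℕ → ℕ) : Prop :=
  AdviceOK nonuniform A.advice ∧
    ∀ (lam : ℕ) (O : Oracle), (∀ d, ∀ l ∈ (O d).support, l.length = w lam) →
      HaltsWithin (1 / 2) O A.prog (A.inputs extra lam) (A.time.eval lam)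

/-- Law of the bit that `A` outputs when it has access to the oracle `O`. -/
noncomputable def outputBit (A : Adversary) (extra : ℕ → List Data) (lam : ℕ) (O : Oracle) :
    PMF Bool :=
  (outputAfter (1 / 2) O A.prog (A.inputs extra lam) (A.time.eval lam)).map Data.toBool

end Adversary

/-! ### Pseudorandom codes over the alphabet `{0,1}` -/

/-- A channel maps a string to a distribution over strings. -/
abbrev Channel : Type := List Bool → PMF (List Bool)

/-- `z` has the same length as `y`, and Hamming distance at most `p |y|` to it. -/
def HammingClose (p : ℝ) (y z : List Bool) : Prop :=
  z.length = y.length ∧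
    (((List.range y.length).filter fun i => y.getD i false != z.getD i false).length : ℝ)
      ≤ p * y.length

/-- `p`-substitution-bounded channels. -/
def SubstitutionBounded (p : ℝ) (E : Channel) : Prop :=
  ∀ y : List Bool, ∀ z ∈ (E y).support, HammingClose p y z

/-- The channel makes more than `p n` substitutions in a uniformly random string of length `n` with
probability at most `ν n`. The channel is `p`-weakly-substitution-bounded if this holds for some
negligible `ν`. -/
def WeaklySubstitutionBoundedBy (p : ℝ) (ν : ℕ → ℝ) (E : Channel) : Prop :=
  ∀ n : ℕ,
    (((unifBits n).bind fun y => (E (List.ofFn y)).map fun z => (List.ofFn y, z)).toOuterMeasure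
      {yz | ¬ HammingClose p yz.1 yz.2}).toReal ≤ ν n

/-- The syntax of a secret-key code over `{0,1}`: secret keys (with their representation as bit
strings of length `lsk λ`), messages in `{0,1}^{k λ}`, codewords in `{0,1}^{n λ}`, and the random
functions `Key`, `Enc`, `Dec`, where the output `none` of `Dec` stands for failure. -/
structure SecretKeyCode where
  SK : ℕ → Type
  lsk : ℕ → ℕ
  k : ℕ → ℕ
  n : ℕ → ℕ
  skBits : ∀ lam, SK lam → List Bool
  Key : ∀ lam, PMF (SK lam)
  Enc : ∀ lam, SK lam → (Fin (k lam) → Bool) → PMF (Fin (n lam) → Bool)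
  Dec : ∀ lam, SK lam → List Bool → PMF (Option (Fin (k lam) → Bool))

namespace SecretKeyCode

variable (S : SecretKeyCode)

/-- The tree representing an output of `Dec`. -/
def ofDecoded {k : ℕ} : Option (Fin k → Bool) → Data
  | none => Data.nil
  | some msg => Data.cons (Data.ofBits (List.ofFn msg)) Data.nil

/-- The message that a query of the adversary represents. -/
def toMessage (k : ℕ) (d : Data) : Fin k → Bool := fun i => d.toBits.getD i false

/-- `Key`, `Enc` and `Dec` are probabilistic polynomial-time algorithms, which may use a coin of
bias `β`. -/
def IsEfficient (nonuniform : Bool) (β : ℝ) : Prop :=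
  IsPPT nonuniform β (I := fun _ => Unit) (fun _ _ => []) (fun lam _ => lam)
      (fun lam _ => (S.Key lam).map fun sk => Data.ofBits (S.skBits lam sk)) ∧
  IsPPT nonuniform β (I := fun lam => S.SK lam × (Fin (S.k lam) → Bool))
      (fun lam i => [Data.ofBits (S.skBits lam i.1), Data.ofBits (List.ofFn i.2)])
      (fun lam _ => lam)
      (fun lam i => (S.Enc lam i.1 i.2).map fun c => Data.ofBits (List.ofFn c)) ∧
  IsPPT nonuniform β (I := fun lam => S.SK lam × List Bool)
      (fun lam i => [Data.ofBits (S.skBits lam i.1), Data.ofBits i.2])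
      (fun lam i => lam + i.2.length)
      (fun lam i => (S.Dec lam i.1 i.2).map ofDecoded)

/-- Robustness to the channels in `𝓔 λ`. -/
def IsRobust (𝓔 : ℕ → Set Channel) : Prop :=
  ∃ ν : ℕ → ℝ, Negligible ν ∧ ∀ (lam : ℕ) (msg : Fin (S.k lam) → Bool), ∀ E ∈ 𝓔 lam,
    1 - ν lam ≤ (((S.Key lam).bind fun sk => (S.Enc lam sk msg).bind fun x =>
      (E (List.ofFn x)).bind fun y => S.Dec lam sk y) (some msg)).toReal

/-- Soundness. -/
def IsSound : Prop :=
  ∃ ν : ℕ → ℝ, Negligible ν ∧ ∀ (lam : ℕ) (y : List Bool),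
    1 - ν lam ≤ (((S.Key lam).bind fun sk => S.Dec lam sk y) none).toReal

/-- Undetectability: no efficient adversary distinguishes the oracle `Enc(1^λ, sk, ·)`, for a random
key, from an oracle that answers every query by a fresh uniformly random string. -/
def IsUndetectable (nonuniform : Bool) : Prop :=
  ∀ A : Adversary, A.IsPPT nonuniform (fun _ => []) S.n →
    Negligible fun lam =>
      |(((S.Key lam).bind fun sk => A.outputBit (fun _ => []) lam fun d =>
            (S.Enc lam sk (toMessage (S.k lam) d)).map List.ofFn) true).toReal
        - ((A.outputBit (fun _ => []) lam fun _ =>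
            (unifBits (S.n lam)).map List.ofFn) true).toReal|

/-- Secret-key pseudorandom codes with robustness to `𝓔`, over the alphabet `{0,1}`. -/
structure IsPRC (nonuniform : Bool) (β : ℝ) (𝓔 : ℕ → Set Channel) : Prop where
  poly_lsk : PolyBounded S.lsk
  poly_k : PolyBounded S.k
  poly_n : PolyBounded S.n
  skBits_length : ∀ lam sk, (S.skBits lam sk).length = S.lsk lam
  skBits_injective : ∀ lam, Function.Injective (S.skBits lam)
  efficient : S.IsEfficient nonuniform β
  robust : S.IsRobust 𝓔
  sound : S.IsSound
  undetectable : S.IsUndetectable nonuniform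

/-- The only message is the empty one. -/
def IsZeroBit : Prop := ∀ lam, S.k lam = 0

end SecretKeyCode

/-! ### Weak pseudorandom functions -/

/-- Functions `F_s : {0,1}^{n(λ)} → {0,1}` indexed by `s ∈ {0,1}^{ℓ(λ)}`. -/
structure FunctionFamily where
  ℓ : ℕ → ℕ
  n : ℕ → ℕ
  F : ∀ lam, (Fin (ℓ lam) → Bool) → (Fin (n lam) → Bool) → Bool

/-- The string `(x, f(x) ⊕ e)` for independent `x ∼ Unif({0,1}^n)` and `e ∼ Ber(q)`. -/
noncomputable def noisySample (q : ℝ) {n : ℕ} (f : (Fin n → Bool) → Bool) : PMF (List Bool) :=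
  (unifBits n).bind fun x => (ber q).map fun e => List.ofFn x ++ [xor (f x) e]

namespace FunctionFamily

variable (𝓕 : FunctionFamily)

/-- Every `F_s` depends on at most `τ(λ)` bits of its input. -/
def IsLocal (τ : ℕ → ℕ) : Prop :=
  ∀ lam s, ∃ J : Finset (Fin (𝓕.n lam)), J.card ≤ τ lam ∧
    ∀ x x' : Fin (𝓕.n lam) → Bool, (∀ j ∈ J, x j = x' j) → 𝓕.F lam s x = 𝓕.F lam s x'

/-- The lengths `ℓ(λ)`, `n(λ)` and the values `F_s(x)` can be computed in polynomial time. -/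
def IsEfficient (nonuniform : Bool) : Prop :=
  IsConstructible nonuniform 𝓕.ℓ ∧ IsConstructible nonuniform 𝓕.n ∧
  IsPolyTime nonuniform (I := fun lam => (Fin (𝓕.ℓ lam) → Bool) × (Fin (𝓕.n lam) → Bool))
    (fun _ i => [Data.ofBits (List.ofFn i.1), Data.ofBits (List.ofFn i.2)])
    (fun lam i => Data.ofBool (𝓕.F lam i.1 i.2))

/-- Weak pseudorandom function families with noise level `q`: no efficient adversary, given `1^λ`
and `1^{n(λ)}`, distinguishes the oracle whose answers are samples `(x, F_s(x) ⊕ e)`, for a random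
`s`, from the oracle whose answers are (noiseless) samples `(x, f(x))`, for a uniformly random
function `f`. -/
def IsWeakPRF (nonuniform : Bool) (q : ℝ) : Prop :=
  ∀ A : Adversary,
    A.IsPPT nonuniform (fun lam => [Data.unary (𝓕.n lam)]) (fun lam => 𝓕.n lam + 1) →
    Negligible fun lam =>
      |(((unifBits (𝓕.ℓ lam)).bind fun s =>
            A.outputBit (fun lam => [Data.unary (𝓕.n lam)]) lam
              fun _ => noisySample q (𝓕.F lam s)) true).toReal
        - (((PMF.uniformOfFintype ((Fin (𝓕.n lam) → Bool) → Bool)).bind fun f =>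
            A.outputBit (fun lam => [Data.unary (𝓕.n lam)]) lam
              fun _ => noisySample 0 f) true).toReal|

end FunctionFamily

/-! ### The construction -/

/-- `k` independent samples. -/
noncomputable def iid {α : Type} (μ : PMF α) : ℕ → PMF (List α)
  | 0 => PMF.pure []
  | k + 1 => μ.bind fun a => (iid μ k).map fun l => a :: l

/-- The block length `N = 3 m (n + 1)²`. -/
def blockLength (n m : ℕ) : ℕ := 3 * m * (n + 1) ^ 2

/-- The threshold of the decoder: `m/2 + ln(m) √m`. -/
noncomputable def threshold (m : ℕ) : ℝ := (m : ℝ) / 2 + Real.log m * Real.sqrt m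

/-- Secret keys `(s, z, π)`. -/
abbrev PRFKey (ℓ N : ℕ) : Type := (Fin ℓ → Bool) × (Fin N → Bool) × Equiv.Perm (Fin N)

/-- Representation of `(s, z, π)` as a bit string: the bits of `s`, the bits of `z`, and the
permutation matrix of `π`, row by row. -/
def keyBits {ℓ N : ℕ} (sk : PRFKey ℓ N) : List Bool :=
  List.ofFn sk.1 ++ (List.ofFn sk.2.1 ++
    (List.ofFn fun i => List.ofFn fun j => decide (sk.2.2 i = j)).flatten)

/-- `π ∘ (a ⊕ z)` with `a = ((x₁, f(x₁) ⊕ e₁), …, (x_m, f(x_m) ⊕ e_m), r)`. -/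
noncomputable def encode (q : ℝ) {n : ℕ} (m : ℕ) {N : ℕ} (f : (Fin n → Bool) → Bool)
    (z : Fin N → Bool) (π : Equiv.Perm (Fin N)) : PMF (Fin N → Bool) :=
  (iid (noisySample q f) m).bind fun blocks =>
    (unifBits (N - (n + 1) * m)).map fun r =>
      let a : List Bool := blocks.flatten ++ List.ofFn r
      fun i => xor (a.getD (π i) false) (z (π i))

/-- The number `W` of indices `j` with `w_j = f(x_j)`, where
`((x₁, w₁), …, (x_m, w_m))` is the beginning of `(π⁻¹ ∘ y) ⊕ z`. -/
def agreement {n : ℕ} (m : ℕ) {N : ℕ} (f : (Fin n → Bool) → Bool)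
    (z : Fin N → Bool) (π : Equiv.Perm (Fin N)) (y : List Bool) : ℕ :=
  let u : List Bool := List.ofFn fun j : Fin N => xor (y.getD (π.symm j) false) (z j)
  (Finset.univ.filter fun j : Fin m =>
    u.getD ((n + 1) * j + n) false = f fun i => u.getD ((n + 1) * j + i) false).card

open Classical in
/-- The code `PRF-PRC[𝓕, p, q]`, whose dependence on `p` is through the number `m` of blocks. Strings
that do not have the length of a codeword are rejected by the decoder. -/
noncomputable def prfPRC (𝓕 : FunctionFamily) (q : ℝ) (m : ℕ → ℕ) : SecretKeyCode where
  SK lam := PRFKey (𝓕.ℓ lam) (blockLength (𝓕.n lam) (m lam))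
  lsk lam := 𝓕.ℓ lam + (blockLength (𝓕.n lam) (m lam) + blockLength (𝓕.n lam) (m lam) ^ 2)
  k _ := 0
  n lam := blockLength (𝓕.n lam) (m lam)
  skBits _ sk := keyBits sk
  Key lam := PMF.uniformOfFintype (PRFKey (𝓕.ℓ lam) (blockLength (𝓕.n lam) (m lam)))
  Enc lam sk _ := encode q (m lam) (𝓕.F lam sk.1) sk.2.1 sk.2.2
  Dec lam sk y := PMF.pure
    (if y.length = blockLength (𝓕.n lam) (m lam) ∧
        threshold (m lam) < agreement (m lam) (𝓕.F lam sk.1) sk.2.1 sk.2.2 y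
      then some Fin.elim0 else none)

end PRFCode

/-!
The three algorithms have to be exhibited as programs with polynomial step counts, and three
probabilistic statements have to be proved about them.

*Efficiency.* A fragment `Prog` computes a value from variables that are held in registers, and `Ev`
states the law of that value together with a bound for the number of steps. The fragments compose
(`Ev.bind`, `Ev.ite`, `Ev.fold`), and a given program with oracle calls can be run inside a fragment
that answers the calls (`Ev.call`). `PEv` is the asymptotic version, with a polynomial step count. In
this calculus the algorithms are short functional programs (`Prog.key`, `Prog.enc`, `Prog.dec`). A
permutation is sampled by drawing the entries of a list one after the other, and fair bits are drawn
from a list of two entries, since the coin of the code is biased.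

*Undetectability.* The encoder uses the function `F_s` only through noisy samples, so that an adversary
against the code is turned into one against the function family, which draws `z` and `π` itself
(`exists_simulation`). Uniformly random samples are encoded as uniformly random strings
(`blockOracle_unif`). It remains to replace the samples of a random function by uniformly random ones;
a program with `t` steps notices the difference only if a point is drawn twice, which has probability
at most `t² / 2^n` (`abs_run_randomFunction_sub_le`).

*Soundness.* As `z` is uniform, the decoder sees a uniformly random string, in which the number of valid
blocks is a sum of `m` fair coins. It exceeds `m/2 + ln(m) √m` with probability at most
`exp(-2 ln(m)²)` (`expect_agreements_uniform_le`).

*Robustness.* As `z` is uniform, the codeword is uniformly random and independent of `π` and of the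
blocks, hence so are the positions of the errors which the channel makes (`expect_decode_le`). For
random `π` the errors in the blocks are a randomly permuted string of some weight `w ≤ pN`. Its law is
dominated by `N + 1` times that of independent bits of bias `w / N`, because the binomial distribution
with mean `w` has its mode at `w` (`expect_perm_le`). Independent noise of rate `ρ ≤ p` keeps the value
of a function of `k` bits with bias `(1 - 2ρ)^k` (`le_stability_self`), so that each block is valid with
probability at least `(1 + b) / 2` for `b = (1 - 2q)(1 - 2p)^(k + 1)`. With `k ≤ log n`, the lower bound
for `m` gives `b ≥ (1 - 2p) m^(-1/4)` (`bias_le`). Hence the expected number of valid blocks exceeds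
`m/2` by the order of `m^(3/4)`, which is more than the threshold requires, and the exponential moment
method bounds the failure probability by `(N + 1) exp(-c √m)` (`expect_agreements_noise_le`,
`exponent_le`). For weakly bounded channels, the probability of too many substitutions in a uniformly
random string is added.
-/

namespace PRFCode

open Function

/-! ### Big-step reasoning about programs -/

theorem bind_congr_support {α β : Type*} (p : PMF α) {f g : α → PMF β}
    (h : ∀ a ∈ p.support, f a = g a) : p.bind f = p.bind g := by
  ext b
  simp only [PMF.bind_apply]
  refine tsum_congr fun a => ?_
  by_cases ha : a ∈ p.support
  · rw [h a ha]
  · rw [PMF.mem_support_iff, not_not] at ha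
    simp [ha]

/-- From the configuration `C` the computation always halts within `t` steps, and then register `0`
has law `ν`. -/
def Halts (β : ℝ) (O : Oracle) (C : Config) (t : ℕ) (ν : PMF Data) : Prop :=
  (∀ C' ∈ (run β O t C).support, C'.1 = []) ∧ (run β O t C).map (fun C' => C'.2 0) = ν

section Halts

variable {β : ℝ} {O : Oracle}

/-- The first step of a computation: `κ` gives the law of the output from the configuration reached. -/
theorem halts_succ {C : Config} {t : ℕ} {ν : PMF Data} :
    Halts β O C (t + 1) ν ↔ ∃ κ : Config → PMF Data,
      (∀ C' ∈ (step β O C).support, Halts β O C' t (κ C')) ∧ (step β O C).bind κ = ν := by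
  constructor
  · rintro ⟨h1, h2⟩
    refine ⟨fun C' => (run β O t C').map fun C' => C'.2 0, fun C' hC' => ⟨fun D hD => h1 D ?_, rfl⟩, ?_⟩
    · rw [run, PMF.mem_support_bind_iff]
      exact ⟨C', hC', hD⟩
    · rw [← h2, run, PMF.map_bind]
  · rintro ⟨κ, h1, rfl⟩
    refine ⟨fun D hD => ?_, ?_⟩
    · rw [run, PMF.mem_support_bind_iff] at hD
      obtain ⟨C', hC', hD⟩ := hD
      exact (h1 C' hC').1 D hD
    · rw [run, PMF.map_bind]
      exact bind_congr_support _ fun C' hC' => (h1 C' hC').2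

theorem halts_nil (σ : Store) (t : ℕ) : Halts β O ([], σ) t (PMF.pure (σ 0)) := by
  induction t with
  | zero => simp [Halts, run, PMF.pure_map]
  | succ t ih =>
    rw [halts_succ]
    exact ⟨fun C => PMF.pure (C.2 0), by simpa [step] using ih, by simp [step]⟩

theorem Halts.succ {C : Config} {t : ℕ} {ν : PMF Data} (h : Halts β O C t ν) :
    Halts β O C (t + 1) ν := by
  induction t generalizing C ν with
  | zero =>
    obtain ⟨cs, σ⟩ := C
    have h1 : cs = [] := by simpa [run] using h.1
    have h2 : PMF.pure (σ 0) = ν := by simpa [run, PMF.pure_map] using h.2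
    subst h1 h2
    exact halts_nil _ _
  | succ t ih =>
    rw [halts_succ] at h ⊢
    obtain ⟨κ, h1, h2⟩ := h
    exact ⟨κ, fun C' hC' => ih (h1 C' hC'), h2⟩

theorem Halts.mono {C : Config} {t t' : ℕ} {ν : PMF Data} (h : Halts β O C t ν) (ht : t ≤ t') :
    Halts β O C t' ν := by
  induction t', ht using Nat.le_induction with
  | base => exact h
  | succ n _ ih => exact ih.succ

theorem halts_of_step_map {C : Config} {t : ℕ} {α : Type} (μ : PMF α) (g : α → Config)
    {κ : α → PMF Data} (hs : step β O C = μ.map g)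
    (h : ∀ a ∈ μ.support, Halts β O (g a) t (κ a)) : Halts β O C (t + 1) (μ.bind κ) := by
  have hμ : ∀ a ∈ μ.support, g a ∈ (step β O C).support := fun a ha => by
    rw [hs, PMF.support_map]
    exact ⟨a, ha, rfl⟩
  rw [halts_succ]
  refine ⟨fun C' => (run β O t C').map fun C' => C'.2 0, fun C' hC' => ?_, ?_⟩
  · rw [hs, PMF.support_map] at hC'
    obtain ⟨a, ha, rfl⟩ := hC'
    exact ⟨(h a ha).1, rfl⟩
  · rw [hs, PMF.bind_map]
    exact bind_congr_support _ fun a ha => (h a ha).2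

theorem halts_of_step_pure {C C' : Config} {t : ℕ} {ν : PMF Data} (hs : step β O C = PMF.pure C')
    (h : Halts β O C' t ν) : Halts β O C (t + 1) ν := by
  rw [halts_succ]
  exact ⟨fun _ => ν, by simpa [hs] using h, by simp [hs]⟩

theorem halts_seq {c d : Cmd} {k : List Cmd} {σ : Store} {t : ℕ} {ν : PMF Data}
    (h : Halts β O (c :: d :: k, σ) t ν) : Halts β O (.seq c d :: k, σ) (t + 1) ν :=
  halts_of_step_pure rfl h

theorem halts_copy {x y : ℕ} {k : List Cmd} {σ : Store} {t : ℕ} {ν : PMF Data}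
    (h : Halts β O (k, update σ x (σ y)) t ν) : Halts β O (.copy x y :: k, σ) (t + 1) ν :=
  halts_of_step_pure rfl h

end Halts

/-- A program fragment that computes a value in an environment of `k` variables: the variables are
the registers `0, …, k - 1`, the value is put into register `k`, and the registers above `k` are
scratch space. -/
abbrev Prog : Type := ℕ → Cmd

/-- In the environment `env` of `k` variables the fragment `t` takes at most `T` steps, leaves the
variables alone, and computes a value of law `μ`. The formulation in terms of continuations hides
what is left in the scratch registers. -/
def Ev (β : ℝ) (O : Oracle) (t : Prog) (k : ℕ) (env : Store) (T : ℕ) (μ : PMF Data) : Prop :=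
  ∀ σ : Store, (∀ i < k, σ i = env i) → ∀ (cont : List Cmd) (s : ℕ) (ν : Data → PMF Data),
    (∀ v ∈ μ.support, ∀ σ' : Store, (∀ i < k, σ' i = env i) → σ' k = v →
      Halts β O (cont, σ') s (ν v)) →
    Halts β O (t k :: cont, σ) (T + s) (μ.bind ν)

namespace Prog

/-- The value of the variable `x`. -/
def var (x : ℕ) : Prog := fun k => .copy k x
def nil : Prog := fun k => .setNil k
def cons (x y : ℕ) : Prog := fun k => .cons k x y
def hd (x : ℕ) : Prog := fun k => .hd k x
def tl (x : ℕ) : Prog := fun k => .tl k x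
def coin : Prog := fun k => .coin k
def choose (x : ℕ) : Prog := fun k => .choose k x
def query (x : ℕ) : Prog := fun k => .query k x
/-- The value of `a` if the variable `x` is not `nil`, and that of `b` otherwise. -/
def ite (x : ℕ) (a b : Prog) : Prog := fun k => .ite x (a k) (b k)

/-- `let x := a; b x`; the new variable `x` is the register `k`. -/
def bind (a : Prog) (b : ℕ → Prog) : Prog := fun k =>
  .seq (a k) (.seq (b k (k + 1)) (.copy k (k + 1)))

/-- Fold over the list `x`, starting from the value `y`. The body sees three new variables: the
register `k` holds the remaining list, `k + 1` the accumulated value and `k + 2` the current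
entry. -/
def fold (x y : ℕ) (body : ℕ → Prog) : Prog := fun k =>
  .seq (.copy k x) (.seq (.copy (k + 1) y) (.seq
    (.while k (.seq (.hd (k + 2) k) (.seq (.tl k k) (.seq (body k (k + 3)) (.copy (k + 1) (k + 3))))))
    (.copy k (k + 1))))

end Prog

/-- A fold with random steps. -/
noncomputable def foldP {S A : Type} (f : S → A → PMF S) : S → List A → PMF S
  | s, [] => PMF.pure s
  | s, a :: l => (f s a).bind fun s' => foldP f s' l

theorem foldP_append {S A : Type} (f : S → A → PMF S) (s : S) (l l' : List A) :
    foldP f s (l ++ l') = (foldP f s l).bind fun s' => foldP f s' l' := by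
  induction l generalizing s with
  | nil => simp [foldP]
  | cons a l ih => simp [foldP, ih, PMF.bind_bind]

section Ev

variable {β : ℝ} {O : Oracle} {k : ℕ} {env : Store}

theorem Ev.mono {t : Prog} {T T' : ℕ} {μ : PMF Data} (h : Ev β O t k env T μ) (hT : T ≤ T') :
    Ev β O t k env T' μ :=
  fun σ hσ cont s ν hν => (h σ hσ cont s ν hν).mono (by omega)

/-- A fragment that consists of a single command. -/
theorem ev_of_step {t : Prog} {μ : PMF Data}
    (h : ∀ σ : Store, (∀ i < k, σ i = env i) → ∀ cont,
      step β O (t k :: cont, σ) = μ.map fun v => (cont, update σ k v)) : Ev β O t k env 1 μ := by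
  intro σ hσ cont s ν hν
  rw [add_comm]
  refine halts_of_step_map μ _ (h σ hσ cont) fun v hv => hν v hv _ (fun i hi => ?_) (by simp)
  rw [update_of_ne hi.ne, hσ i hi]

theorem Ev.bind {a : Prog} {b : ℕ → Prog} {Ta Tb : ℕ} {μ : PMF Data} {ν : Data → PMF Data}
    (ha : Ev β O a k env Ta μ)
    (hb : ∀ v ∈ μ.support, Ev β O (b k) (k + 1) (update env k v) Tb (ν v)) :
    Ev β O (Prog.bind a b) k env (Ta + Tb + 3) (μ.bind ν) := by
  intro σ hσ cont s κ hκ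
  rw [PMF.bind_bind]
  have := ha σ hσ (.seq (b k (k + 1)) (.copy k (k + 1)) :: cont) (Tb + (s + 1) + 1)
    (fun v => (ν v).bind κ) (fun v hv σ' hσ' hv' => ?_)
  · exact (halts_seq this).mono (by omega)
  · refine halts_seq ?_
    refine hb v hv σ' (fun i hi => ?_) _ _ _ fun w hw σ'' hσ'' hw' => ?_
    · rcases Nat.lt_succ_iff_lt_or_eq.1 hi with hi | rfl
      · rw [update_of_ne hi.ne, hσ' i hi]
      · simpa using hv'
    · refine halts_copy (hκ w ?_ _ (fun i hi => ?_) ?_)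
      · rw [PMF.mem_support_bind_iff]
        exact ⟨v, hv, hw⟩
      · rw [update_of_ne hi.ne, hσ'' i (by omega), update_of_ne hi.ne]
      · simp [hw']

theorem Ev.ite {x : ℕ} (hx : x < k) {a b : Prog} {T : ℕ} {μ : PMF Data}
    (h : Ev β O (if (env x).toBool then a else b) k env T μ) :
    Ev β O (Prog.ite x a b) k env (T + 1) μ := by
  intro σ hσ cont s ν hν
  have := h σ hσ cont s ν hν
  refine Halts.mono (halts_of_step_pure (C' := ((if (env x).toBool then a else b) k :: cont, σ)) ?_ this)
    (by omega)
  simp only [Prog.ite, step, hσ x hx]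
  split <;> rfl

/-- A fold is correct if its body is, for each entry of the list and all accumulated values that can
occur there. The constants count the commands that move data around. -/
theorem Ev.fold {S A : Type} {rep : S → Data} {repA : A → Data} {f : S → A → PMF S} {x y : ℕ}
    (hx : x < k) (hy : y < k) {body : ℕ → Prog} {T : ℕ} {l : List A} {s₀ : S}
    (ex : env x = Data.ofList (l.map repA)) (ey : env y = rep s₀)
    (hb : ∀ rem pre a post, pre ++ a :: post = l → ∀ s ∈ (foldP f s₀ pre).support,
      Ev β O (body k) (k + 3)
        (update (update (update env k rem) (k + 1) (rep s)) (k + 2) (repA a)) T ((f s a).map rep)) :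
    Ev β O (Prog.fold x y body) k env (l.length * (T + 8) + 10) ((foldP f s₀ l).map rep) := by
  set loop : Cmd := .while k (.seq (.hd (k + 2) k)
    (.seq (.tl k k) (.seq (body k (k + 3)) (.copy (k + 1) (k + 3))))) with hloop
  -- the loop, started with an arbitrary remaining list and accumulated value
  have key : ∀ (l₁ l₂ : List A), l₁ ++ l₂ = l → ∀ s₁ ∈ (foldP f s₀ l₁).support, ∀ (σ : Store),
      (∀ i < k, σ i = env i) →
      σ k = Data.ofList (l₂.map repA) → σ (k + 1) = rep s₁ →
      ∀ (cont : List Cmd) (s : ℕ) (ν : S → PMF Data),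
        (∀ v ∈ (foldP f s₁ l₂).support, ∀ σ' : Store, (∀ i < k, σ' i = env i) → σ' (k + 1) = rep v →
          Halts β O (cont, σ') s (ν v)) →
        Halts β O (loop :: cont, σ) (l₂.length * (T + 8) + 1 + s) ((foldP f s₁ l₂).bind ν) := by
    intro l₁ l₂
    induction l₂ generalizing l₁ with
    | nil =>
      intro hl s₁ hs₁ σ hσ hk hk1 cont s ν hν
      have h0 : step β O (loop :: cont, σ) = PMF.pure (cont, σ) := by
        simp [hloop, step, hk, Data.ofList, Data.toBool]
      have := hν s₁ (by simp [foldP]) σ hσ hk1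
      refine Halts.mono (halts_of_step_pure h0 (ν := (foldP f s₁ []).bind ν) (t := s) ?_)
        (by simp)
      simpa [foldP] using this
    | cons a l₂ ih =>
      intro hl s₁ hs₁ σ hσ hk hk1 cont s ν hν
      have hs₁' : ∀ s' ∈ (f s₁ a).support, s' ∈ (foldP f s₀ (l₁ ++ [a])).support := by
        intro s' hs'
        rw [foldP_append, PMF.mem_support_bind_iff]
        exact ⟨s₁, hs₁, by simpa [foldP] using hs'⟩
      have h0 : step β O (loop :: cont, σ) = PMF.pure (.seq (.hd (k + 2) k)
          (.seq (.tl k k) (.seq (body k (k + 3)) (.copy (k + 1) (k + 3)))) :: loop :: cont, σ) := by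
        simp [hloop, step, hk, Data.ofList, Data.toBool]
      have h1 : Halts β O (loop :: cont, σ)
          ((T + (l₂.length * (T + 8) + 1 + s + 1)) + 1 + 1 + 1 + 1 + 1 + 1)
          ((foldP f s₁ (a :: l₂)).bind ν) := by
        refine halts_of_step_pure h0 (halts_seq ?_)
        refine halts_of_step_pure rfl (halts_seq ?_)
        refine halts_of_step_pure rfl (halts_seq ?_)
        rw [foldP, PMF.bind_bind]
        have := hb (Data.ofList (l₂.map repA)) l₁ a l₂ hl s₁ hs₁
          (update (update σ (k + 2) (σ k).hd) k ((update σ (k + 2) (σ k).hd) k).tl) ?_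
          (.copy (k + 1) (k + 3) :: loop :: cont) (l₂.length * (T + 8) + 1 + s + 1)
          -- As `rep` need not be injective, the law of what follows is given in terms of the tree
          -- `d` that represents the accumulated value: run the loop from some store with that tree.
          (fun d => (run β O (l₂.length * (T + 8) + 1 + s)
            (loop :: cont, update (update (fun i => if i < k then env i else Data.nil) k
              (Data.ofList (l₂.map repA))) (k + 1) d)).map fun C => C.2 0) ?_
        · rw [PMF.bind_map] at this
          convert this using 1
          refine bind_congr_support _ fun s' hs' => ?_
          refine (ih (l₁ ++ [a]) (by simpa using hl) s' (hs₁' s' hs') _ ?_ ?_ ?_ cont s ν ?_).2.symm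
          · intro i hi
            rw [update_of_ne (by omega), update_of_ne (by omega), if_pos hi]
          · rw [update_of_ne (by omega), update_self]
          · simp
          · intro v hv
            refine hν v ?_
            rw [foldP, PMF.mem_support_bind_iff]
            exact ⟨s', hs', hv⟩
        · intro i hi
          rcases (by omega : i < k ∨ i = k ∨ i = k + 1 ∨ i = k + 2) with h | rfl | rfl | rfl
          · simp (disch := omega) [hσ i h]
          · simp [hk, Data.ofList, Data.tl]
          · simp [hk1]
          · simp [hk, Data.ofList, Data.hd]
        · intro v hv σ' hσ' hv'
          rw [PMF.support_map] at hv
          obtain ⟨s', hs', rfl⟩ := hv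
          have hsub : ∀ v ∈ (foldP f s' l₂).support, v ∈ (foldP f s₁ (a :: l₂)).support := by
            intro v hv
            rw [foldP, PMF.mem_support_bind_iff]
            exact ⟨s', hs', hv⟩
          refine halts_copy ?_
          have e := (ih (l₁ ++ [a]) (by simpa using hl) s' (hs₁' s' hs') (update (update (fun i => if i < k then env i else Data.nil) k
              (Data.ofList (l₂.map repA))) (k + 1) (rep s')) ?_ ?_ ?_ cont s ν
              fun v hv => hν v (hsub v hv)).2
          · rw [e]
            refine ih (l₁ ++ [a]) (by simpa using hl) s' (hs₁' s' hs') _ ?_ ?_ ?_ cont s ν fun v hv => hν v (hsub v hv)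
            · intro i hi
              rw [update_of_ne (by omega), hσ' i (by omega)]
              simp (disch := omega)
            · rw [update_of_ne (by omega), hσ' k (by omega)]
              simp (disch := omega)
            · simp [hv']
          · intro i hi
            rw [update_of_ne (by omega), update_of_ne (by omega), if_pos hi]
          · rw [update_of_ne (by omega), update_self]
          · simp
      refine h1.mono ?_
      simp only [List.length_cons]
      ring_nf
      omega
  intro σ hσ cont s ν hν
  have h1 : Halts β O (Prog.fold x y body k :: cont, σ)
      (l.length * (T + 8) + 1 + (s + 1) + 1 + 1 + 1 + 1 + 1) (((foldP f s₀ l).map rep).bind ν) := by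
    refine halts_seq (halts_copy (halts_seq (halts_copy (halts_seq ?_))))
    rw [PMF.bind_map]
    refine key [] l rfl s₀ (by simp [foldP]) _ ?_ ?_ ?_ _ _ _ ?_
    · intro i hi
      rw [update_of_ne (by omega), update_of_ne (by omega), hσ i hi]
    · simp [hσ x hx, ex]
    · rw [update_self, update_of_ne (by omega), hσ y hy, ey]
    · intro v hv σ' hσ' hv'
      refine halts_copy (hν _ ?_ _ (fun i hi => ?_) ?_)
      · rw [PMF.support_map]
        exact ⟨v, hv, rfl⟩
      · rw [update_of_ne (by omega), hσ' i hi]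
      · simp [hv']
  exact h1.mono (by omega)

end Ev

/-! ### Running a program inside another one -/

/-- A number that exceeds all registers of a program. -/
def Cmd.width : Cmd → ℕ
  | .setNil x => x + 1
  | .copy x y => max (x + 1) (y + 1)
  | .cons x y z => max (x + 1) (max (y + 1) (z + 1))
  | .hd x y => max (x + 1) (y + 1)
  | .tl x y => max (x + 1) (y + 1)
  | .coin x => x + 1
  | .choose x y => max (x + 1) (y + 1)
  | .query x y => max (x + 1) (y + 1)
  | .seq c d => max c.width d.width
  | .ite x c d => max (x + 1) (max c.width d.width)
  | .while x c => max (x + 1) c.width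

/-- The program on the registers `k, …, k + K - 1` in which every oracle call is replaced by the
fragment `qp`, which uses the registers from `k + K` on as its scratch space. -/
def Cmd.embed (k K : ℕ) (qp : Prog) : Cmd → Cmd
  | .setNil x => .setNil (k + x)
  | .copy x y => .copy (k + x) (k + y)
  | .cons x y z => .cons (k + x) (k + y) (k + z)
  | .hd x y => .hd (k + x) (k + y)
  | .tl x y => .tl (k + x) (k + y)
  | .coin x => .coin (k + x)
  | .choose x y => .choose (k + x) (k + y)
  | .query x _ => .seq (qp (k + K)) (.copy (k + x) (k + K))
  | .seq c d => .seq (c.embed k K qp) (d.embed k K qp)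
  | .ite x c d => .ite (k + x) (c.embed k K qp) (d.embed k K qp)
  | .while x c => .while (k + x) (c.embed k K qp)

section embed

variable {β : ℝ} {O₁ O₂ : Oracle} {k K M : ℕ} {qp : Prog} {env : Store}

/-- The embedded program simulates the original one if the fragment `qp` simulates its oracle. -/
theorem halts_embed (hK : 0 < K)
    (hq : ∀ σ : Store, (∀ i < k, σ i = env i) → ∀ y < K,
      Ev β O₂ qp (k + K) σ M ((O₁ (σ (k + y))).map Data.ofBits))
    {t : ℕ} {cs : List Cmd} {τ σ : Store} {μ : PMF Data} (h : Halts β O₁ (cs, τ) t μ)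
    (hcs : ∀ c ∈ cs, c.width ≤ K) (hσ : ∀ i < k, σ i = env i) (hστ : ∀ i < K, σ (k + i) = τ i)
    (cont : List Cmd) (s : ℕ) (ν : Data → PMF Data)
    (hν : ∀ v ∈ μ.support, ∀ σ' : Store, (∀ i < k, σ' i = env i) → σ' k = v →
      Halts β O₂ (cont, σ') s (ν v)) :
    Halts β O₂ (cs.map (Cmd.embed k K qp) ++ cont, σ) (t * (M + 2) + s) (μ.bind ν) := by
  induction t generalizing cs τ σ μ with
  | zero =>
    have h1 : cs = [] := by simpa [run] using h.1
    have h2 : PMF.pure (τ 0) = μ := by simpa [run, PMF.pure_map] using h.2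
    subst h1 h2
    simpa using hν (τ 0) (by simp) σ hσ (by simpa using hστ 0 hK)
  | succ t ih =>
    rw [halts_succ] at h
    obtain ⟨κ, h1, rfl⟩ := h
    have hν' : ∀ C ∈ (step β O₁ (cs, τ)).support, ∀ v ∈ (κ C).support, ∀ σ' : Store,
        (∀ i < k, σ' i = env i) → σ' k = v → Halts β O₂ (cont, σ') s (ν v) :=
      fun C hC v hv => hν v ((PMF.mem_support_bind_iff _ _ _).2 ⟨C, hC, hv⟩)
    -- one step without random choices
    have pureCase : ∀ (C' : Config) (C₂ : Config), step β O₁ (cs, τ) = PMF.pure C' →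
        step β O₂ (cs.map (Cmd.embed k K qp) ++ cont, σ) = PMF.pure C₂ →
        C₂.1 = C'.1.map (Cmd.embed k K qp) ++ cont →
        (∀ c ∈ C'.1, c.width ≤ K) → (∀ i < k, C₂.2 i = env i) →
        (∀ i < K, C₂.2 (k + i) = C'.2 i) →
        Halts β O₂ (cs.map (Cmd.embed k K qp) ++ cont, σ) ((t + 1) * (M + 2) + s)
          (((step β O₁ (cs, τ)).bind κ).bind ν) := by
      rintro ⟨cs', τ'⟩ ⟨cs₂, σ₂⟩ e1 e2 e3 e4 e5 e6
      have hC : (cs', τ') ∈ (step β O₁ (cs, τ)).support := by simp [e1]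
      have := ih (h1 _ hC) e4 e5 e6 (hν' _ hC)
      rw [e1, PMF.pure_bind]
      simp only at e3
      rw [← e3] at this
      refine (halts_of_step_pure e2 this).mono ?_
      ring_nf; omega
    -- one step that sets a register, deterministically or to a random value
    have setCase : ∀ (α : Type) (p : PMF α) (g : α → Data) (x : ℕ) (cs' : List Cmd), x < K →
        (∀ c ∈ cs', c.width ≤ K) →
        step β O₁ (cs, τ) = p.map (fun a => (cs', update τ x (g a))) →
        step β O₂ (cs.map (Cmd.embed k K qp) ++ cont, σ) =
          p.map (fun a => (cs'.map (Cmd.embed k K qp) ++ cont, update σ (k + x) (g a))) →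
        Halts β O₂ (cs.map (Cmd.embed k K qp) ++ cont, σ) ((t + 1) * (M + 2) + s)
          (((step β O₁ (cs, τ)).bind κ).bind ν) := by
      intro α p g x cs' hx e4 e1 e2
      rw [e1, PMF.bind_map, PMF.bind_bind]
      have hC : ∀ a ∈ p.support, (cs', update τ x (g a)) ∈ (step β O₁ (cs, τ)).support :=
        fun a ha => by rw [e1, PMF.support_map]; exact ⟨a, ha, rfl⟩
      refine Halts.mono (halts_of_step_map p _ e2 fun a ha => ih (h1 _ (hC a ha)) e4 ?_ ?_
        (hν' _ (hC a ha))) (by ring_nf; omega)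
      · intro i hi
        rw [update_of_ne (by omega), hσ i hi]
      · intro i hi
        by_cases hix : i = x
        · simp [hix]
        · rw [update_of_ne (by omega), update_of_ne hix, hστ i hi]
    match cs with
    | [] =>
      have hC : ([], τ) ∈ (step β O₁ ([], τ)).support := by simp [step]
      have := ih (h1 _ hC) (by simp) hσ hστ (hν' _ hC)
      simp only [step, PMF.pure_bind]
      exact this.mono (by ring_nf; omega)
    | c :: cs =>
      have hcs' : ∀ c ∈ cs, c.width ≤ K := fun c hc => hcs c (by simp [hc])
      have hc := hcs c (by simp)
      cases c with
      | setNil x =>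
        refine setCase Unit (PMF.pure ()) (fun _ => Data.nil) x cs (by simp [Cmd.width] at hc; omega)
          hcs' ?_ ?_ <;> simp [step, PMF.pure_map, Cmd.embed]
      | copy x y =>
        simp only [Cmd.width] at hc
        refine setCase Unit (PMF.pure ()) (fun _ => τ y) x cs (by omega)
          hcs' ?_ ?_ <;> simp [step, PMF.pure_map, Cmd.embed, hστ y (by omega)]
      | cons x y z =>
        simp only [Cmd.width] at hc
        refine setCase Unit (PMF.pure ()) (fun _ => (τ y).cons (τ z)) x cs (by omega)
          hcs' ?_ ?_ <;>
          simp [step, PMF.pure_map, Cmd.embed, hστ y (by omega), hστ z (by omega)]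
      | hd x y =>
        simp only [Cmd.width] at hc
        refine setCase Unit (PMF.pure ()) (fun _ => (τ y).hd) x cs (by omega)
          hcs' ?_ ?_ <;> simp [step, PMF.pure_map, Cmd.embed, hστ y (by omega)]
      | tl x y =>
        simp only [Cmd.width] at hc
        refine setCase Unit (PMF.pure ()) (fun _ => (τ y).tl) x cs (by omega)
          hcs' ?_ ?_ <;> simp [step, PMF.pure_map, Cmd.embed, hστ y (by omega)]
      | coin x =>
        exact setCase Bool (ber β) Data.ofBool x cs (by simp [Cmd.width] at hc; omega) hcs' rfl rfl
      | choose x y =>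
        simp only [Cmd.width] at hc
        refine setCase Data (pick (τ y).toList) id x cs (by omega) hcs' rfl ?_
        simp [step, Cmd.embed, hστ y (by omega)]
      | query x y =>
        simp only [Cmd.width] at hc
        have hC : ∀ l ∈ (O₁ (τ y)).support, (cs, update τ x (Data.ofBits l)) ∈
            (step β O₁ (.query x y :: cs, τ)).support :=
          fun l hl => by rw [step, PMF.support_map]; exact ⟨l, hl, rfl⟩
        have e := hq σ hσ y (by omega)
        rw [hστ y (by omega)] at e
        -- the law of the continuation, on a store that depends on the answer only
        set τ' : Store := fun i => if i < k then env i else τ (i - k) with hτ'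
        set law : Data → PMF Data := fun d =>
          (run β O₂ (t * (M + 2) + s) (cs.map (Cmd.embed k K qp) ++ cont,
            update τ' (k + x) d)).map fun C => C.2 0 with hlaw
        have e3 : ∀ l ∈ (O₁ (τ y)).support, ∀ σ' : Store, (∀ i < k, σ' i = env i) →
            (∀ i < K, σ' (k + i) = update τ x (Data.ofBits l) i) →
            Halts β O₂ (cs.map (Cmd.embed k K qp) ++ cont, σ') (t * (M + 2) + s)
              ((κ (cs, update τ x (Data.ofBits l))).bind ν) := fun l hl σ' h2 h3 =>
          ih (h1 _ (hC l hl)) hcs' h2 h3 (hν' _ (hC l hl))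
        have e4 : ∀ l ∈ (O₁ (τ y)).support,
            law (Data.ofBits l) = (κ (cs, update τ x (Data.ofBits l))).bind ν := by
          intro l hl
          refine (e3 l hl _ ?_ ?_).2
          · intro i hi
            rw [update_of_ne (by omega), hτ']
            simp [hi]
          · intro i hi
            by_cases hix : i = x
            · simp [hix]
            · rw [update_of_ne (by omega), update_of_ne hix, hτ']
              simp
        have e5 := e σ (fun _ _ => rfl) (.copy (k + x) (k + K) :: (cs.map (Cmd.embed k K qp) ++ cont))
          (t * (M + 2) + s + 1) law ?_
        · rw [PMF.bind_map] at e5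
          rw [step, PMF.bind_map, PMF.bind_bind]
          have e6 := halts_seq e5
          rw [show (O₁ (τ y)).bind (law ∘ Data.ofBits) = (O₁ (τ y)).bind
            (fun a => ((κ ∘ fun l => (cs, update τ x (Data.ofBits l))) a).bind ν) from
            bind_congr_support _ e4] at e6
          exact e6.mono (by ring_nf; omega)
        · intro v hv σ' hσ' hv'
          rw [PMF.support_map] at hv
          obtain ⟨l, hl, rfl⟩ := hv
          rw [e4 l hl]
          refine halts_copy (e3 l hl _ ?_ ?_)
          · intro i hi
            rw [update_of_ne (by omega), hσ' i (by omega), hσ i hi]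
          · intro i hi
            by_cases hix : i = x
            · simp [hix, hv']
            · rw [update_of_ne (by omega), update_of_ne hix, hσ' _ (by omega), hστ i hi]
      | seq c d =>
        simp only [Cmd.width] at hc
        refine pureCase (c :: d :: cs, τ) (c.embed k K qp :: d.embed k K qp ::
          (cs.map (Cmd.embed k K qp) ++ cont), σ) rfl rfl (by simp) ?_ hσ hστ
        intro c' hc'
        simp only [List.mem_cons] at hc'
        rcases hc' with rfl | rfl | hc'
        · omega
        · omega
        · exact hcs' _ hc'
      | ite x c d =>
        simp only [Cmd.width] at hc
        refine pureCase ((if (τ x).toBool then c else d) :: cs, τ)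
          ((if (τ x).toBool then c else d).embed k K qp :: (cs.map (Cmd.embed k K qp) ++ cont), σ)
          rfl ?_ (by simp) ?_ hσ hστ
        · simp only [List.map_cons, List.cons_append, Cmd.embed, step, hστ x (by omega)]
          split <;> rfl
        · intro c' hc'
          simp only [List.mem_cons] at hc'
          rcases hc' with rfl | hc'
          · split <;> omega
          · exact hcs' _ hc'
      | _ =>
        rename_i x c
        simp only [Cmd.width] at hc
        refine pureCase (if (τ x).toBool then c :: .while x c :: cs else cs, τ)
          ((if (τ x).toBool then c :: .while x c :: cs else cs).map (Cmd.embed k K qp) ++ cont, σ)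
          rfl ?_ (by simp) ?_ hσ hστ
        · simp only [List.map_cons, List.cons_append, Cmd.embed, step, hστ x (by omega)]
          split <;> rfl
        · intro c' hc'
          simp only at hc'
          split at hc'
          · simp only [List.mem_cons] at hc'
            rcases hc' with rfl | rfl | hc'
            · omega
            · simp only [Cmd.width]; omega
            · exact hcs' _ hc'
          · exact hcs' _ hc'

end embed

/-- Loads the variables `args` into the registers `k, k + 1, …`, and clears the following ones, up
to `k + J - 1`. -/
def loadArgs (k : ℕ) (args : List ℕ) : ℕ → Cmd
  | 0 => .setNil k
  | J + 1 => .seq (loadArgs k args J)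
      (match args[J]? with
        | some x => .copy (k + J) x
        | none => .setNil (k + J))

theorem halts_loadArgs {β : ℝ} {O : Oracle} {k : ℕ} {args : List ℕ} (hargs : ∀ x ∈ args, x < k)
    {env : Store} (J : ℕ) (σ : Store) (hσ : ∀ i < k, σ i = env i) (cont : List Cmd) (s : ℕ)
    (ν : PMF Data)
    (h : ∀ σ' : Store, (∀ i < k, σ' i = env i) →
      (∀ j < J, σ' (k + j) = (args.map env).getD j Data.nil) → Halts β O (cont, σ') s ν) :
    Halts β O (loadArgs k args J :: cont, σ) (2 * J + 1 + s) ν := by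
  induction J generalizing cont s with
  | zero =>
    refine Halts.mono (halts_of_step_pure rfl (h _ ?_ (by simp))) (by omega)
    intro i hi
    rw [update_of_ne hi.ne, hσ i hi]
  | succ J ih =>
    refine Halts.mono (halts_seq (ih _ (s + 1) fun σ' h1 h2 => ?_)) (by omega)
    cases hJ : args[J]? with
    | some x =>
      have hx : x < k := hargs x (List.mem_of_getElem? hJ)
      refine halts_copy (h _ ?_ ?_)
      · intro i hi
        rw [update_of_ne (by omega), h1 i hi]
      · intro j hj
        rcases Nat.lt_succ_iff_lt_or_eq.1 hj with hj | rfl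
        · rw [update_of_ne (by omega), h2 j hj]
        · simp [hJ, h1 x hx]
    | none =>
      refine halts_of_step_pure rfl (h _ ?_ ?_)
      · intro i hi
        rw [update_of_ne (by omega), h1 i hi]
      · intro j hj
        rcases Nat.lt_succ_iff_lt_or_eq.1 hj with hj | rfl
        · rw [update_of_ne (by omega), h2 j hj]
        · simp [hJ]

/-- Runs the program `c` with the variables `args` as its inputs; oracle calls are replaced by the
fragment `qp`. -/
def Prog.call (c : Cmd) (args : List ℕ) (qp : Prog) : Prog := fun k =>
  .seq (loadArgs k args (c.width + 1)) (c.embed k (c.width + 1) qp)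

/-- A call costs a factor `M + 2`, where `M` bounds the time it takes to answer an oracle call: one step
for the command `seq` and one to move the answer. -/
theorem Ev.call {β : ℝ} {O₁ O₂ : Oracle} {k M T : ℕ} {qp : Prog} {env : Store} {c : Cmd}
    {args : List ℕ} (hargs : ∀ x ∈ args, x < k) {μ : PMF Data}
    (h : Halts β O₁ (start c (args.map env)) T μ)
    (hq : ∀ σ : Store, (∀ i < k, σ i = env i) → ∀ y,
      Ev β O₂ qp (k + (c.width + 1)) σ M ((O₁ (σ (k + y))).map Data.ofBits)) :
    Ev β O₂ (Prog.call c args qp) k env (T * (M + 2) + (2 * (c.width + 1) + 2)) μ := by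
  intro σ hσ cont s ν hν
  have := halts_loadArgs (β := β) (O := O₂) hargs (c.width + 1) σ hσ
    (c.embed k (c.width + 1) qp :: cont) (T * (M + 2) + s) (μ.bind ν) fun σ' h1 h2 => ?_
  · exact (halts_seq this).mono (by omega)
  · have := halts_embed (K := c.width + 1) (cs := [c]) (by omega) (fun σ hσ y _ => hq σ hσ y) h
      (by simp) h1 h2 cont s ν hν
    simpa using this

/-! ### Programs without random choices -/

theorem step_deterministic (β β' : ℝ) (O O' : Oracle) {cs : List Cmd} (σ : Store)
    (h : ∀ c ∈ cs, c.IsDeterministic) :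
    ∃ C : Config, step β O (cs, σ) = PMF.pure C ∧ step β' O' (cs, σ) = PMF.pure C ∧
      ∀ c ∈ C.1, c.IsDeterministic := by
  match cs with
  | [] => exact ⟨_, rfl, rfl, by simp⟩
  | c :: cs =>
    have hcs : ∀ c ∈ cs, c.IsDeterministic := fun c hc => h c (by simp [hc])
    have hc := h c (by simp)
    cases c with
    | coin | choose | query => simp [Cmd.IsDeterministic] at hc
    | seq c d =>
      refine ⟨_, rfl, rfl, ?_⟩
      simpa [hc.1, hc.2] using hcs
    | ite x c d =>
      refine ⟨_, rfl, rfl, ?_⟩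
      simp only [List.mem_cons, forall_eq_or_imp]
      refine ⟨?_, hcs⟩
      split
      exacts [hc.1, hc.2]
    | setNil | copy | cons | hd | tl => exact ⟨_, rfl, rfl, hcs⟩
    | _ =>
      rename_i x c
      refine ⟨_, rfl, rfl, ?_⟩
      simp only
      split
      · simp only [List.mem_cons, forall_eq_or_imp]
        exact ⟨hc, hc, hcs⟩
      · exact hcs

/-- Deterministic programs run in the same way with any coin and any oracle. This makes the programs
for the function family available as fragments of randomized programs. -/
theorem run_deterministic (β β' : ℝ) (O O' : Oracle) (t : ℕ) {cs : List Cmd} (σ : Store)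
    (h : ∀ c ∈ cs, c.IsDeterministic) : run β O t (cs, σ) = run β' O' t (cs, σ) := by
  induction t generalizing cs σ with
  | zero => rfl
  | succ t ih =>
    obtain ⟨⟨cs', σ'⟩, h1, h2, h3⟩ := step_deterministic β β' O O' σ h
    rw [run, run, h1, h2, PMF.pure_bind, PMF.pure_bind, ih σ' h3]

/-! ### Polynomial-time program fragments -/

/-- `f` is bounded by a polynomial in the size. -/
def PolyB {ι : Type} (sz f : ι → ℕ) : Prop := ∃ P : Polynomial ℕ, ∀ i, f i ≤ P.eval (sz i)

section PolyB

variable {ι : Type} {sz f g : ι → ℕ}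

theorem polyEval_mono (P : Polynomial ℕ) {a b : ℕ} (h : a ≤ b) : P.eval a ≤ P.eval b := by
  rw [Polynomial.eval_eq_sum_range, Polynomial.eval_eq_sum_range]
  gcongr

theorem PolyB.const (c : ℕ) : PolyB sz fun _ => c := ⟨Polynomial.C c, by simp⟩

theorem PolyB.add (hf : PolyB sz f) (hg : PolyB sz g) : PolyB sz fun i => f i + g i := by
  obtain ⟨P, hP⟩ := hf
  obtain ⟨Q, hQ⟩ := hg
  exact ⟨P + Q, fun i => by simpa using add_le_add (hP i) (hQ i)⟩

theorem PolyB.mul (hf : PolyB sz f) (hg : PolyB sz g) : PolyB sz fun i => f i * g i := by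
  obtain ⟨P, hP⟩ := hf
  obtain ⟨Q, hQ⟩ := hg
  exact ⟨P * Q, fun i => by simpa using Nat.mul_le_mul (hP i) (hQ i)⟩

theorem PolyB.mono (hg : PolyB sz g) (h : ∀ i, f i ≤ g i) : PolyB sz f := by
  obtain ⟨P, hP⟩ := hg
  exact ⟨P, fun i => (h i).trans (hP i)⟩

theorem PolyB.comap {κ : Type} (e : κ → ι) (hf : PolyB sz f) : PolyB (sz ∘ e) (f ∘ e) := by
  obtain ⟨P, hP⟩ := hf
  exact ⟨P, fun i => hP (e i)⟩

theorem PolyB.sigma {A : ι → Type} (hf : PolyB sz f) :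
    PolyB (fun j : (i : ι) × A i => sz j.1) (fun j => f j.1) := hf.comap Sigma.fst

theorem PolyB.of_le_size {sz' : ι → ℕ} (hf : PolyB sz f) (h : ∀ i, sz i ≤ sz' i) :
    PolyB sz' f := by
  obtain ⟨P, hP⟩ := hf
  exact ⟨P, fun i => (hP i).trans (polyEval_mono P (h i))⟩

end PolyB

/-- The fragment `t`, run with the oracle `O i` in the environment `env i` of `k` variables, computes
a value of law `μ i`, in time polynomial in `sz i`. -/
def PEv (β : ℝ) {ι : Type} (sz : ι → ℕ) (O : ι → Oracle) (t : Prog) (k : ℕ) (env : ι → Store)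
    (μ : ι → PMF Data) : Prop :=
  ∃ P : Polynomial ℕ, ∀ i, Ev β (O i) t k (env i) (P.eval (sz i)) (μ i)

/-- The law of the value of a fragment can be observed by moving the value to register `0` and halting. -/
theorem Ev.law_unique {β : ℝ} {O : Oracle} {t : Prog} {k T T' : ℕ} {env : Store} {μ μ' : PMF Data}
    (h : Ev β O t k env T μ) (h' : Ev β O t k env T' μ') : μ = μ' := by
  have key : ∀ {T : ℕ} {μ : PMF Data}, Ev β O t k env T μ →
      Halts β O ([t k, .copy 0 k], env) (T + 1) μ := by
    intro T μ h
    have := h env (fun _ _ => rfl) [.copy 0 k] 1 PMF.pure fun v hv σ' hσ' hv' => halts_copy ?_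
    · simpa using this
    · have := halts_nil (β := β) (O := O) (update σ' 0 (σ' k)) 0
      simpa [hv'] using this
  rw [← ((key h).mono (show _ ≤ max T T' + 1 by omega)).2,
    ← ((key h').mono (show _ ≤ max T T' + 1 by omega)).2]

/-- The circumstances of one round of a fold over `l`: the remaining list `rem`, the entries
`pre` that have been dealt with, the current entry, and the possible accumulated values. -/
structure FoldRound {S A : Type} (f : S → A → PMF S) (s₀ : S) (l : List A) where
  rem : Data
  acc : S
  pre : List A
  cur : A
  post : List A
  eq : pre ++ cur :: post = l
  mem : acc ∈ (foldP f s₀ pre).support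

theorem FoldRound.cur_mem {S A : Type} {f : S → A → PMF S} {s₀ : S} {l : List A}
    (r : FoldRound f s₀ l) : r.cur ∈ l := 
  (congrArg (fun l' => r.cur ∈ l') r.eq).mp (by simp)

theorem FoldRound.pre_length {S A : Type} {f : S → A → PMF S} {s₀ : S} {l : List A}
    (r : FoldRound f s₀ l) : r.pre.length < l.length := by
  have := congrArg List.length r.eq
  simp at this
  omega

theorem foldP_pure {S A : Type} (g : S → A → S) (s : S) (l : List A) :
    foldP (fun s a => PMF.pure (g s a)) s l = PMF.pure (l.foldl g s) := by
  induction l generalizing s with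
  | nil => rfl
  | cons a l ih => simp [foldP, ih]

theorem FoldRound.acc_eq {S A : Type} {g : S → A → S} {s₀ : S} {l : List A}
    (r : FoldRound (fun s a => PMF.pure (g s a)) s₀ l) : r.acc = r.pre.foldl g s₀ := by
  simpa [foldP_pure] using r.mem

section PEv

variable {β : ℝ} {ι : Type} {sz : ι → ℕ} {O : ι → Oracle} {k : ℕ} {env : ι → Store}

theorem PEv.congr {t : Prog} {μ μ' : ι → PMF Data} (h : PEv β sz O t k env μ)
    (hμ : ∀ i, μ i = μ' i) : PEv β sz O t k env μ' := by
  rwa [← funext hμ]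

theorem PEv.comap {κ : Type} (e : κ → ι) {t : Prog} {μ : ι → PMF Data} (h : PEv β sz O t k env μ) :
    PEv β (fun j => sz (e j)) (fun j => O (e j)) t k (fun j => env (e j)) (fun j => μ (e j)) := by
  obtain ⟨P, hP⟩ := h
  exact ⟨P, fun i => hP (e i)⟩

theorem pev_of_step {t : Prog} {μ : ι → PMF Data}
    (h : ∀ i (σ : Store), (∀ x < k, σ x = env i x) → ∀ cont,
      step β (O i) (t k :: cont, σ) = (μ i).map fun v => (cont, update σ k v)) :
    PEv β sz O t k env μ :=
  ⟨1, fun i => (ev_of_step (h i)).mono (by simp)⟩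

theorem PEv.var {x : ℕ} (hx : x < k) {d : ι → Data} (ex : ∀ i, env i x = d i) :
    PEv β sz O (Prog.var x) k env fun i => PMF.pure (d i) :=
  pev_of_step fun i σ hσ cont => by simp [PMF.pure_map, Prog.var, step, hσ x hx, ex]

theorem PEv.nil : PEv β sz O Prog.nil k env fun _ => PMF.pure Data.nil :=
  pev_of_step fun i σ hσ cont => by simp [PMF.pure_map, Prog.nil, step]

theorem PEv.cons {x y : ℕ} (hx : x < k) (hy : y < k) {d e : ι → Data} (ex : ∀ i, env i x = d i)
    (ey : ∀ i, env i y = e i) :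
    PEv β sz O (Prog.cons x y) k env fun i => PMF.pure ((d i).cons (e i)) :=
  pev_of_step fun i σ hσ cont => by
    simp [PMF.pure_map, Prog.cons, step, hσ x hx, hσ y hy, ex, ey]

theorem PEv.hd {x : ℕ} (hx : x < k) {d : ι → Data} (ex : ∀ i, env i x = d i) :
    PEv β sz O (Prog.hd x) k env fun i => PMF.pure (d i).hd :=
  pev_of_step fun i σ hσ cont => by simp [PMF.pure_map, Prog.hd, step, hσ x hx, ex]

theorem PEv.tl {x : ℕ} (hx : x < k) {d : ι → Data} (ex : ∀ i, env i x = d i) :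
    PEv β sz O (Prog.tl x) k env fun i => PMF.pure (d i).tl :=
  pev_of_step fun i σ hσ cont => by simp [PMF.pure_map, Prog.tl, step, hσ x hx, ex]

theorem PEv.coin : PEv β sz O Prog.coin k env fun _ => (ber β).map Data.ofBool :=
  pev_of_step fun i σ hσ cont => by simp [Prog.coin, step, PMF.map_comp]; rfl

theorem PEv.choose {x : ℕ} (hx : x < k) {d : ι → Data} (ex : ∀ i, env i x = d i) :
    PEv β sz O (Prog.choose x) k env fun i => pick (d i).toList :=
  pev_of_step fun i σ hσ cont => by simp [Prog.choose, step, hσ x hx, ex]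

theorem PEv.query {x : ℕ} (hx : x < k) {d : ι → Data} (ex : ∀ i, env i x = d i) :
    PEv β sz O (Prog.query x) k env fun i => (O i (d i)).map Data.ofBits :=
  pev_of_step fun i σ hσ cont => by simp [Prog.query, step, hσ x hx, ex, PMF.map_comp]; rfl

/-- In the body the new variable holds a possible value of `a`, so that the environments are indexed by
pairs of an index and such a value. -/
theorem PEv.bind {A : ι → Type} {a : Prog} {b : ℕ → Prog} {μ : ∀ i, PMF (A i)}
    {rep : ∀ i, A i → Data} {ν : ∀ i, A i → PMF Data}
    (ha : PEv β sz O a k env fun i => (μ i).map (rep i))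
    (hb : PEv β (fun j : (i : ι) × {v : A i // v ∈ (μ i).support} => sz j.1) (fun j => O j.1) (b k)
      (k + 1) (fun j => update (env j.1) k (rep j.1 j.2)) (fun j => ν j.1 j.2)) :
    PEv β sz O (Prog.bind a b) k env fun i => (μ i).bind (ν i) := by
  classical
  obtain ⟨P, hP⟩ := ha
  obtain ⟨Q, hQ⟩ := hb
  refine ⟨P + Q + 3, fun i => ?_⟩
  have hex : ∀ d ∈ ((μ i).map (rep i)).support, ∃ v ∈ (μ i).support, rep i v = d := by
    intro d hd
    rw [PMF.support_map] at hd
    exact hd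
  set ν' : Data → PMF Data := fun d =>
    if h : d ∈ ((μ i).map (rep i)).support then ν i (hex d h).choose else PMF.pure Data.nil with hν'
  have hQ' : ∀ d ∈ ((μ i).map (rep i)).support,
      Ev β (O i) (b k) (k + 1) (update (env i) k d) (Q.eval (sz i)) (ν' d) := by
    intro d hd
    simp only [hν', dif_pos hd]
    have := hQ ⟨i, (hex d hd).choose, (hex d hd).choose_spec.1⟩
    simpa only [(hex d hd).choose_spec.2] using this
  have := (hP i).bind hQ'
  rw [PMF.bind_map] at this
  show Ev _ _ _ _ _ _ ((μ i).bind (ν i))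
  rw [← bind_congr_support (μ i) (f := ν' ∘ rep i) (g := ν i)]
  · simpa using this
  · intro v hv
    have hd : rep i v ∈ ((μ i).map (rep i)).support := by
      rw [PMF.support_map]
      exact ⟨v, hv, rfl⟩
    exact (hQ' _ hd).law_unique (hQ ⟨i, v, hv⟩)

/-- The case of `PEv.bind` in which the value of the new variable is not random. -/
theorem PEv.bindD {a : Prog} {b : ℕ → Prog} {v : ι → Data} {ν : ι → PMF Data}
    (ha : PEv β sz O a k env fun i => PMF.pure (v i))
    (hb : PEv β sz O (b k) (k + 1) (fun i => update (env i) k (v i)) ν) :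
    PEv β sz O (Prog.bind a b) k env ν := by
  obtain ⟨P, hP⟩ := ha
  obtain ⟨Q, hQ⟩ := hb
  refine ⟨P + Q + 3, fun i => ?_⟩
  have := (hP i).bind (b := b) (Tb := Q.eval (sz i)) (ν := fun _ => ν i) fun d hd => by
    rw [PMF.support_pure, Set.mem_singleton_iff] at hd
    rw [hd]
    exact hQ i
  simpa using this

theorem PEv.ite {x : ℕ} (hx : x < k) {a b : Prog} {μ : ι → PMF Data} {c : ι → Bool}
    (ec : ∀ i, (env i x).toBool = c i)
    (ha : PEv β (fun j : {i // c i = true} => sz j) (fun j => O j) a k (fun j => env j)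
      (fun j => μ j))
    (hb : PEv β (fun j : {i // c i = false} => sz j) (fun j => O j) b k (fun j => env j)
      (fun j => μ j)) : PEv β sz O (Prog.ite x a b) k env μ := by
  obtain ⟨P, hP⟩ := ha
  obtain ⟨Q, hQ⟩ := hb
  refine ⟨P + Q + 1, fun i => ?_⟩
  have : Ev β (O i) (Prog.ite x a b) k (env i) (P.eval (sz i) + Q.eval (sz i) + 1) (μ i) := by
    refine Ev.ite hx ?_
    rw [ec i]
    cases hc : c i
    · exact (hQ ⟨i, hc⟩).mono (by simp)
    · exact (hP ⟨i, hc⟩).mono (by simp)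
  simpa using this

theorem PEv.fold {S A : ι → Type} {rep : ∀ i, S i → Data} {repA : ∀ i, A i → Data}
    {f : ∀ i, S i → A i → PMF (S i)} {x y : ℕ} (hx : x < k) (hy : y < k) {body : ℕ → Prog}
    {l : ∀ i, List (A i)} {s₀ : ∀ i, S i} (ex : ∀ i, env i x = Data.ofList ((l i).map (repA i)))
    (ey : ∀ i, env i y = rep i (s₀ i)) (hl : PolyB sz fun i => (l i).length)
    (hb : PEv β (fun j : (i : ι) × FoldRound (f i) (s₀ i) (l i) => sz j.1) (fun j => O j.1)
      (body k) (k + 3)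
      (fun j => update (update (update (env j.1) k j.2.rem) (k + 1) (rep j.1 j.2.acc)) (k + 2)
        (repA j.1 j.2.cur))
      (fun j => (f j.1 j.2.acc j.2.cur).map (rep j.1))) :
    PEv β sz O (Prog.fold x y body) k env fun i => (foldP (f i) (s₀ i) (l i)).map (rep i) := by
  obtain ⟨P, hP⟩ := hl
  obtain ⟨Q, hQ⟩ := hb
  refine ⟨P * (Q + 8) + 10, fun i => ?_⟩
  refine (Ev.fold (T := Q.eval (sz i)) hx hy (ex i) (ey i) fun rem pre a post h s hs =>
    hQ ⟨i, rem, s, pre, a, post, h, hs⟩).mono ?_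
  have := Nat.mul_le_mul_right (Q.eval (sz i) + 8) (hP i)
  simpa using this

/-- The case of `PEv.fold` without randomness. -/
theorem PEv.foldD {S A : ι → Type} {rep : ∀ i, S i → Data} {repA : ∀ i, A i → Data}
    {g : ∀ i, S i → A i → S i} {x y : ℕ} (hx : x < k) (hy : y < k) {body : ℕ → Prog}
    {l : ∀ i, List (A i)} {s₀ : ∀ i, S i} (ex : ∀ i, env i x = Data.ofList ((l i).map (repA i)))
    (ey : ∀ i, env i y = rep i (s₀ i)) (hl : PolyB sz fun i => (l i).length)
    (hb : PEv β (fun j : (i : ι) × FoldRound (fun s a => PMF.pure (g i s a)) (s₀ i) (l i) => sz j.1)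
      (fun j => O j.1) (body k) (k + 3)
      (fun j => update (update (update (env j.1) k j.2.rem) (k + 1) (rep j.1 j.2.acc)) (k + 2)
        (repA j.1 j.2.cur))
      (fun j => PMF.pure (rep j.1 (g j.1 j.2.acc j.2.cur)))) :
    PEv β sz O (Prog.fold x y body) k env
      fun i => PMF.pure (rep i ((l i).foldl (g i) (s₀ i))) := by
  refine (PEv.fold (f := fun i s a => PMF.pure (g i s a)) hx hy ex ey hl ?_).congr fun i => ?_
  · simpa only [PMF.pure_map] using hb
  · rw [foldP_pure, PMF.pure_map]

/-- The environments in which the oracle calls are answered are those that agree with `env i` on the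
variables; the query itself is in one of the registers of the called program. -/
theorem PEv.call {O₁ : ι → Oracle} {qp : Prog} {c : Cmd} {args : List ℕ} (hargs : ∀ x ∈ args, x < k)
    {T : ι → ℕ} (hT : PolyB sz T) {μ : ι → PMF Data} {inputs : ι → List Data}
    (hin : ∀ i, args.map (env i) = inputs i)
    (h : ∀ i, Halts β (O₁ i) (start c (inputs i)) (T i) (μ i))
    (hq : PEv β (fun j : (i : ι) × ({σ : Store // ∀ x < k, σ x = env i x} × ℕ) => sz j.1)
      (fun j => O j.1) qp (k + (c.width + 1)) (fun j => j.2.1)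
      (fun j => (O₁ j.1 (j.2.1.1 (k + j.2.2))).map Data.ofBits)) :
    PEv β sz O (Prog.call c args qp) k env μ := by
  obtain ⟨P, hP⟩ := hT
  obtain ⟨Q, hQ⟩ := hq
  refine ⟨P * (Q + 2) + (2 * (Polynomial.C c.width + 1) + 2), fun i => ?_⟩
  refine (Ev.call (M := Q.eval (sz i)) hargs (by rw [hin]; exact h i) fun σ hσ y => hQ ⟨i, ⟨σ, hσ⟩, y⟩).mono ?_
  have := Nat.mul_le_mul_right (Q.eval (sz i) + 2) (hP i)
  simpa using this

/-- Calling a deterministic polynomial-time program. -/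
theorem PEv.callD {c : Cmd} (hc : c.IsDeterministic) {args : List ℕ} (hargs : ∀ x ∈ args, x < k)
    {T : ι → ℕ} (hT : PolyB sz T) {v : ι → Data} {inputs : ι → List Data}
    (hin : ∀ i, args.map (env i) = inputs i)
    (h : ∀ i, HaltsWithin 0 noOracle c (inputs i) (T i) ∧
      outputAfter 0 noOracle c (inputs i) (T i) = PMF.pure (v i)) :
    PEv β sz O (Prog.call c args Prog.nil) k env fun i => PMF.pure (v i) := by
  refine PEv.call (O₁ := fun _ => noOracle) hargs hT hin (fun i => ?_) ?_
  · have e : run β noOracle (T i) (start c (inputs i)) =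
        run 0 noOracle (T i) (start c (inputs i)) := run_deterministic _ _ _ _ _ _ (by simpa using hc)
    refine ⟨?_, ?_⟩
    · rw [e]
      exact (h i).1
    · rw [e]
      exact (h i).2
  · exact PEv.nil.congr fun _ => by simp [noOracle, PMF.pure_map, Data.ofBits, Data.ofList]

/-- A complete program: the inputs are the variables `0, …, k - 1`, and the output is moved to
register `0`. -/
def Prog.main (t : Prog) (k : ℕ) : Cmd := .seq (t k) (.copy 0 k)

theorem PEv.main {t : Prog} {inputs : ι → List Data} {μ : ι → PMF Data}
    (h : PEv β sz O t k (fun i x => (inputs i).getD x Data.nil) μ) :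
    ∃ P : Polynomial ℕ, ∀ i, Halts β (O i) (start (t.main k) (inputs i)) (P.eval (sz i)) (μ i) := by
  obtain ⟨P, hP⟩ := h
  refine ⟨P + 2, fun i => ?_⟩
  have := hP i _ (fun _ _ => rfl) [.copy 0 k] 1 PMF.pure fun v hv σ' hσ' hv' => halts_copy ?_
  · rw [PMF.bind_pure] at this
    exact (halts_seq this).mono (by simp)
  · have := halts_nil (β := β) (O := O i) (update σ' 0 (σ' k)) 0
    simpa [hv'] using this

end PEv

/-! ### Programs for lists -/

namespace Data

theorem toList_ofList (l : List Data) : (ofList l).toList = l := by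
  induction l with
  | nil => rfl
  | cons a l ih => simp [ofList, toList, ih]

theorem toBool_ofBool (b : Bool) : (ofBool b).toBool = b := by cases b <;> rfl

theorem toBool_ofList (l : List Data) : (ofList l).toBool = !l.isEmpty := by cases l <;> rfl

@[simp] theorem hd_cons (a b : Data) : (cons a b).hd = a := rfl

@[simp] theorem tl_cons (a b : Data) : (cons a b).tl = b := rfl

@[simp] theorem hd_ofList (l : List Data) : (ofList l).hd = l.head?.getD nil := by cases l <;> rfl

@[simp] theorem tl_ofList (l : List Data) : (ofList l).tl = ofList l.tail := by cases l <;> rfl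

theorem unary_eq (n : ℕ) : unary n = ofList (List.replicate n (ofBool true)) := by
  simp [unary, ofBits]

end Data

/-- The first `c` entries of a list, which is extended by `nil` if it is too short. -/
def takePad : ℕ → List Data → List Data
  | 0, _ => []
  | c + 1, l => l.head?.getD Data.nil :: takePad c l.tail

/-- `m` consecutive segments of length `c` of a list. -/
def segments (c : ℕ) : ℕ → List Data → List (List Data)
  | 0, _ => []
  | m + 1, l => takePad c l :: segments c m (l.drop c)

theorem length_takePad (c : ℕ) (l : List Data) : (takePad c l).length = c := by
  induction c generalizing l with
  | zero => rfl
  | succ c ih => simp [takePad, ih]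

theorem length_segments (c m : ℕ) (l : List Data) : (segments c m l).length = m := by
  induction m generalizing l with
  | zero => rfl
  | succ c ih => simp [segments, ih]

theorem takePad_append (l l' : List Data) : takePad l.length (l ++ l') = l := by
  induction l with
  | nil => rfl
  | cons a l ih => simp [takePad, ih]

theorem segments_flatten {c : ℕ} (L : List (List Data)) (hL : ∀ l ∈ L, l.length = c)
    (r : List Data) : segments c L.length (L.flatten ++ r) = L := by
  induction L with
  | nil => rfl
  | cons l L ih =>
    have hl := hL l (by simp)
    simp only [List.length_cons, segments, List.flatten_cons, List.append_assoc]
    rw [← hl, takePad_append, List.drop_left, hl, ih fun l hl => hL l (by simp [hl])]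

namespace Prog

/-- The bit `1`. -/
def tt : Prog := bind nil fun e => cons e e

/-- The reversal of the list `x`, followed by the list `y`. -/
def revAppend (x y : ℕ) : Prog := fold x y fun b => cons (b + 2) (b + 1)

/-- The reversal of the list `x`. -/
def reverse (x : ℕ) : Prog := bind nil fun e => revAppend x e

/-- The list `x`, followed by the list `y`. -/
def append (x y : ℕ) : Prog := bind (reverse x) fun r => revAppend r y

/-- Drops as many entries of the list `y` as the list `x` has. -/
def drop (x y : ℕ) : Prog := fold x y fun b => tl (b + 1)

/-- Applies `body` to all entries of the list `x`. -/
def mapM (x : ℕ) (body : ℕ → Prog) : Prog :=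
  bind nil fun e => bind (fold x e fun b => bind (body (b + 2)) fun r => cons r (b + 1)) reverse

/-- The concatenation of the lists in the list `x`. -/
def flatten (x : ℕ) : Prog :=
  bind (reverse x) fun r => bind nil fun e => fold r e fun b => append (b + 2) (b + 1)

/-- The list of pairs of corresponding entries of the lists `x` and `y`. -/
def zip (x y : ℕ) : Prog :=
  bind nil fun e => bind (cons y e) fun s =>
    bind (fold x s fun b =>
      bind (hd (b + 1)) fun rest => bind (tl (b + 1)) fun out => bind (hd rest) fun h =>
      bind (cons (b + 2) h) fun p => bind (tl rest) fun rest' => bind (cons p out) fun out' =>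
      cons rest' out') fun r =>
    bind (tl r) fun o => reverse o

/-- Exclusive or of two bits. -/
def xor (x y : ℕ) : Prog := ite x (ite y nil tt) (var y)

/-- Entrywise exclusive or of two lists of bits. -/
def xorList (x y : ℕ) : Prog :=
  bind (zip x y) fun z => mapM z fun p => bind (hd p) fun a => bind (tl p) fun b => xor a b

/-- The first entries of the list `y`, as many as the list `x` has, and the rest of `y`. -/
def split (x y : ℕ) : Prog :=
  bind nil fun e => bind (cons y e) fun s =>
    bind (fold x s fun b =>
      bind (hd (b + 1)) fun rest => bind (tl (b + 1)) fun out => bind (hd rest) fun h =>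
      bind (tl rest) fun rest' => bind (cons h out) fun out' => cons rest' out') fun r =>
    bind (hd r) fun rest => bind (tl r) fun o => bind (reverse o) fun o' => cons o' rest

/-- Cuts the beginning of the list `y` into segments: the list `w` gives their length, and the list
`x` their number. -/
def cut (x w y : ℕ) : Prog :=
  bind nil fun e => bind (cons y e) fun s =>
    bind (fold x s fun b =>
      bind (hd (b + 1)) fun rest => bind (tl (b + 1)) fun out => bind (split w rest) fun p =>
      bind (hd p) fun h => bind (tl p) fun rest' => bind (cons h out) fun out' =>
      cons rest' out') fun r =>
    bind (tl r) fun o => reverse o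

/-- The product of two numbers in unary representation. -/
def mul (x y : ℕ) : Prog := bind nil fun e => fold x e fun b => append y (b + 1)

/-- The last entry of the list `y` that is marked by a nonzero entry of the list `x`. -/
def select (x y : ℕ) : Prog :=
  bind nil fun e => bind (zip x y) fun z => fold z e fun b =>
    bind (hd (b + 2)) fun c => ite c (tl (b + 2)) (var (b + 1))

end Prog

/-- The value computed by `Prog.select`. -/
def selectVal (l l' : List Data) : Data :=
  (l.zip l').foldl (fun s p => if p.1.toBool then p.2 else s) Data.nil

/-- A map over a list with random values. -/
noncomputable def mapP {A B : Type} (f : A → PMF B) : List A → PMF (List B)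
  | [] => PMF.pure []
  | a :: l => (f a).bind fun b => (mapP f l).map (b :: ·)

theorem mapP_pure {A B : Type} (g : A → B) (l : List A) :
    mapP (fun a => PMF.pure (g a)) l = PMF.pure (l.map g) := by
  induction l with
  | nil => rfl
  | cons a l ih => simp [mapP, ih, PMF.pure_map]

theorem mapP_replicate {A B : Type} (μ : PMF B) (a : A) (n : ℕ) :
    mapP (fun _ => μ) (List.replicate n a) = iid μ n := by
  induction n with
  | zero => rfl
  | succ n ih => simp only [List.replicate_succ, mapP, iid, ih]

theorem foldP_cons_eq_mapP {A B : Type} (f : A → PMF B) (s : List B) (l : List A) :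
    foldP (fun s a => (f a).map (· :: s)) s l = (mapP f l).map fun r => r.reverse ++ s := by
  induction l generalizing s with
  | nil => simp [foldP, mapP, PMF.pure_map]
  | cons a l ih =>
    simp only [foldP, mapP, PMF.bind_map, PMF.map_bind, PMF.map_comp]
    congr 1
    funext b
    simp only [Function.comp_apply, ih]
    congr 1
    funext r
    simp

section

variable {β : ℝ} {ι : Type} {sz : ι → ℕ} {O : ι → Oracle} {k : ℕ} {env : ι → Store}

theorem PEv.tt : PEv β sz O Prog.tt k env fun _ => PMF.pure (Data.ofBool true) :=
  PEv.nil.bindD (PEv.cons (by omega) (by omega) (fun _ => by simp) (fun _ => by simp))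

theorem PEv.revAppend {x y : ℕ} (hx : x < k) (hy : y < k) {l l' : ι → List Data}
    (ex : ∀ i, env i x = Data.ofList (l i)) (ey : ∀ i, env i y = Data.ofList (l' i))
    (hl : PolyB sz fun i => (l i).length) :
    PEv β sz O (Prog.revAppend x y) k env
      fun i => PMF.pure (Data.ofList ((l i).reverse ++ l' i)) := by
  refine (PEv.foldD (S := fun _ => List Data) (A := fun _ => Data) (rep := fun _ => Data.ofList)
    (repA := fun _ => id) (g := fun _ s a => a :: s) (s₀ := l') hx hy (by simpa using ex) ey hl ?_).congr
    fun i => ?_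
  · exact PEv.cons (by omega) (by omega) (fun _ => by simp) (fun _ => by simp)
  · congr 2
    generalize l' i = s
    induction l i generalizing s with
    | nil => rfl
    | cons a l ih => simp [ih]

theorem PEv.reverse {x : ℕ} (hx : x < k) {l : ι → List Data}
    (ex : ∀ i, env i x = Data.ofList (l i)) (hl : PolyB sz fun i => (l i).length) :
    PEv β sz O (Prog.reverse x) k env fun i => PMF.pure (Data.ofList (l i).reverse) := by
  refine PEv.nil.bindD ((PEv.revAppend (l' := fun _ => []) (by omega) (by omega)
    (fun i => by simp (disch := omega) [ex]) (fun i => by simp [Data.ofList]) hl).congr fun i => ?_)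
  simp

theorem PEv.append {x y : ℕ} (hx : x < k) (hy : y < k) {l l' : ι → List Data}
    (ex : ∀ i, env i x = Data.ofList (l i)) (ey : ∀ i, env i y = Data.ofList (l' i))
    (hl : PolyB sz fun i => (l i).length) :
    PEv β sz O (Prog.append x y) k env fun i => PMF.pure (Data.ofList (l i ++ l' i)) := by
  refine (PEv.reverse hx ex hl).bindD ((PEv.revAppend (l := fun i => (l i).reverse) (l' := l')
    (by omega) (by omega) (fun i => by simp) (fun i => by simp (disch := omega) [ey])
    (by simpa using hl)).congr fun i => ?_)
  simp

theorem PEv.drop {x y : ℕ} (hx : x < k) (hy : y < k) {l l' : ι → List Data}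
    (ex : ∀ i, env i x = Data.ofList (l i)) (ey : ∀ i, env i y = Data.ofList (l' i))
    (hl : PolyB sz fun i => (l i).length) :
    PEv β sz O (Prog.drop x y) k env
      fun i => PMF.pure (Data.ofList ((l' i).drop (l i).length)) := by
  refine (PEv.foldD (S := fun _ => List Data) (A := fun _ => Data) (rep := fun _ => Data.ofList)
    (repA := fun _ => id) (g := fun _ s _ => s.tail) (s₀ := l') hx hy (by simpa using ex) ey hl ?_).congr
    fun i => ?_
  · refine (PEv.tl (d := fun j => Data.ofList j.2.acc) (by omega) (fun _ => by simp)).congr fun j => ?_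
    cases j.2.acc <;> rfl
  · congr 2
    generalize l' i = s
    induction l i generalizing s with
    | nil => rfl
    | cons a l ih => simp [ih]

/-- The circumstances of one evaluation of the body of `Prog.mapM`. -/
structure MapRound {A : Type} (l : List A) where
  rem : Data
  acc : Data
  cur : A
  mem : cur ∈ l

theorem PEv.mapM {A B : ι → Type} {repA : ∀ i, A i → Data} {repB : ∀ i, B i → Data}
    {f : ∀ i, A i → PMF (B i)} {x : ℕ} (hx : x < k) {body : ℕ → Prog}
    {l : ∀ i, List (A i)} (ex : ∀ i, env i x = Data.ofList ((l i).map (repA i)))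
    (hl : PolyB sz fun i => (l i).length)
    (hb : PEv β (fun j : (i : ι) × MapRound (l i) => sz j.1) (fun j => O j.1) (body (k + 3)) (k + 4)
      (fun j => update (update (update (update (env j.1) k Data.nil) (k + 1) j.2.rem)
        (k + 2) j.2.acc) (k + 3) (repA j.1 j.2.cur))
      (fun j => (f j.1 j.2.cur).map (repB j.1))) :
    PEv β sz O (Prog.mapM x body) k env
      fun i => (mapP (f i) (l i)).map fun r => Data.ofList (r.map (repB i)) := by
  refine PEv.nil.bindD ?_
  have h1 : PEv β sz O (Prog.fold x k fun b => Prog.bind (body (b + 2)) fun r => Prog.cons r (b + 1))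
      (k + 1) (fun i => update (env i) k Data.nil)
      fun i => (foldP (fun s a => (f i a).map (· :: s)) [] (l i)).map
        fun r => Data.ofList (r.map (repB i)) := by
    refine PEv.fold (S := fun i => List (B i)) (rep := fun i s => Data.ofList (s.map (repB i)))
      (repA := repA) (by omega) (by omega) (fun i => by simp (disch := omega) [ex])
      (fun i => by simp [Data.ofList]) hl ?_
    have h2 := hb.comap (κ := (i : ι) × FoldRound (fun s a => (f i a).map (· :: s)) [] (l i))
      fun j => ⟨j.1, j.2.rem, Data.ofList (j.2.acc.map (repB j.1)), j.2.cur, j.2.cur_mem⟩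
    refine (PEv.bind h2 (ν := fun j v =>
      PMF.pure (Data.cons (repB j.1 v) (Data.ofList (j.2.acc.map (repB j.1))))) ?_).congr fun j => ?_
    · exact PEv.cons (by omega) (by omega) (fun _ => by simp) (fun _ => by simp (disch := omega))
    · simp only [PMF.map_comp]
      rw [← PMF.bind_pure_comp]
      rfl
  refine (PEv.bind h1 (ν := fun i r => PMF.pure (Data.ofList (r.reverse.map (repB i)))) ?_).congr
    fun i => ?_
  · refine (PEv.reverse (l := fun j => j.2.1.map (repB j.1)) (by omega) (fun j => by simp) ?_).congr
      fun j => ?_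
    · refine PolyB.mono (hl.sigma) fun j => ?_
      obtain ⟨i, v, hv⟩ := j
      rw [foldP_cons_eq_mapP, PMF.support_map] at hv
      obtain ⟨r, hr, rfl⟩ := hv
      have : ∀ l : List (A i), ∀ r ∈ (mapP (f i) l).support, r.length = l.length := by
        intro l
        induction l with
        | nil => simp [mapP]
        | cons a l ih =>
          intro r hr
          simp only [mapP, PMF.mem_support_bind_iff, PMF.support_map] at hr
          obtain ⟨b, _, r, hr, rfl⟩ := hr
          simp [ih r hr]
      simp [this _ r hr]
    · simp
  · rw [foldP_cons_eq_mapP, PMF.bind_map, ← PMF.bind_pure_comp]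
    congr 1
    funext r
    simp

theorem PEv.mapD {A : ι → Type} {repA : ∀ i, A i → Data} {g : ∀ i, A i → Data} {x : ℕ} (hx : x < k)
    {body : ℕ → Prog} {l : ∀ i, List (A i)} (ex : ∀ i, env i x = Data.ofList ((l i).map (repA i)))
    (hl : PolyB sz fun i => (l i).length)
    (hb : PEv β (fun j : (i : ι) × MapRound (l i) => sz j.1) (fun j => O j.1) (body (k + 3)) (k + 4)
      (fun j => update (update (update (update (env j.1) k Data.nil) (k + 1) j.2.rem)
        (k + 2) j.2.acc) (k + 3) (repA j.1 j.2.cur))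
      (fun j => PMF.pure (g j.1 j.2.cur))) :
    PEv β sz O (Prog.mapM x body) k env fun i => PMF.pure (Data.ofList ((l i).map (g i))) := by
  refine (PEv.mapM (B := fun _ => Data) (repB := fun _ => id) (f := fun i a => PMF.pure (g i a))
    hx ex hl (hb.congr fun _ => by simp [PMF.pure_map])).congr fun i => ?_
  rw [mapP_pure, PMF.pure_map]
  simp

theorem PEv.flatten {x : ℕ} (hx : x < k) {l : ι → List (List Data)} {w : ι → ℕ}
    (ex : ∀ i, env i x = Data.ofList ((l i).map Data.ofList)) (hl : PolyB sz fun i => (l i).length)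
    (hw : PolyB sz w) (hlw : ∀ i, ∀ a ∈ l i, a.length ≤ w i) :
    PEv β sz O (Prog.flatten x) k env fun i => PMF.pure (Data.ofList (l i).flatten) := by
  refine (PEv.reverse hx ex (by simpa using hl)).bindD (PEv.nil.bindD ?_)
  refine (PEv.foldD (S := fun _ => List Data) (A := fun _ => List Data) (rep := fun _ => Data.ofList)
    (repA := fun _ => Data.ofList) (l := fun i => (l i).reverse) (g := fun _ s a => a ++ s)
    (s₀ := fun _ => []) (by omega) (by omega) (fun i => by simp (disch := omega))
    (fun i => by simp [Data.ofList]) (by simpa using hl) ?_).congr fun i => ?_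
  · refine PEv.append (by omega) (by omega) (fun j => by simp) (fun j => by simp (disch := omega))
      (hw.sigma.mono fun j => hlw _ _ ?_)
    simpa using j.2.cur_mem
  · congr 2
    rw [List.foldl_reverse]
    induction l i with
    | nil => rfl
    | cons a l ih => simp [ih]

theorem PEv.zip {x y : ℕ} (hx : x < k) (hy : y < k) {l l' : ι → List Data}
    (ex : ∀ i, env i x = Data.ofList (l i)) (ey : ∀ i, env i y = Data.ofList (l' i))
    (hl : PolyB sz fun i => (l i).length) (hll : ∀ i, (l i).length ≤ (l' i).length) :
    PEv β sz O (Prog.zip x y) k env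
      fun i => PMF.pure (Data.ofList (((l i).zip (l' i)).map fun p => Data.cons p.1 p.2)) := by
  have key : ∀ (l l' o : List Data), l.length ≤ l'.length →
      (l.foldl (fun (s : List Data × List Data) a =>
        (s.1.tail, Data.cons a (s.1.head?.getD Data.nil) :: s.2)) (l', o)) =
        (l'.drop l.length, ((l.zip l').map fun p => Data.cons p.1 p.2).reverse ++ o) := by
    intro l
    induction l with
    | nil => simp
    | cons a l ih =>
      intro l' o h
      match l' with
      | [] => simp at h
      | b :: l' => simp [ih l' _ (by simpa using h)]
  refine PEv.nil.bindD ((PEv.cons (e := fun _ => Data.nil) (by omega) (by omega)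
    (fun i => by simp (disch := omega) [ey]; rfl) (fun i => by simp)).bindD ?_)
  have h1 := PEv.foldD (β := β) (sz := sz) (O := O) (k := k + 2) (x := x) (y := k + 1)
    (env := fun i => update (update (env i) k Data.nil) (k + 1)
      (Data.cons (Data.ofList (l' i)) Data.nil))
    (S := fun _ => List Data × List Data) (A := fun _ => Data)
    (rep := fun _ s => Data.cons (Data.ofList s.1) (Data.ofList s.2)) (repA := fun _ => id) (l := l)
    (g := fun _ s a => (s.1.tail, Data.cons a (s.1.head?.getD Data.nil) :: s.2))
    (s₀ := fun i => (l' i, [])) (body := fun b =>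
      Prog.bind (.hd (b + 1)) fun rest => .bind (.tl (b + 1)) fun out => .bind (.hd rest) fun h =>
      .bind (.cons (b + 2) h) fun p => .bind (.tl rest) fun rest' => .bind (.cons p out) fun out' =>
      .cons rest' out')
    (by omega) (by omega) (fun i => by simp (disch := omega) [ex]) (fun i => by simp [Data.ofList]) hl ?_
  · refine h1.bindD ((PEv.tl (by omega) (fun i => by rw [update_self])).bindD ?_)
    refine (PEv.reverse (l := fun i => (((l i).zip (l' i)).map fun p => Data.cons p.1 p.2).reverse)
      (by omega) (fun i => ?_) ?_).congr fun i => ?_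
    · simp [key _ _ _ (hll i)]
    · simpa using hl.mono fun i => by simp
    · simp
  · refine (PEv.hd (by omega) (fun j => by simp (disch := omega); rfl)).bindD ?_
    refine (PEv.tl (by omega) (fun j => by simp (disch := omega); rfl)).bindD ?_
    refine (PEv.hd (by omega) (fun j => by simp (disch := omega); rfl)).bindD ?_
    refine (PEv.cons (by omega) (by omega) (fun j => by simp (disch := omega); rfl)
      (fun j => by simp (disch := omega); rfl)).bindD ?_
    refine (PEv.tl (by omega) (fun j => by simp (disch := omega); rfl)).bindD ?_
    refine (PEv.cons (by omega) (by omega) (fun j => by simp (disch := omega); rfl)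
      (fun j => by simp (disch := omega); rfl)).bindD ?_
    refine (PEv.cons (by omega) (by omega) (fun j => by simp (disch := omega); rfl)
      (fun j => by simp (disch := omega); rfl)).congr fun j => ?_
    simp [Data.ofList]

theorem PEv.xor {x y : ℕ} (hx : x < k) (hy : y < k) {b c : ι → Bool}
    (ex : ∀ i, env i x = Data.ofBool (b i)) (ey : ∀ i, env i y = Data.ofBool (c i)) :
    PEv β sz O (Prog.xor x y) k env fun i => PMF.pure (Data.ofBool (Bool.xor (b i) (c i))) := by
  refine PEv.ite hx (c := b) (fun i => by rw [ex, Data.toBool_ofBool]) ?_ ?_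
  · refine PEv.ite hy (c := fun i => c i) (fun i => by rw [ey, Data.toBool_ofBool]) ?_ ?_
    · refine PEv.nil.congr fun i => ?_
      rw [i.1.2, i.2]
      rfl
    · refine PEv.tt.congr fun i => ?_
      rw [i.1.2, i.2]
      rfl
  · refine (PEv.var hy fun i : {i // b i = false} => ey i).congr fun i => ?_
    rw [i.2, Bool.false_xor]

theorem PEv.xorList {x y : ℕ} (hx : x < k) (hy : y < k) {b c : ι → List Bool}
    (ex : ∀ i, env i x = Data.ofBits (b i)) (ey : ∀ i, env i y = Data.ofBits (c i))
    (hl : PolyB sz fun i => (b i).length) (hll : ∀ i, (b i).length ≤ (c i).length) :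
    PEv β sz O (Prog.xorList x y) k env
      fun i => PMF.pure (Data.ofBits (List.zipWith Bool.xor (b i) (c i))) := by
  refine (PEv.zip hx hy ex ey (by simpa using hl) (by simpa using hll)).bindD ?_
  refine (PEv.mapD (A := fun _ => Bool × Bool)
    (repA := fun _ p => Data.cons (Data.ofBool p.1) (Data.ofBool p.2))
    (g := fun _ p => Data.ofBool (Bool.xor p.1 p.2)) (l := fun i => (b i).zip (c i)) (by omega)
    (fun i => ?_) (hl.mono fun i => by simp) ?_).congr fun i => ?_
  · rw [update_self, List.zip_map, List.map_map]
    rfl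
  · refine (PEv.hd (by omega) (fun j => by simp; rfl)).bindD ?_
    refine (PEv.tl (by omega) (fun j => by simp (disch := omega); rfl)).bindD ?_
    exact PEv.xor (by omega) (by omega) (fun j => by simp (disch := omega))
      (fun j => by simp (disch := omega))
  · rw [Data.ofBits, ← List.map_uncurry_zip_eq_zipWith, List.map_map]
    rfl

theorem PEv.split {x y : ℕ} (hx : x < k) (hy : y < k) {l l' : ι → List Data}
    (ex : ∀ i, env i x = Data.ofList (l i)) (ey : ∀ i, env i y = Data.ofList (l' i))
    (hl : PolyB sz fun i => (l i).length) :
    PEv β sz O (Prog.split x y) k env fun i => PMF.pure (Data.cons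
      (Data.ofList (takePad (l i).length (l' i))) (Data.ofList ((l' i).drop (l i).length))) := by
  have key : ∀ (l l' o : List Data),
      (l.foldl (fun (s : List Data × List Data) _ =>
        (s.1.tail, s.1.head?.getD Data.nil :: s.2)) (l', o)) =
        (l'.drop l.length, (takePad l.length l').reverse ++ o) := by
    intro l
    induction l with
    | nil => simp [takePad]
    | cons a l ih =>
      intro l' o
      simp [ih, takePad]
  refine PEv.nil.bindD ((PEv.cons (e := fun _ => Data.nil) (by omega) (by omega)
    (fun i => by simp (disch := omega) [ey]; rfl) (fun i => by simp)).bindD ?_)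
  have h1 := PEv.foldD (β := β) (sz := sz) (O := O) (k := k + 2) (x := x) (y := k + 1)
    (env := fun i => update (update (env i) k Data.nil) (k + 1)
      (Data.cons (Data.ofList (l' i)) Data.nil))
    (S := fun _ => List Data × List Data) (A := fun _ => Data)
    (rep := fun _ s => Data.cons (Data.ofList s.1) (Data.ofList s.2)) (repA := fun _ => id) (l := l)
    (g := fun _ s _ => (s.1.tail, s.1.head?.getD Data.nil :: s.2))
    (s₀ := fun i => (l' i, [])) (body := fun b =>
      Prog.bind (.hd (b + 1)) fun rest => .bind (.tl (b + 1)) fun out => .bind (.hd rest) fun h =>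
      .bind (.tl rest) fun rest' => .bind (.cons h out) fun out' => .cons rest' out')
    (by omega) (by omega) (fun i => by simp (disch := omega) [ex]) (fun i => by simp [Data.ofList]) hl ?_
  · refine h1.bindD ((PEv.hd (by omega) (fun i => by rw [update_self])).bindD ?_)
    refine (PEv.tl (by omega) (fun i => by simp (disch := omega); rfl)).bindD ?_
    refine (PEv.reverse (l := fun i => (takePad (l i).length (l' i)).reverse)
      (by omega) (fun i => ?_) ?_).bindD ?_
    · simp [key]
    · simpa [length_takePad] using hl
    · refine (PEv.cons (by omega) (by omega) (fun j => by simp (disch := omega); rfl)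
        (fun j => by simp (disch := omega); rfl)).congr fun j => ?_
      simp [key]
  · refine (PEv.hd (by omega) (fun j => by simp (disch := omega); rfl)).bindD ?_
    refine (PEv.tl (by omega) (fun j => by simp (disch := omega); rfl)).bindD ?_
    refine (PEv.hd (by omega) (fun j => by simp (disch := omega); rfl)).bindD ?_
    refine (PEv.tl (by omega) (fun j => by simp (disch := omega); rfl)).bindD ?_
    refine (PEv.cons (by omega) (by omega) (fun j => by simp (disch := omega); rfl)
      (fun j => by simp (disch := omega); rfl)).bindD ?_
    refine (PEv.cons (by omega) (by omega) (fun j => by simp (disch := omega); rfl)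
      (fun j => by simp (disch := omega); rfl)).congr fun j => ?_
    simp [Data.ofList]

theorem PEv.cut {x w y : ℕ} (hx : x < k) (hw : w < k) (hy : y < k) {l lw l' : ι → List Data}
    (ex : ∀ i, env i x = Data.ofList (l i)) (ew : ∀ i, env i w = Data.ofList (lw i))
    (ey : ∀ i, env i y = Data.ofList (l' i))
    (hl : PolyB sz fun i => (l i).length) (hlw : PolyB sz fun i => (lw i).length) :
    PEv β sz O (Prog.cut x w y) k env fun i => PMF.pure
      (Data.ofList ((segments (lw i).length (l i).length (l' i)).map Data.ofList)) := by
  have key : ∀ (c : ℕ) (l l' : List Data) (o : List (List Data)),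
      (l.foldl (fun (s : List Data × List (List Data)) _ =>
        (s.1.drop c, takePad c s.1 :: s.2)) (l', o)).2 =
        (segments c l.length l').reverse ++ o := by
    intro c l
    induction l with
    | nil => simp [segments]
    | cons a l ih =>
      intro l' o
      simp [ih, segments]
  refine PEv.nil.bindD ((PEv.cons (e := fun _ => Data.nil) (by omega) (by omega)
    (fun i => by simp (disch := omega) [ey]; rfl) (fun i => by simp)).bindD ?_)
  have h1 := PEv.foldD (β := β) (sz := sz) (O := O) (k := k + 2) (x := x) (y := k + 1)
    (env := fun i => update (update (env i) k Data.nil) (k + 1)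
      (Data.cons (Data.ofList (l' i)) Data.nil))
    (S := fun _ => List Data × List (List Data)) (A := fun _ => Data)
    (rep := fun _ s => Data.cons (Data.ofList s.1) (Data.ofList (s.2.map Data.ofList)))
    (repA := fun _ => id) (l := l)
    (g := fun i s _ => (s.1.drop (lw i).length, takePad (lw i).length s.1 :: s.2))
    (s₀ := fun i => (l' i, [])) (body := fun b =>
      Prog.bind (.hd (b + 1)) fun rest => .bind (.tl (b + 1)) fun out => .bind (.split w rest) fun p =>
      .bind (.hd p) fun h => .bind (.tl p) fun rest' => .bind (.cons h out) fun out' =>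
      .cons rest' out')
    (by omega) (by omega) (fun i => by simp (disch := omega) [ex]) (fun i => by simp [Data.ofList]) hl ?_
  · refine h1.bindD ((PEv.tl (by omega) (fun i => by rw [update_self])).bindD ?_)
    refine (PEv.reverse (l := fun i =>
      ((segments (lw i).length (l i).length (l' i)).map Data.ofList).reverse)
      (by omega) (fun i => ?_) ?_).congr fun i => ?_
    · simp [key]
    · simpa [length_segments] using hl
    · simp
  · refine (PEv.hd (by omega) (fun j => by simp (disch := omega); rfl)).bindD ?_
    refine (PEv.tl (by omega) (fun j => by simp (disch := omega); rfl)).bindD ?_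
    refine (PEv.split (l := fun j => lw j.1) (l' := fun j => j.2.acc.1) (by omega) (by omega)
      (fun j => by simp (disch := omega) [ew]) (fun j => by simp (disch := omega)) hlw.sigma).bindD ?_
    refine (PEv.hd (by omega) (fun j => by simp (disch := omega); rfl)).bindD ?_
    refine (PEv.tl (by omega) (fun j => by simp (disch := omega); rfl)).bindD ?_
    refine (PEv.cons (by omega) (by omega) (fun j => by simp (disch := omega); rfl)
      (fun j => by simp (disch := omega); rfl)).bindD ?_
    refine (PEv.cons (by omega) (by omega) (fun j => by simp (disch := omega); rfl)
      (fun j => by simp (disch := omega); rfl)).congr fun j => ?_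
    simp [Data.ofList]

theorem PEv.mul {x y : ℕ} (hx : x < k) (hy : y < k) {a b : ι → ℕ}
    (ex : ∀ i, env i x = Data.unary (a i)) (ey : ∀ i, env i y = Data.unary (b i))
    (ha : PolyB sz a) (hb : PolyB sz b) :
    PEv β sz O (Prog.mul x y) k env fun i => PMF.pure (Data.unary (a i * b i)) := by
  simp only [Data.unary_eq] at ex ey ⊢
  refine PEv.nil.bindD ((PEv.foldD (S := fun _ => List Data) (A := fun _ => Data)
    (rep := fun _ => Data.ofList) (repA := fun _ => id)
    (g := fun i s _ => List.replicate (b i) (Data.ofBool true) ++ s) (s₀ := fun _ => [])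
    (l := fun i => List.replicate (a i) (Data.ofBool true))
    (by omega) (by omega) (fun i => by simp (disch := omega) [ex]) (fun i => by simp [Data.ofList])
    (by simpa using ha) ?_).congr fun i => ?_)
  · exact PEv.append (by omega) (by omega) (fun j => by simp (disch := omega) [ey])
      (fun j => by simp (disch := omega)) (by simpa using hb.sigma)
  · congr 2
    induction a i with
    | zero => simp
    | succ n ih =>
      rw [List.replicate_succ', List.foldl_append, ih, Nat.add_mul, one_mul, add_comm]
      simp

theorem PEv.select {x y : ℕ} (hx : x < k) (hy : y < k) {l l' : ι → List Data}
    (ex : ∀ i, env i x = Data.ofList (l i)) (ey : ∀ i, env i y = Data.ofList (l' i))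
    (hl : PolyB sz fun i => (l i).length) (hll : ∀ i, (l i).length ≤ (l' i).length) :
    PEv β sz O (Prog.select x y) k env fun i => PMF.pure (selectVal (l i) (l' i)) := by
  refine PEv.nil.bindD ((PEv.zip (by omega) (by omega) (fun i => by simp (disch := omega) [ex])
    (fun i => by simp (disch := omega) [ey]) hl hll).bindD ?_)
  refine PEv.foldD (S := fun _ => Data) (A := fun _ => Data × Data) (rep := fun _ => id)
    (repA := fun _ p => Data.cons p.1 p.2) (s₀ := fun _ => Data.nil)
    (g := fun _ s p => if p.1.toBool then p.2 else s) (l := fun i => (l i).zip (l' i))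
    (by omega) (by omega) (fun i => by simp (disch := omega)) (fun i => by simp (disch := omega))
    (hl.mono fun i => by simp) ?_
  refine (PEv.hd (by omega) (fun j => by simp (disch := omega); rfl)).bindD ?_
  refine PEv.ite (by omega) (c := fun j => j.2.cur.1.toBool) (fun j => by simp) ?_ ?_
  · refine (PEv.tl (by omega) (fun j => by simp (disch := omega); rfl)).congr fun j => ?_
    simp [j.2]
  · refine (PEv.var (by omega) (fun j => by simp (disch := omega); rfl)).congr fun j => ?_
    simp [j.2]

end

/-! ### Uniform distributions -/

/-- The uniform distribution on a finite type. -/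
noncomputable abbrev unif (α : Type) [Fintype α] [Nonempty α] : PMF α := PMF.uniformOfFintype α

theorem unif_map_equiv {α β : Type} [Fintype α] [Nonempty α] [Fintype β] [Nonempty β] (e : α ≃ β) :
    (unif α).map e = unif β := by
  classical
  ext b
  rw [PMF.map_apply, PMF.uniformOfFintype_apply, tsum_eq_single (e.symm b)]
  · simp [Fintype.card_congr e]
  · intro a ha
    rw [if_neg]
    rintro rfl
    simp at ha

theorem unif_prod (α β : Type) [Fintype α] [Nonempty α] [Fintype β] [Nonempty β] :
    unif (α × β) = (unif α).bind fun a => (unif β).map fun b => (a, b) := by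
  classical
  ext ⟨a, b⟩
  rw [PMF.bind_apply, tsum_eq_single a]
  · rw [PMF.map_apply, tsum_eq_single b]
    · simp only [PMF.uniformOfFintype_apply, if_true, Fintype.card_prod, Nat.cast_mul]
      rw [ENNReal.mul_inv] <;> simp
    · intro b' hb'
      rw [if_neg]
      simpa using Ne.symm hb'
  · intro a' ha'
    rw [PMF.map_apply]
    simp [Ne.symm ha']

theorem mem_support_iid {α : Type} {μ : PMF α} {n : ℕ} {l : List α} (h : l ∈ (iid μ n).support) :
    l.length = n ∧ ∀ a ∈ l, a ∈ μ.support := by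
  induction n generalizing l with
  | zero =>
    have : l = [] := by simpa [iid] using h
    simp [this]
  | succ n ih =>
    simp only [iid, PMF.mem_support_bind_iff, PMF.support_map] at h
    obtain ⟨a, ha, l, hl, rfl⟩ := h
    refine ⟨by simp [(ih hl).1], ?_⟩
    simp only [List.mem_cons, forall_eq_or_imp]
    exact ⟨ha, (ih hl).2⟩

theorem iid_unif (α : Type) [Fintype α] [Nonempty α] (n : ℕ) :
    iid (unif α) n = (unif (Fin n → α)).map List.ofFn := by
  induction n with
  | zero =>
    have : (unif (Fin 0 → α)).map List.ofFn = (unif (Fin 0 → α)).map (Function.const _ []) := by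
      congr 1
    rw [this, PMF.map_const]
    rfl
  | succ n ih =>
    rw [← unif_map_equiv (Fin.consEquiv fun _ : Fin (n + 1) => α), unif_prod, iid, PMF.map_bind,
      PMF.map_bind]
    congr 1
    funext a
    rw [ih, PMF.map_comp, PMF.map_comp, PMF.map_comp]
    congr 1
    funext f
    simp [Fin.consEquiv, List.ofFn_succ]

theorem unifBits_map_ofFn (n : ℕ) : (unifBits n).map List.ofFn = iid (unif Bool) n :=
  (iid_unif Bool n).symm

theorem pick_ofFn {n : ℕ} (g : Fin (n + 1) → Data) : pick (List.ofFn g) = (unif (Fin (n + 1))).map g := by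
  rw [List.ofFn_succ, pick]
  have h : (List.ofFn fun i : Fin n => g i.succ).length + 1 = n + 1 := by simp
  rw [← unif_map_equiv (finCongr h), PMF.map_comp]
  congr 1
  funext i
  refine Fin.cases rfl (fun j => ?_) i
  simp
  rfl

/-! ### Sampling bit strings and permutations -/

/-- Removes a random entry from a list; the first entry takes its place. -/
noncomputable def drawP : List Data → PMF (Data × List Data)
  | [] => PMF.pure (Data.nil, [])
  | h :: t => (unif (Fin (t.length + 1))).map fun i =>
      ((h :: t).get i, List.ofFn fun j : Fin t.length => (h :: t).get (Equiv.swap 0 i j.succ))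

/-- The entries of a list, each of them together with the list in which it is replaced by `h`. -/
def swapList (h : Data) : List Data → List (Data × List Data)
  | [] => []
  | a :: t => (a, h :: t) :: (swapList h t).map fun p => (p.1, a :: p.2)

theorem swapList_eq_ofFn (h : Data) (t : List Data) :
    swapList h t = List.ofFn fun i : Fin t.length => (t.get i, t.set i h) := by
  induction t with
  | nil => rfl
  | cons a t ih => simp [swapList, ih, List.ofFn_succ, List.map_ofFn, Function.comp_def]

theorem ofFn_swap (h : Data) (t : List Data) (i : Fin t.length) :
    (List.ofFn fun j : Fin t.length => (h :: t).get (Equiv.swap 0 i.succ j.succ)) = t.set i h := by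
  refine List.ext_get (by simp) fun n h1 h2 => ?_
  simp only [List.length_ofFn] at h1
  simp only [List.get_eq_getElem, List.getElem_ofFn, List.getElem_set]
  by_cases hn : (i : ℕ) = n
  · subst hn
    simp
  · rw [if_neg hn, Equiv.swap_apply_of_ne_of_ne]
    · simp
    · exact Fin.succ_ne_zero _
    · intro e
      exact hn (by simpa [Fin.ext_iff] using e.symm)

namespace Prog

/-- A fair bit. It is drawn from a list with two entries, as the coin may be biased. -/
def fairBit : Prog :=
  bind nil fun e => bind (cons e e) fun t => bind (cons t e) fun l => bind (cons e l) fun l' =>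
  choose l'

/-- A uniformly random bit string, of the length of the list `x`. -/
def bits (x : ℕ) : Prog := mapM x fun _ => fairBit

/-- The program for `swapList`, where `h` is the replacement and `x` the list. -/
def swaps (h x : ℕ) : Prog :=
  bind (reverse x) fun r => bind nil fun e => bind (cons e e) fun s =>
    bind (fold r s fun b =>
      bind (hd (b + 1)) fun t => bind (tl (b + 1)) fun out => bind (cons h t) fun ht =>
      bind (cons (b + 2) ht) fun new =>
      bind (mapM out fun p => bind (hd p) fun c => bind (tl p) fun d =>
        bind (cons (b + 2) d) fun d' => cons c d') fun out' =>
      bind (cons new out') fun out'' => bind (cons (b + 2) t) fun t' => cons t' out'') fun r' =>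
    tl r'

/-- The program for `drawP`. -/
def draw (x : ℕ) : Prog :=
  bind (hd x) fun h => bind (tl x) fun t => bind (swaps h t) fun s =>
  bind (cons h t) fun p => bind (cons p s) fun l => choose l

/-- A random rearrangement of the list `y`; the list `x` has the same length. -/
def shuffle (x y : ℕ) : Prog :=
  bind nil fun e => bind (cons y e) fun s =>
    bind (fold x s fun b =>
      bind (hd (b + 1)) fun l => bind (tl (b + 1)) fun out => bind (draw l) fun r =>
      bind (hd r) fun a => bind (tl r) fun l' => bind (cons a out) fun out' => cons l' out') fun r =>
    bind (tl r) fun o => reverse o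

/-- The rows of the identity matrix of size `x`. -/
def identity (x : ℕ) : Prog :=
  bind nil fun e => bind (cons e e) fun t => bind (cons t e) fun p => bind (cons p e) fun s =>
    bind (fold x s fun b =>
      bind (hd (b + 1)) fun p => bind (tl (b + 1)) fun out => bind (split x p) fun q =>
      bind (hd q) fun row => bind (cons row out) fun out' => bind (cons e p) fun p' =>
      cons p' out') fun r =>
    bind (tl r) fun o => reverse o

/-- The rows of a uniformly random permutation matrix of size `x`. -/
def perm (x : ℕ) : Prog := bind (identity x) fun l => shuffle x l

end Prog

/-- The rows of a permutation matrix. -/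
def permRows {N : ℕ} (π : Equiv.Perm (Fin N)) : List (List Bool) :=
  List.ofFn fun i => List.ofFn fun j => decide (π i = j)

/-- One step of `Prog.shuffle`: the remaining list, and the entries drawn so far. -/
noncomputable def shuffleStep (s : List Data × List Data) : PMF (List Data × List Data) :=
  (drawP s.1).map fun r => (r.2, r.1 :: s.2)

/-- Drawing the entries of a list one after the other, where the first entry replaces the one that is
drawn, puts them into a uniformly random order; this is the recursion `Equiv.Perm.decomposeFin`. -/
theorem foldP_shuffleStep {A : Type} (l₀ : List A) (l : Fin l₀.length → Data) (o : List Data) :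
    foldP (fun s _ => shuffleStep s) (List.ofFn l, o) l₀ =
      (unif (Equiv.Perm (Fin l₀.length))).map fun π =>
        ([], (List.ofFn fun i => l (π i)).reverse ++ o) := by
  induction l₀ generalizing o with
  | nil =>
    have : (fun π : Equiv.Perm (Fin ([] : List A).length) =>
        (([] : List Data), (List.ofFn fun i => l (π i)).reverse ++ o)) = Function.const _ ([], o) := by
      funext π
      simp
    rw [this, PMF.map_const]
    simp [foldP]
  | cons a l₀ ih =>
    have hd : drawP (List.ofFn l) = (unif (Fin (l₀.length + 1))).map fun i =>
        (l i, List.ofFn fun j : Fin l₀.length => l (Equiv.swap 0 i j.succ)) := by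
      have hg : ∀ (h : (List.ofFn fun i : Fin l₀.length => l i.succ).length + 1 = l₀.length + 1) i,
          (l 0 :: List.ofFn fun i : Fin l₀.length => l i.succ).get i = l (Fin.cast h i) := by
        intro h i
        refine Fin.cases ?_ (fun j => ?_) i
        · simp
        · simp
          rfl
      have h : (List.ofFn fun i : Fin l₀.length => l i.succ).length = l₀.length := by simp
      have h' : (List.ofFn fun i : Fin l₀.length => l i.succ).length + 1 = l₀.length + 1 := by simp
      have e : List.ofFn l = l 0 :: List.ofFn fun i : Fin l₀.length => l i.succ := List.ofFn_succ
      rw [e, drawP, ← unif_map_equiv (finCongr h'), PMF.map_comp]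
      congr 1
      funext i
      simp only [hg h', Function.comp_apply, finCongr_apply, Prod.mk.injEq, true_and]
      rw [List.ofFn_congr h]
      congr 1
      funext j
      have : ∀ (n n' : ℕ) (hn : n = n') (i : Fin (n + 1)) (j : Fin n'),
          Fin.cast (congrArg (· + 1) hn) (Equiv.swap 0 i (Fin.cast hn.symm j).succ) =
            Equiv.swap 0 (Fin.cast (congrArg (· + 1) hn) i) j.succ := by
        rintro n _ rfl i j
        rfl
      exact congrArg l (this _ _ h i j)
    simp only [foldP, shuffleStep, hd]
    have hdec : unif (Equiv.Perm (Fin (a :: l₀).length)) = (unif (Fin (l₀.length + 1))).bind fun p =>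
        (unif (Equiv.Perm (Fin l₀.length))).map fun e => Equiv.Perm.decomposeFin.symm (p, e) := by
      rw [show unif (Equiv.Perm (Fin (a :: l₀).length)) = _ from
        (unif_map_equiv (Equiv.Perm.decomposeFin (n := l₀.length)).symm).symm, unif_prod, PMF.map_bind]
      simp only [PMF.map_comp]
      rfl
    rw [hdec, PMF.map_bind, PMF.map_comp, PMF.bind_map]
    congr 1
    funext p
    simp only [Function.comp_apply, PMF.map_comp]
    refine (ih _ _).trans ?_
    congr 1
    funext e
    simp [List.ofFn_succ, Equiv.Perm.decomposeFin_symm_apply_succ]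

theorem takePad_eq_ofFn (c : ℕ) (l : List Data) :
    takePad c l = List.ofFn fun i : Fin c => l[(i : ℕ)]?.getD Data.nil := by
  induction c generalizing l with
  | zero => simp [takePad]
  | succ c ih => simp [takePad, ih, List.ofFn_succ, List.head?_eq_getElem?]

section

variable {β : ℝ} {ι : Type} {sz : ι → ℕ} {O : ι → Oracle} {k : ℕ} {env : ι → Store}

theorem PEv.fairBit : PEv β sz O Prog.fairBit k env fun _ => (unif Bool).map Data.ofBool := by
  refine PEv.nil.bindD ?_
  refine (PEv.cons (by omega) (by omega) (fun _ => by simp; rfl) (fun _ => by simp; rfl)).bindD ?_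
  refine (PEv.cons (by omega) (by omega) (fun _ => by simp; rfl) (fun _ => by simp; rfl)).bindD ?_
  refine (PEv.cons (by omega) (by omega) (fun _ => by simp (disch := omega); rfl)
    (fun _ => by simp; rfl)).bindD ?_
  refine (PEv.choose (by omega) (fun _ => by simp; rfl)).congr fun _ => ?_
  rw [← unif_map_equiv finTwoEquiv, PMF.map_comp]
  refine (pick_ofFn fun i : Fin 2 => Data.ofBool (finTwoEquiv i)).trans ?_
  rfl

theorem PEv.bits {x : ℕ} (hx : x < k) {n : ι → ℕ} (ex : ∀ i, env i x = Data.unary (n i))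
    (hn : PolyB sz n) : PEv β sz O (Prog.bits x) k env
      fun i => (unifBits (n i)).map fun r => Data.ofBits (List.ofFn r) := by
  simp only [Data.unary_eq] at ex
  refine (PEv.mapM (A := fun _ => Data) (B := fun _ => Bool) (repA := fun _ => id)
    (repB := fun _ => Data.ofBool) (f := fun _ _ => unif Bool)
    (l := fun i => List.replicate (n i) (Data.ofBool true)) hx (by simpa using ex) (by simpa using hn)
    PEv.fairBit).congr fun i => ?_
  rw [mapP_replicate, ← unifBits_map_ofFn, PMF.map_comp]
  rfl

theorem PEv.swaps {h x : ℕ} (hh : h < k) (hx : x < k) {d : ι → Data} {l : ι → List Data}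
    (eh : ∀ i, env i h = d i) (ex : ∀ i, env i x = Data.ofList (l i))
    (hl : PolyB sz fun i => (l i).length) :
    PEv β sz O (Prog.swaps h x) k env fun i => PMF.pure (Data.ofList ((swapList (d i) (l i)).map
      fun p => Data.cons p.1 (Data.ofList p.2))) := by
  set g : Data → List Data × List (Data × List Data) → Data → List Data × List (Data × List Data) :=
    fun h s a => (a :: s.1, (a, h :: s.1) :: s.2.map fun p => (p.1, a :: p.2)) with hg
  have key : ∀ h (l : List Data), l.foldr (fun a s => g h s a) ([], []) = (l, swapList h l) := by
    intro h l
    induction l with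
    | nil => rfl
    | cons a l ih =>
      rw [List.foldr_cons, ih]
      rfl
  refine (PEv.reverse hx ex hl).bindD (PEv.nil.bindD ?_)
  refine (PEv.cons (by omega) (by omega) (fun _ => by simp; rfl) (fun _ => by simp; rfl)).bindD ?_
  refine (PEv.foldD (S := fun _ => List Data × List (Data × List Data)) (A := fun _ => Data)
    (rep := fun _ s => Data.cons (Data.ofList s.1)
      (Data.ofList (s.2.map fun p => Data.cons p.1 (Data.ofList p.2)))) (repA := fun _ => id)
    (g := fun i => g (d i)) (s₀ := fun _ => ([], [])) (l := fun i => (l i).reverse) (by omega)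
    (by omega) (fun i => by simp (disch := omega)) (fun i => by simp [Data.ofList]) (by simpa using hl)
    ?_).bindD ?_
  · refine (PEv.hd (by omega) (fun j => by simp (disch := omega); rfl)).bindD ?_
    refine (PEv.tl (by omega) (fun j => by simp (disch := omega); rfl)).bindD ?_
    refine (PEv.cons (by omega) (by omega) (fun j => by simp (disch := omega) [eh]; rfl)
      (fun j => by simp (disch := omega); rfl)).bindD ?_
    refine (PEv.cons (by omega) (by omega) (fun j => by simp (disch := omega); rfl)
      (fun j => by simp (disch := omega); rfl)).bindD ?_
    refine (PEv.mapD (A := fun _ => Data × List Data)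
      (repA := fun _ p => Data.cons p.1 (Data.ofList p.2)) (l := fun j => j.2.acc.2)
      (g := fun j p => Data.cons p.1 (Data.ofList (j.2.cur :: p.2)))
      (by omega) (fun j => by simp (disch := omega)) ?_ ?_).bindD ?_
    · refine hl.sigma.mono fun j => ?_
      have h1 : ∀ h (l : List Data) s, (l.foldl (g h) s).2.length = l.length + s.2.length := by
        intro h l
        induction l with
        | nil => simp
        | cons a l ih =>
          intro s
          rw [List.foldl_cons, ih]
          simp [hg]
          omega
      rw [j.2.acc_eq, h1]
      have := j.2.pre_length
      simp at this ⊢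
      omega
    · refine (PEv.hd (by omega) (fun j => by simp (disch := omega); rfl)).bindD ?_
      refine (PEv.tl (by omega) (fun j => by simp (disch := omega); rfl)).bindD ?_
      refine (PEv.cons (by omega) (by omega) (fun j => by simp (disch := omega); rfl)
        (fun j => by simp (disch := omega); rfl)).bindD ?_
      exact (PEv.cons (by omega) (by omega) (fun j => by simp (disch := omega))
        (fun j => by simp (disch := omega) [Data.ofList]))
    refine (PEv.cons (by omega) (by omega) (fun j => by simp (disch := omega); rfl)
      (fun j => by simp (disch := omega); rfl)).bindD ?_
    refine (PEv.cons (by omega) (by omega) (fun j => by simp (disch := omega); rfl)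
      (fun j => by simp (disch := omega); rfl)).bindD ?_
    refine (PEv.cons (by omega) (by omega) (fun j => by simp (disch := omega); rfl)
      (fun j => by simp (disch := omega); rfl)).congr fun j => ?_
    simp [hg, Data.ofList, Function.comp_def]
  · refine (PEv.tl (by omega) (fun j => by simp (disch := omega); rfl)).congr fun i => ?_
    rw [key]
    rfl

theorem PEv.draw {x : ℕ} (hx : x < k) {l : ι → List Data} (ex : ∀ i, env i x = Data.ofList (l i))
    (hl : PolyB sz fun i => (l i).length) :
    PEv β sz O (Prog.draw x) k env
      fun i => (drawP (l i)).map fun r => Data.cons r.1 (Data.ofList r.2) := by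
  refine (PEv.hd hx ex).bindD ?_
  refine (PEv.tl (by omega) (fun i => by simp (disch := omega) [ex]; rfl)).bindD ?_
  refine (PEv.swaps (l := fun i => (l i).tail) (by omega) (by omega)
    (fun i => by simp (disch := omega); rfl) (fun i => by simp (disch := omega))
    (hl.mono fun i => by simp)).bindD ?_
  refine (PEv.cons (by omega) (by omega) (fun i => by simp (disch := omega); rfl)
    (fun i => by simp (disch := omega); rfl)).bindD ?_
  refine (PEv.cons (by omega) (by omega) (fun i => by simp (disch := omega) ; rfl)
    (fun i => by simp (disch := omega); rfl)).bindD ?_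
  refine (PEv.choose (by omega) (fun i => by simp (disch := omega); rfl)).congr fun i => ?_
  rw [Data.toList, Data.toList_ofList]
  match l i with
  | [] =>
    simp [swapList, drawP, PMF.pure_map, Data.ofList]
    refine (pick_ofFn (n := 0) fun _ => Data.cons Data.nil Data.nil).trans ?_
    exact PMF.map_const _ _
  | h :: t =>
    have e : Data.cons ((h :: t).head?.getD Data.nil) (Data.ofList (h :: t).tail) ::
        (swapList ((h :: t).head?.getD Data.nil) (h :: t).tail).map
        (fun p => Data.cons p.1 (Data.ofList p.2)) = List.ofFn fun i : Fin (t.length + 1) =>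
          Data.cons ((h :: t).get i) (Data.ofList
            (List.ofFn fun j : Fin t.length => (h :: t).get (Equiv.swap 0 i j.succ))) := by
      rw [List.ofFn_succ]
      congr 1
      · simp
      · simp only [ofFn_swap]
        simp [swapList_eq_ofFn, List.map_ofFn, Function.comp_def]
    rw [e, pick_ofFn, drawP, PMF.map_comp]
    rfl

theorem length_of_mem_support_drawP {l : List Data} {r : Data × List Data}
    (h : r ∈ (drawP l).support) : r.2.length ≤ l.length := by
  match l with
  | [] =>
    have : r = (Data.nil, []) := by simpa [drawP] using h
    simp [this]
  | a :: t =>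
    rw [drawP, PMF.support_map] at h
    obtain ⟨i, -, rfl⟩ := h
    simp

theorem length_of_mem_support_foldP_shuffleStep {A : Type} {l₀ : List A}
    {s s' : List Data × List Data} (h : s' ∈ (foldP (fun s _ => shuffleStep s) s l₀).support) :
    s'.1.length ≤ s.1.length ∧ s'.2.length ≤ s.2.length + l₀.length := by
  induction l₀ generalizing s with
  | nil =>
    have : s' = s := by simpa [foldP] using h
    simp [this]
  | cons a l₀ ih =>
    rw [foldP, PMF.mem_support_bind_iff] at h
    obtain ⟨s₁, h₁, h⟩ := h
    rw [shuffleStep, PMF.support_map] at h₁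
    obtain ⟨r, hr, rfl⟩ := h₁
    have h1 := ih h
    have h2 := length_of_mem_support_drawP hr
    simp only [List.length_cons] at h1 ⊢
    omega

theorem PEv.shuffle {x y : ℕ} (hx : x < k) (hy : y < k) {n : ι → ℕ} {l : ∀ i, Fin (n i) → Data}
    (ex : ∀ i, env i x = Data.unary (n i)) (ey : ∀ i, env i y = Data.ofList (List.ofFn (l i)))
    (hn : PolyB sz n) :
    PEv β sz O (Prog.shuffle x y) k env fun i => (unif (Equiv.Perm (Fin (n i)))).map
      fun π => Data.ofList (List.ofFn fun j => l i (π j)) := by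
  simp only [Data.unary_eq] at ex
  have hfold : ∀ i, foldP (fun s _ => shuffleStep s) (List.ofFn (l i), [])
      (List.replicate (n i) (Data.ofBool true)) = (unif (Equiv.Perm (Fin (n i)))).map
        fun π => ([], (List.ofFn fun j => l i (π j)).reverse) := by
    intro i
    have h := foldP_shuffleStep (List.replicate (n i) (Data.ofBool true))
      (fun j => l i (Fin.cast (by simp) j)) []
    have e : ∀ (n m : ℕ) (h : m = n) (l : Fin n → Data) (A : List Data),
        (foldP (fun s _ => shuffleStep s) (List.ofFn fun j : Fin m => l (Fin.cast h j), []) A =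
          (unif (Equiv.Perm (Fin m))).map fun π =>
            ([], (List.ofFn fun i => l (Fin.cast h (π i))).reverse ++ [])) →
        foldP (fun s _ => shuffleStep s) (List.ofFn l, []) A =
          (unif (Equiv.Perm (Fin n))).map fun π => ([], (List.ofFn fun j => l (π j)).reverse) := by
      rintro n _ rfl l A h
      simpa using h
    exact e _ _ (by simp) _ _ h
  refine PEv.nil.bindD ?_
  refine (PEv.cons (by omega) (by omega) (fun i => by simp (disch := omega) [ey]; rfl)
    (fun _ => by simp; rfl)).bindD ?_
  have h1 := PEv.fold (β := β) (sz := sz) (O := O) (k := k + 2) (x := x) (y := k + 1)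
    (env := fun i => update (update (env i) k Data.nil) (k + 1)
      (Data.cons (Data.ofList (List.ofFn (l i))) Data.nil)) (body := fun b =>
      .bind (.hd (b + 1)) fun l => .bind (.tl (b + 1)) fun out => .bind (.draw l) fun r =>
      .bind (.hd r) fun a => .bind (.tl r) fun l' => .bind (.cons a out) fun out' => .cons l' out')
    (S := fun _ => List Data × List Data) (A := fun _ => Data)
    (rep := fun _ s => Data.cons (Data.ofList s.1) (Data.ofList s.2)) (repA := fun _ => id)
    (f := fun _ s _ => shuffleStep s) (l := fun i => List.replicate (n i) (Data.ofBool true))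
    (s₀ := fun i => (List.ofFn (l i), []))
    (by omega) (by omega) (fun i => by simp (disch := omega) [ex]) (fun i => by simp [Data.ofList])
    (by simpa using hn) ?_
  · refine (PEv.bind (A := fun _ => List Data × List Data) h1
      (ν := fun _ s => PMF.pure (Data.ofList s.2.reverse)) ?_).congr fun i => ?_
    · refine (PEv.tl (by omega) (fun j => by simp (disch := omega); rfl)).bindD ?_
      refine PEv.reverse (l := fun j : (i : ι) × {s : List Data × List Data //
        s ∈ (foldP (fun s _ => shuffleStep s) (List.ofFn (l i), [])
          (List.replicate (n i) (Data.ofBool true))).support} => j.2.1.2) (by omega) (fun j => by simp (disch := omega))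
        (hn.sigma.mono fun j => ?_)
      simpa using (length_of_mem_support_foldP_shuffleStep j.2.2).2
    · rw [hfold, PMF.bind_map, ← PMF.bind_pure_comp]
      congr 1
      funext π
      simp
  · refine (PEv.hd (by omega) (fun j => by simp (disch := omega); rfl)).bindD ?_
    refine (PEv.tl (by omega) (fun j => by simp (disch := omega); rfl)).bindD ?_
    refine (PEv.bind (PEv.draw (l := fun j => j.2.acc.1) (by omega) (fun j => by simp (disch := omega))
      (hn.sigma.mono fun j => ?_)) (ν := fun j r => PMF.pure (Data.cons (Data.ofList r.2)
        (Data.ofList (r.1 :: j.2.acc.2)))) ?_).congr fun j => ?_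
    · simpa using (length_of_mem_support_foldP_shuffleStep j.2.mem).1
    · refine (PEv.hd (by omega) (fun j => by simp (disch := omega); rfl)).bindD ?_
      refine (PEv.tl (by omega) (fun j => by simp (disch := omega); rfl)).bindD ?_
      refine (PEv.cons (by omega) (by omega) (fun j => by simp (disch := omega); rfl)
        (fun j => by simp (disch := omega); rfl)).bindD ?_
      exact (PEv.cons (by omega) (by omega) (fun j => by simp (disch := omega))
        (fun j => by simp (disch := omega) [Data.ofList]))
    · rw [shuffleStep, PMF.map_comp, ← PMF.bind_pure_comp]
      rfl

theorem PEv.identity {x : ℕ} (hx : x < k) {n : ι → ℕ} (ex : ∀ i, env i x = Data.unary (n i))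
    (hn : PolyB sz n) :
    PEv β sz O (Prog.identity x) k env fun i => PMF.pure (Data.ofList
      (List.ofFn fun j : Fin (n i) => Data.ofBits (List.ofFn fun j' => decide (j = j')))) := by
  simp only [Data.unary_eq] at ex
  -- the sequence whose only nonzero bit is at the position `j`
  set e : ℕ → List Data := fun j => List.replicate j Data.nil ++ [Data.ofBool true] with he
  set g : ℕ → ℕ × List (List Data) → Data → ℕ × List (List Data) :=
    fun n s _ => (s.1 + 1, takePad n (e s.1) :: s.2) with hg
  have key : ∀ n c, (List.replicate c (Data.ofBool true)).foldl (g n) (0, []) =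
      (c, ((List.range c).map fun j => takePad n (e j)).reverse) := by
    intro n c
    induction c with
    | zero => rfl
    | succ c ih =>
      rw [List.replicate_succ', List.foldl_append, ih]
      simp [hg, List.range_succ]
  refine PEv.nil.bindD ?_
  refine (PEv.cons (by omega) (by omega) (fun _ => by simp; rfl) (fun _ => by simp; rfl)).bindD ?_
  refine (PEv.cons (by omega) (by omega) (fun _ => by simp; rfl)
    (fun _ => by simp (disch := omega); rfl)).bindD ?_
  refine (PEv.cons (by omega) (by omega) (fun _ => by simp; rfl)
    (fun _ => by simp (disch := omega); rfl)).bindD ?_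
  refine (PEv.foldD (S := fun _ => ℕ × List (List Data)) (A := fun _ => Data)
    (rep := fun _ s => Data.cons (Data.ofList (e s.1)) (Data.ofList (s.2.map Data.ofList)))
    (repA := fun _ => id) (g := fun i => g (n i)) (s₀ := fun i => (0, []))
    (l := fun i => List.replicate (n i) (Data.ofBool true))
    (by omega) (by omega) (fun i => by simp (disch := omega) [ex])
    (fun i => by simp [Data.ofList, he, Data.ofBool]) (by simpa using hn) ?_).bindD ?_
  · refine (PEv.hd (by omega) (fun j => by simp (disch := omega); rfl)).bindD ?_
    refine (PEv.tl (by omega) (fun j => by simp (disch := omega); rfl)).bindD ?_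
    refine (PEv.split (l := fun j => List.replicate (n j.1) (Data.ofBool true))
      (by omega) (by omega) (fun j => by simp (disch := omega) [ex])
      (fun j => by simp (disch := omega); rfl) (by simpa using hn.sigma)).bindD ?_
    refine (PEv.hd (by omega) (fun j => by simp (disch := omega); rfl)).bindD ?_
    refine (PEv.cons (by omega) (by omega) (fun j => by simp (disch := omega); rfl)
      (fun j => by simp (disch := omega); rfl)).bindD ?_
    refine (PEv.cons (by omega) (by omega) (fun j => by simp (disch := omega); rfl)
      (fun j => by simp (disch := omega); rfl)).bindD ?_
    refine (PEv.cons (by omega) (by omega) (fun j => by simp (disch := omega); rfl)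
      (fun j => by simp (disch := omega); rfl)).congr fun j => ?_
    simp [hg, he, Data.ofList, List.replicate_succ]
  · refine (PEv.tl (by omega) (fun j => by simp (disch := omega); rfl)).bindD ?_
    refine (PEv.reverse (l := fun i => (((List.range (n i)).map fun j => takePad (n i) (e j)).map
      Data.ofList).reverse) (by omega) (fun j => by simp (disch := omega) [key]) (by simpa using hn)).congr
      fun i => ?_
    congr 2
    rw [List.reverse_reverse]
    refine List.ext_get (by simp) fun a h1 h2 => ?_
    simp only [List.length_ofFn] at h2
    simp only [List.get_eq_getElem, List.getElem_map, List.getElem_range, List.getElem_ofFn,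
      takePad_eq_ofFn, Data.ofBits, List.map_ofFn]
    congr 2
    funext b
    simp only [he, Function.comp_apply, Fin.ext_iff]
    rcases lt_trichotomy (b : ℕ) a with h | h | h
    · rw [List.getElem?_append_left (by simpa using h)]
      simp [h, h.ne', Data.ofBool]
    · simp [h]
    · rw [List.getElem?_append_right (by simpa using h.le), List.getElem?_eq_none (by simp; omega)]
      simp [h.ne, Data.ofBool]

theorem PEv.perm {x : ℕ} (hx : x < k) {n : ι → ℕ} (ex : ∀ i, env i x = Data.unary (n i))
    (hn : PolyB sz n) :
    PEv β sz O (Prog.perm x) k env fun i => (unif (Equiv.Perm (Fin (n i)))).map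
      fun π => Data.ofList ((permRows π).map Data.ofBits) := by
  refine (PEv.identity hx ex hn).bindD ?_
  refine (PEv.shuffle (l := fun i j => Data.ofBits (List.ofFn fun j' => decide (j = j')))
    (by omega) (by omega) (fun i => by simp (disch := omega) [ex]) (fun i => by simp) hn).congr fun i => ?_
  congr 1
  funext π
  simp [permRows, List.map_ofFn, Function.comp_def]

end

/-! ### The algorithms of the code -/

/-- The encoder, once the blocks `(x_j, w_j)` have been chosen. -/
noncomputable def encodeWith {N : ℕ} (M : ℕ) (blocks : List (List Bool)) (z : Fin N → Bool)
    (π : Equiv.Perm (Fin N)) : PMF (Fin N → Bool) :=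
  (unifBits (N - M)).map fun r =>
    fun i => xor ((blocks.flatten ++ List.ofFn r).getD (π i) false) (z (π i))

theorem encode_eq_bind (q : ℝ) {n : ℕ} (m : ℕ) {N : ℕ} (f : (Fin n → Bool) → Bool)
    (z : Fin N → Bool) (π : Equiv.Perm (Fin N)) :
    encode q m f z π = (iid (noisySample q f) m).bind fun blocks =>
      encodeWith ((n + 1) * m) blocks z π := rfl

/-- The fragment `p` computes `f` from the security parameter and the auxiliary input `adv`, which
are in the variables `0` and `1`. -/
def Computes (p : Prog) (adv f : ℕ → Data) : Prop :=
  ∀ ⦃β : ℝ⦄ ⦃ι : Type⦄ ⦃sz : ι → ℕ⦄ ⦃O : ι → Oracle⦄ ⦃k : ℕ⦄ ⦃env : ι → Store⦄ (lam : ι → ℕ),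
    (∀ i, lam i ≤ sz i) → 2 ≤ k → (∀ i, env i 0 = Data.unary (lam i)) →
    (∀ i, env i 1 = adv (lam i)) → PEv β sz O p k env fun i => PMF.pure (f (lam i))

/-- The fragment `p s x` computes the function of the family with the key `s` at the point `x`. -/
def ComputesF (p : ℕ → ℕ → Prog) (adv : ℕ → Data) (𝓕 : FunctionFamily) : Prop :=
  ∀ ⦃β : ℝ⦄ ⦃ι : Type⦄ ⦃sz : ι → ℕ⦄ ⦃O : ι → Oracle⦄ ⦃k : ℕ⦄ ⦃env : ι → Store⦄ (lam : ι → ℕ)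
    ⦃s x : ℕ⦄ (sv : ∀ i, Fin (𝓕.ℓ (lam i)) → Bool) (xv : ∀ i, Fin (𝓕.n (lam i)) → Bool),
    (∀ i, lam i ≤ sz i) → 2 ≤ k → s < k → x < k → (∀ i, env i 0 = Data.unary (lam i)) →
    (∀ i, env i 1 = adv (lam i)) → (∀ i, env i s = Data.ofBits (List.ofFn (sv i))) →
    (∀ i, env i x = Data.ofBits (List.ofFn (xv i))) →
    PEv β sz O (p s x) k env fun i => PMF.pure (Data.ofBool (𝓕.F (lam i) (sv i) (xv i)))

namespace Prog

/-- The entry `i` of the list `x`. -/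
def nth : ℕ → ℕ → Prog
  | 0, x => hd x
  | i + 1, x => bind (tl x) fun y => nth i y

/-- Calls a program with the entry `i` of the auxiliary input as its auxiliary input. -/
def callAdvice (c : Cmd) (i : ℕ) (args : List ℕ) : Prog :=
  bind (nth i 1) fun a => call c (0 :: a :: args) nil

/-- `3 m (n + 1)²` in unary representation. -/
def blockLen (n m : ℕ) : Prog :=
  bind nil fun e => bind tt fun t => bind (cons t n) fun n' => bind (mul n' n') fun sq =>
  bind (cons t e) fun a => bind (cons t a) fun b => bind (cons t b) fun c =>
  bind (mul c m) fun d => mul d sq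

/-- Computes `ℓ`, `n`, `m` and `N`, and continues with these variables. -/
def setup (pℓ pn pm : Prog) (cont : ℕ → ℕ → ℕ → ℕ → Prog) : Prog :=
  bind pℓ fun ℓ => bind pn fun n => bind pm fun m => bind (blockLen n m) fun N => cont ℓ n m N

/-- Splits the key `x` into `s`, `z` and the rows of the permutation matrix, and continues with these
variables. -/
def parse (ℓ N x : ℕ) (cont : ℕ → ℕ → ℕ → Prog) : Prog :=
  bind (split ℓ x) fun p => bind (hd p) fun s => bind (tl p) fun rest =>
  bind (split N rest) fun p' => bind (hd p') fun z => bind (tl p') fun rest' =>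
  bind (cut N N rest') fun rows => cont s z rows

/-- The program for `encodeWith`. -/
def finish (N blocks z rows : ℕ) : Prog :=
  bind (flatten blocks) fun f => bind (drop f N) fun c => bind (bits c) fun r =>
  bind (append f r) fun a => bind (xorList a z) fun v => mapM rows fun row => select row v

/-- The program for `noisySample`. -/
def sample (pF : ℕ → ℕ → Prog) (n s : ℕ) : Prog :=
  bind (bits n) fun x => bind coin fun e => bind (pF s x) fun w => bind (xor w e) fun v =>
  bind nil fun o => bind (cons v o) fun l => append x l

/-- The program for `Key`. -/
def key (pℓ pn pm : Prog) : Prog :=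
  setup pℓ pn pm fun ℓ _ _ N => bind (bits ℓ) fun s => bind (bits N) fun z =>
    bind (perm N) fun rows => bind (flatten rows) fun r => bind (append z r) fun zr => append s zr

/-- The program for `Enc` with the key `x`. -/
def enc (pℓ pn pm : Prog) (pF : ℕ → ℕ → Prog) (x : ℕ) : Prog :=
  setup pℓ pn pm fun ℓ n m N => parse ℓ N x fun s z rows =>
    bind (mapM m fun _ => sample pF n s) fun blocks => finish N blocks z rows

end Prog

theorem nth_spec {β : ℝ} {ι : Type} {sz : ι → ℕ} {O : ι → Oracle} (j : ℕ) {k : ℕ}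
    {env : ι → Store} {x : ℕ} (hx : x < k) {l : ι → List Data}
    (ex : ∀ i, env i x = Data.ofList (l i)) :
    PEv β sz O (Prog.nth j x) k env fun i => PMF.pure ((l i)[j]?.getD Data.nil) := by
  induction j generalizing k env x l with
  | zero =>
    refine (PEv.hd hx ex).congr fun i => ?_
    rw [Data.hd_ofList, List.head?_eq_getElem?]
  | succ j ih =>
    refine (PEv.tl hx ex).bindD ((ih (by omega) (l := fun i => (l i).tail) fun i => by simp).congr
      fun i => ?_)
    simp

theorem callAdvice_spec {c : Cmd} {a adv : ℕ → Data} {j : ℕ} {P : Polynomial ℕ}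
    (hc : c.IsDeterministic) {L : ℕ → List Data} (hadv : ∀ lam, adv lam = Data.ofList (L lam))
    (hL : ∀ lam, (L lam)[j]? = some (a lam))
    {β : ℝ} {ι : Type} {sz : ι → ℕ} {O : ι → Oracle} {k : ℕ} {env : ι → Store} (lam : ι → ℕ)
    (hlam : ∀ i, lam i ≤ sz i) (hk : 2 ≤ k) (e0 : ∀ i, env i 0 = Data.unary (lam i))
    (e1 : ∀ i, env i 1 = adv (lam i)) {args : List ℕ} (hargs : ∀ x ∈ args, x < k)
    {inp : ι → List Data} (hinp : ∀ i, args.map (env i) = inp i) {v : ι → Data}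
    (h : ∀ i, HaltsWithin 0 noOracle c (Data.unary (lam i) :: a (lam i) :: inp i) (P.eval (lam i)) ∧
      outputAfter 0 noOracle c (Data.unary (lam i) :: a (lam i) :: inp i) (P.eval (lam i)) =
        PMF.pure (v i)) :
    PEv β sz O (Prog.callAdvice c j args) k env fun i => PMF.pure (v i) := by
  refine (nth_spec j (x := 1) (by omega) (l := fun i => L (lam i))
    (fun i => by rw [e1, hadv])).bindD ?_
  refine PEv.callD hc ?_ (T := fun i => P.eval (lam i)) ?_ (fun i => ?_) h
  · simp only [List.mem_cons, forall_eq_or_imp]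
    exact ⟨by omega, by omega, fun x hx => by have := hargs x hx; omega⟩
  · exact PolyB.of_le_size (sz := lam) ⟨P, fun i => le_rfl⟩ hlam
  · rw [List.map_cons, List.map_cons, update_of_ne (by omega), update_self, e0, hL]
    simp only [Option.getD_some, List.cons.injEq, true_and]
    rw [← hinp]
    refine List.map_congr_left fun x hx => ?_
    rw [update_of_ne (hargs x hx).ne]

theorem computes_callAdvice {f : ℕ → Data} {c : Cmd} {a adv : ℕ → Data} {j : ℕ}
    {P : Polynomial ℕ} (hc : c.IsDeterministic) {L : ℕ → List Data}
    (hadv : ∀ lam, adv lam = Data.ofList (L lam)) (hL : ∀ lam, (L lam)[j]? = some (a lam))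
    (h : ∀ lam, HaltsWithin 0 noOracle c [Data.unary lam, a lam] (P.eval lam) ∧
      outputAfter 0 noOracle c [Data.unary lam, a lam] (P.eval lam) = PMF.pure (f lam)) :
    Computes (Prog.callAdvice c j []) adv f :=
  fun _ _ _ _ _ _ lam hlam hk e0 e1 => callAdvice_spec hc hadv hL lam hlam hk e0 e1 (by simp)
    (inp := fun _ => []) (by simp) fun i => h (lam i)

theorem computesF_callAdvice {𝓕 : FunctionFamily} {c : Cmd} {a adv : ℕ → Data} {j : ℕ}
    {P : Polynomial ℕ} (hc : c.IsDeterministic) {L : ℕ → List Data}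
    (hadv : ∀ lam, adv lam = Data.ofList (L lam)) (hL : ∀ lam, (L lam)[j]? = some (a lam))
    (h : ∀ lam (i : (Fin (𝓕.ℓ lam) → Bool) × (Fin (𝓕.n lam) → Bool)),
      HaltsWithin 0 noOracle c (Data.unary lam :: a lam ::
        [Data.ofBits (List.ofFn i.1), Data.ofBits (List.ofFn i.2)]) (P.eval lam) ∧
      outputAfter 0 noOracle c (Data.unary lam :: a lam ::
        [Data.ofBits (List.ofFn i.1), Data.ofBits (List.ofFn i.2)]) (P.eval lam) =
        PMF.pure (Data.ofBool (𝓕.F lam i.1 i.2))) :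
    ComputesF (fun s x => Prog.callAdvice c j [s, x]) adv 𝓕 := by
  intro _ _ _ _ _ _ lam s x sv xv hlam hk hs hx e0 e1 es ex
  exact callAdvice_spec hc hadv hL lam hlam hk e0 e1 (by simp [hs, hx])
    (inp := fun i => [Data.ofBits (List.ofFn (sv i)), Data.ofBits (List.ofFn (xv i))])
    (fun i => by simp [es, ex]) fun i => h (lam i) (sv i, xv i)

section

variable {β : ℝ} {ι : Type} {sz : ι → ℕ} {O : ι → Oracle} {k : ℕ} {env : ι → Store}

theorem unary_succ (n : ℕ) : Data.unary (n + 1) = Data.cons (Data.ofBool true) (Data.unary n) := rfl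

theorem blockLen_spec {x y : ℕ} (hx : x < k) (hy : y < k) {n m : ι → ℕ}
    (ex : ∀ i, env i x = Data.unary (n i)) (ey : ∀ i, env i y = Data.unary (m i))
    (hn : PolyB sz n) (hm : PolyB sz m) :
    PEv β sz O (Prog.blockLen x y) k env
      fun i => PMF.pure (Data.unary (blockLength (n i) (m i))) := by
  refine PEv.nil.bindD (PEv.tt.bindD ?_)
  refine (PEv.cons (by omega) (by omega) (fun i => by simp; rfl)
    (fun i => by simp (disch := omega) [ex]; rfl)).bindD ?_
  refine (PEv.mul (a := fun i => n i + 1) (b := fun i => n i + 1) (by omega) (by omega)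
    (fun i => by simp [unary_succ]) (fun i => by simp [unary_succ]) (hn.add (.const 1))
    (hn.add (.const 1))).bindD ?_
  refine (PEv.cons (by omega) (by omega) (fun i => by simp (disch := omega); rfl)
    (fun i => by simp (disch := omega); rfl)).bindD ?_
  refine (PEv.cons (by omega) (by omega) (fun i => by simp (disch := omega); rfl)
    (fun i => by simp (disch := omega); rfl)).bindD ?_
  refine (PEv.cons (by omega) (by omega) (fun i => by simp (disch := omega); rfl)
    (fun i => by simp (disch := omega); rfl)).bindD ?_
  refine (PEv.mul (a := fun i => 3) (b := m) (by omega) (by omega)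
    (fun i => by simp; rfl) (fun i => by simp (disch := omega) [ey]) (.const 3) hm).bindD ?_
  refine (PEv.mul (a := fun i => 3 * m i) (b := fun i => (n i + 1) * (n i + 1)) (by omega) (by omega)
    (fun i => by simp) (fun i => by simp (disch := omega)) ((PolyB.const 3).mul hm)
    ((hn.add (.const 1)).mul (hn.add (.const 1)))).congr fun i => ?_
  rw [blockLength, sq]

theorem setup_spec {𝓕 : FunctionFamily} {m : ℕ → ℕ} {adv : ℕ → Data} {pℓ pn pm : Prog}
    (hℓ : Computes pℓ adv fun lam => Data.unary (𝓕.ℓ lam))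
    (hn : Computes pn adv fun lam => Data.unary (𝓕.n lam))
    (hm : Computes pm adv fun lam => Data.unary (m lam))
    (bn : PolyBounded 𝓕.n) (bm : PolyBounded m) (lam : ι → ℕ) (hlam : ∀ i, lam i ≤ sz i)
    (hk : 2 ≤ k) (e0 : ∀ i, env i 0 = Data.unary (lam i)) (e1 : ∀ i, env i 1 = adv (lam i))
    {cont : ℕ → ℕ → ℕ → ℕ → Prog} {μ : ι → PMF Data}
    (hc : ∀ env' : ι → Store, (∀ i, ∀ x < k, env' i x = env i x) →
      (∀ i, env' i k = Data.unary (𝓕.ℓ (lam i))) → (∀ i, env' i (k + 1) = Data.unary (𝓕.n (lam i))) →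
      (∀ i, env' i (k + 2) = Data.unary (m (lam i))) →
      (∀ i, env' i (k + 3) = Data.unary (blockLength (𝓕.n (lam i)) (m (lam i)))) →
      PEv β sz O (cont k (k + 1) (k + 2) (k + 3)) (k + 4) env' μ) :
    PEv β sz O (Prog.setup pℓ pn pm cont) k env μ := by
  have hb : ∀ {f : ℕ → ℕ}, PolyBounded f → PolyB sz fun i => f (lam i) := fun {f} hf => by
    obtain ⟨P, hP⟩ := hf
    exact PolyB.of_le_size (sz := lam) ⟨P, fun i => hP _⟩ hlam
  refine (hℓ lam hlam hk e0 e1).bindD ?_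
  refine (hn lam hlam (by omega) (fun i => by simp (disch := omega) [e0])
    (fun i => by simp (disch := omega) [e1])).bindD ?_
  refine (hm lam hlam (by omega) (fun i => by simp (disch := omega) [e0])
    (fun i => by simp (disch := omega) [e1])).bindD ?_
  refine (blockLen_spec (n := fun i => 𝓕.n (lam i)) (m := fun i => m (lam i)) (by omega) (by omega)
    (fun i => by simp (disch := omega)) (fun i => by simp (disch := omega)) (hb bn) (hb bm)).bindD ?_
  refine hc _ (fun i x hx => by simp (disch := omega)) (fun i => by simp (disch := omega))
    (fun i => by simp (disch := omega)) (fun i => by simp (disch := omega))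
    (fun i => by simp (disch := omega))

theorem ofBits_append (l l' : List Bool) :
    Data.ofBits (l ++ l') = Data.ofList (l.map Data.ofBool ++ l'.map Data.ofBool) := by
  simp [Data.ofBits]

theorem permRows_length {N : ℕ} (π : Equiv.Perm (Fin N)) : (permRows π).length = N := by
  simp [permRows]

theorem length_of_mem_permRows {N : ℕ} {π : Equiv.Perm (Fin N)} {l : List Bool}
    (h : l ∈ permRows π) : l.length = N := by
  simp only [permRows, List.mem_ofFn] at h
  obtain ⟨i, rfl⟩ := h
  simp

theorem keyBits_eq {ℓ N : ℕ} (sk : PRFKey ℓ N) : keyBits sk =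
    List.ofFn sk.1 ++ (List.ofFn sk.2.1 ++ (permRows sk.2.2).flatten) := rfl

theorem parse_spec {ℓv Nv : ι → ℕ} (sk : ∀ i, PRFKey (ℓv i) (Nv i)) {ℓ N x : ℕ} (hℓ : ℓ < k)
    (hN : N < k) (hx : x < k) (eℓ : ∀ i, env i ℓ = Data.unary (ℓv i))
    (eN : ∀ i, env i N = Data.unary (Nv i)) (ex : ∀ i, env i x = Data.ofBits (keyBits (sk i)))
    (bℓ : PolyB sz ℓv) (bN : PolyB sz Nv) {cont : ℕ → ℕ → ℕ → Prog} {μ : ι → PMF Data}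
    (hc : ∀ env' : ι → Store, (∀ i, ∀ x < k, env' i x = env i x) →
      (∀ i, env' i (k + 1) = Data.ofBits (List.ofFn (sk i).1)) →
      (∀ i, env' i (k + 4) = Data.ofBits (List.ofFn (sk i).2.1)) →
      (∀ i, env' i (k + 6) = Data.ofList ((permRows (sk i).2.2).map Data.ofBits)) →
      PEv β sz O (cont (k + 1) (k + 4) (k + 6)) (k + 7) env' μ) :
    PEv β sz O (Prog.parse ℓ N x cont) k env μ := by
  simp only [Data.unary_eq] at eℓ eN
  refine (PEv.split (l' := fun i => (List.ofFn (sk i).1).map Data.ofBool ++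
    ((List.ofFn (sk i).2.1).map Data.ofBool ++ (permRows (sk i).2.2).flatten.map Data.ofBool))
    hℓ hx eℓ (fun i => by rw [ex, keyBits_eq]; simp [Data.ofBits]) (by simpa using bℓ)).bindD ?_
  have e1 : ∀ i, takePad (List.replicate (ℓv i) (Data.ofBool true)).length
      ((List.ofFn (sk i).1).map Data.ofBool ++ ((List.ofFn (sk i).2.1).map Data.ofBool ++
        (permRows (sk i).2.2).flatten.map Data.ofBool)) = (List.ofFn (sk i).1).map Data.ofBool := by
    intro i
    have := takePad_append ((List.ofFn (sk i).1).map Data.ofBool)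
      ((List.ofFn (sk i).2.1).map Data.ofBool ++ (permRows (sk i).2.2).flatten.map Data.ofBool)
    simpa only [List.length_map, List.length_ofFn, List.length_replicate] using this
  have e2 : ∀ i, ((List.ofFn (sk i).1).map Data.ofBool ++ ((List.ofFn (sk i).2.1).map Data.ofBool ++
      (permRows (sk i).2.2).flatten.map Data.ofBool)).drop
        (List.replicate (ℓv i) (Data.ofBool true)).length =
      (List.ofFn (sk i).2.1).map Data.ofBool ++ (permRows (sk i).2.2).flatten.map Data.ofBool :=
    fun i => List.drop_left' (by simp)
  have e3 : ∀ i, takePad (List.replicate (Nv i) (Data.ofBool true)).length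
      ((List.ofFn (sk i).2.1).map Data.ofBool ++ (permRows (sk i).2.2).flatten.map Data.ofBool) =
        (List.ofFn (sk i).2.1).map Data.ofBool := by
    intro i
    have := takePad_append ((List.ofFn (sk i).2.1).map Data.ofBool)
      ((permRows (sk i).2.2).flatten.map Data.ofBool)
    simpa only [List.length_map, List.length_ofFn, List.length_replicate] using this
  have e4 : ∀ i, ((List.ofFn (sk i).2.1).map Data.ofBool ++
      (permRows (sk i).2.2).flatten.map Data.ofBool).drop
        (List.replicate (Nv i) (Data.ofBool true)).length =
      (permRows (sk i).2.2).flatten.map Data.ofBool :=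
    fun i => List.drop_left' (by simp)
  have e5 : ∀ i, segments (List.replicate (Nv i) (Data.ofBool true)).length
      (List.replicate (Nv i) (Data.ofBool true)).length
      ((permRows (sk i).2.2).flatten.map Data.ofBool) =
      (permRows (sk i).2.2).map (List.map Data.ofBool) := by
    intro i
    have := segments_flatten (c := Nv i) ((permRows (sk i).2.2).map (List.map Data.ofBool))
      (by
        intro l hl
        rw [List.mem_map] at hl
        obtain ⟨l, hl, rfl⟩ := hl
        simpa using length_of_mem_permRows hl) []
    simpa [permRows_length, List.map_flatten] using this
  refine (PEv.hd (by omega) (fun i => by rw [update_self, e1, e2])).bindD ?_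
  refine (PEv.tl (by omega) (fun i => by rw [update_of_ne (by omega), update_self, e1, e2])).bindD ?_
  refine (PEv.split (by omega) (by omega) (fun i => by simp (disch := omega) [eN]; rfl)
    (fun i => by rw [update_self, Data.tl_cons]) (by simpa using bN)).bindD ?_
  refine (PEv.hd (by omega) (fun i => by rw [update_self, e3, e4])).bindD ?_
  refine (PEv.tl (by omega) (fun i => by rw [update_of_ne (by omega), update_self, e3, e4])).bindD ?_
  refine (PEv.cut (l := fun i => List.replicate (Nv i) (Data.ofBool true))
    (lw := fun i => List.replicate (Nv i) (Data.ofBool true))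
    (l' := fun i => (permRows (sk i).2.2).flatten.map Data.ofBool) (by omega) (by omega) (by omega)
    (fun i => by simp (disch := omega) [eN]) (fun i => by simp (disch := omega) [eN])
    (fun i => by rw [update_self, Data.tl_cons]) (by simpa using bN) (by simpa using bN)).bindD ?_
  refine hc _ (fun i y hy => by simp (disch := omega)) (fun i => ?_) (fun i => ?_) (fun i => ?_)
  · simp (disch := omega) [Data.ofBits]
  · simp (disch := omega) [Data.ofBits]
  · rw [update_self, e5, List.map_map]
    rfl

end

theorem foldl_select_false {n : ℕ} (v : Fin n → Data) (s : Data) :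
    (List.ofFn fun j : Fin n => (Data.ofBool false, v j)).foldl
      (fun s p => if p.1.toBool then p.2 else s) s = s := by
  induction n with
  | zero => simp
  | succ n ih => rw [List.ofFn_succ, List.foldl_cons]; exact ih _

theorem foldl_select {n : ℕ} (p : Fin n) (v : Fin n → Data) (s : Data) :
    (List.ofFn fun j : Fin n => (Data.ofBool (decide (p = j)), v j)).foldl
      (fun s p => if p.1.toBool then p.2 else s) s = v p := by
  induction n generalizing s with
  | zero => exact p.elim0
  | succ n ih =>
    rw [List.ofFn_succ, List.foldl_cons]
    refine Fin.cases ?_ (fun p => ?_) p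
    · simp only [decide_true, Data.toBool_ofBool, if_true]
      have : ∀ j : Fin n, decide ((0 : Fin (n + 1)) = j.succ) = false := fun j =>
        decide_eq_false (Fin.succ_ne_zero j).symm
      simp only [this]
      exact foldl_select_false _ _
    · simp only [Fin.succ_inj]
      exact ih p (fun j => v j.succ) _

theorem zip_ofFn {A B : Type} {n : ℕ} (f : Fin n → A) (g : Fin n → B) :
    (List.ofFn f).zip (List.ofFn g) = List.ofFn fun i => (f i, g i) :=
  List.ext_get (by simp) fun i h1 h2 => by simp

theorem zipWith_ofFn {A B C : Type} {n : ℕ} (h : A → B → C) (f : Fin n → A) (g : Fin n → B) :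
    List.zipWith h (List.ofFn f) (List.ofFn g) = List.ofFn fun i => h (f i) (g i) :=
  List.ext_get (by simp) fun i h1 h2 => by simp

/-- Selecting with a row of a permutation matrix. -/
theorem selectVal_row {n : ℕ} (p : Fin n) (v : Fin n → Data) :
    selectVal (List.ofFn fun j => Data.ofBool (decide (p = j))) (List.ofFn v) = v p := by
  rw [selectVal, zip_ofFn, foldl_select]

section

variable {β : ℝ} {ι : Type} {sz : ι → ℕ} {O : ι → Oracle} {k : ℕ} {env : ι → Store}

theorem sample_spec {𝓕 : FunctionFamily} {adv : ℕ → Data} {pF : ℕ → ℕ → Prog}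
    (hF : ComputesF pF adv 𝓕) (bn : PolyBounded 𝓕.n) (lam : ι → ℕ) (hlam : ∀ i, lam i ≤ sz i)
    (hk : 2 ≤ k) (e0 : ∀ i, env i 0 = Data.unary (lam i)) (e1 : ∀ i, env i 1 = adv (lam i))
    {n s : ℕ} (hn : n < k) (hs : s < k) (en : ∀ i, env i n = Data.unary (𝓕.n (lam i)))
    (sv : ∀ i, Fin (𝓕.ℓ (lam i)) → Bool) (es : ∀ i, env i s = Data.ofBits (List.ofFn (sv i))) :
    PEv β sz O (Prog.sample pF n s) k env
      fun i => (noisySample β (𝓕.F (lam i) (sv i))).map Data.ofBits := by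
  have hb : PolyB sz fun i => 𝓕.n (lam i) := by
    obtain ⟨P, hP⟩ := bn
    exact PolyB.of_le_size (sz := lam) ⟨P, fun i => hP _⟩ hlam
  refine PEv.congr (PEv.bind (A := fun i => Fin (𝓕.n (lam i)) → Bool) (PEv.bits hn en hb)
    (ν := fun i x => (ber β).bind fun e => PMF.pure (Data.ofBits
      (List.ofFn x ++ [xor (𝓕.F (lam i) (sv i) x) e]))) ?_) fun i => ?_
  · refine PEv.bind (A := fun _ => Bool) PEv.coin ?_
    refine PEv.bindD (hF (fun j => lam j.1.1) (fun j => sv j.1.1) (fun j => j.1.2.1) (fun j => hlam _) (by omega)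
      (by omega) (by omega) (fun j => by simp (disch := omega) [e0])
      (fun j => by simp (disch := omega) [e1]) (fun j => by simp (disch := omega) [es])
      (fun j => by simp (disch := omega))) ?_
    refine PEv.bindD (PEv.xor (by omega) (by omega) (fun j => by simp; rfl)
      (fun j => by simp (disch := omega); rfl)) ?_
    refine PEv.nil.bindD ?_
    refine PEv.bindD (PEv.cons (by omega) (by omega) (fun j => by simp (disch := omega); rfl)
      (fun j => by simp; rfl)) ?_
    refine PEv.congr (PEv.append (l := fun j => (List.ofFn j.1.2.1).map Data.ofBool)
      (l' := fun j => [Data.ofBool (xor (𝓕.F (lam j.1.1) (sv j.1.1) j.1.2.1) j.2.1)])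
      (by omega) (by omega) (fun j => by simp (disch := omega) [Data.ofBits])
      (fun j => by simp (disch := omega) [Data.ofList]) ?_) fun j => ?_
    · simpa using (hb.sigma (A := fun i => {v // v ∈ (unifBits (𝓕.n (lam i))).support})).sigma
    · simp [Data.ofBits]
  · rw [noisySample, PMF.map_bind]
    congr 1
    funext x
    rw [PMF.map_comp, ← PMF.bind_pure_comp]
    rfl

theorem finish_spec {Nv nv mv : ι → ℕ} (bl : ι → List (List Bool)) (z : ∀ i, Fin (Nv i) → Bool)
    (π : ∀ i, Equiv.Perm (Fin (Nv i))) {N b zv rows : ℕ} (hN : N < k) (hb : b < k) (hz : zv < k)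
    (hrows : rows < k) (eN : ∀ i, env i N = Data.unary (Nv i))
    (eb : ∀ i, env i b = Data.ofList ((bl i).map Data.ofBits))
    (ez : ∀ i, env i zv = Data.ofBits (List.ofFn (z i)))
    (er : ∀ i, env i rows = Data.ofList ((permRows (π i)).map Data.ofBits))
    (bN : PolyB sz Nv) (bn : PolyB sz nv) (bm : PolyB sz mv)
    (hbl : ∀ i, (bl i).length = mv i ∧ ∀ l ∈ bl i, l.length = nv i + 1)
    (hNv : ∀ i, (nv i + 1) * mv i ≤ Nv i) :
    PEv β sz O (Prog.finish N b zv rows) k env fun i =>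
      (encodeWith ((nv i + 1) * mv i) (bl i) (z i) (π i)).map fun c => Data.ofBits (List.ofFn c) := by
  have hlen : ∀ i, (bl i).flatten.length = (nv i + 1) * mv i := by
    intro i
    have h : (bl i).map List.length = List.replicate (mv i) (nv i + 1) := by
      rw [List.eq_replicate_iff, List.length_map]
      refine ⟨(hbl i).1, fun x hx => ?_⟩
      rw [List.mem_map] at hx
      obtain ⟨l, hl, rfl⟩ := hx
      exact (hbl i).2 l hl
    rw [List.length_flatten, h, List.sum_replicate, smul_eq_mul, mul_comm]
  have bM : PolyB sz fun i => (nv i + 1) * mv i := (bn.add (.const 1)).mul bm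
  simp only [Data.unary_eq] at eN
  refine PEv.bindD (PEv.flatten (l := fun i => (bl i).map (List.map Data.ofBool)) (w := fun i => nv i + 1) hb
    (fun i => by rw [eb, List.map_map]; rfl) (bm.mono fun i => by simp [(hbl i).1])
    (bn.add (.const 1)) (fun i a ha => ?_)) ?_
  · rw [List.mem_map] at ha
    obtain ⟨l, hl, rfl⟩ := ha
    simp [(hbl i).2 l hl]
  refine PEv.bindD (PEv.drop (by omega) (by omega) (fun i => by rw [update_self])
    (fun i => by simp (disch := omega) [eN]; rfl) ?_) ?_
  · refine bM.mono fun i => ?_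
    rw [← List.map_flatten, List.length_map, hlen]
  refine PEv.congr (PEv.bind (A := fun i => Fin (Nv i - (nv i + 1) * mv i) → Bool)
    (PEv.bits (n := fun i => Nv i - (nv i + 1) * mv i) (by omega) (fun i => ?_)
      (bN.mono fun i => by omega)) (ν := fun i r => PMF.pure (Data.ofBits (List.ofFn
        fun j => xor (((bl i).flatten ++ List.ofFn r).getD (π i j) false) (z i (π i j))))) ?_)
    fun i => ?_
  · rw [update_self, ← List.map_flatten, List.length_map, hlen, List.drop_replicate, Data.unary_eq]
  · refine PEv.bindD (PEv.append (l := fun j => (bl j.1).flatten.map Data.ofBool)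
      (l' := fun j => (List.ofFn j.2.1).map Data.ofBool) (by omega) (by omega)
      (fun j => by rw [update_of_ne (by omega), update_of_ne (by omega), update_self, List.map_flatten])
      (fun j => by rw [update_self]; rfl)
      (bM.sigma.mono fun j => by rw [List.length_map, hlen])) ?_
    refine PEv.bindD (PEv.xorList (b := fun j => (bl j.1).flatten ++ List.ofFn j.2.1)
      (c := fun j => List.ofFn (z j.1)) (by omega) (by omega)
      (fun j => by rw [update_self, ofBits_append]) (fun j => by simp (disch := omega) [ez])
      (bN.sigma.mono fun j => ?_) (fun j => ?_)) ?_
    · have := hNv j.1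
      simp only [List.length_append, hlen, List.length_ofFn]
      omega
    · have := hNv j.1
      simp only [List.length_append, hlen, List.length_ofFn]
      omega
    have hv : ∀ i (r : Fin (Nv i - (nv i + 1) * mv i) → Bool),
        List.zipWith Bool.xor ((bl i).flatten ++ List.ofFn r) (List.ofFn (z i)) =
          List.ofFn fun j => xor (((bl i).flatten ++ List.ofFn r).getD j false) (z i j) := by
      intro i r
      have := hNv i
      refine List.ext_get (by simp [hlen]; omega) fun j h1 h2 => ?_
      simp only [List.length_ofFn] at h2
      have h3 : j < ((bl i).flatten ++ List.ofFn r).length := by simp [hlen]; omega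
      simp only [List.get_eq_getElem, List.getElem_zipWith, List.getElem_ofFn, List.getD_eq_getElem _ _ h3]
    refine PEv.congr (PEv.mapD (A := fun j => Fin (Nv j.1))
      (repA := fun j p => Data.ofBits (List.ofFn fun j' => decide (π j.1 p = j')))
      (l := fun j => List.ofFn id)
      (g := fun j p => Data.ofBool (xor (((bl j.1).flatten ++ List.ofFn j.2.1).getD (π j.1 p) false)
        (z j.1 (π j.1 p)))) (by omega) (fun j => ?_) (by simpa using bN.sigma) ?_) fun j => ?_
    · simp (disch := omega) [er, permRows, List.map_ofFn, Function.comp_def]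
    · refine PEv.congr (PEv.select (l := fun j => List.ofFn fun j' => Data.ofBool (decide (π j.1.1 j.2.cur = j')))
        (l' := fun j => List.ofFn fun j' => Data.ofBool (xor
          (((bl j.1.1).flatten ++ List.ofFn j.1.2.1).getD j' false) (z j.1.1 j'))) (by omega) (by omega)
        (fun j => ?_) (fun j => ?_) ?_ (by simp)) fun j => ?_
      · simp [Data.ofBits, List.map_ofFn, Function.comp_def]
      · rw [update_of_ne (by omega), update_of_ne (by omega), update_of_ne (by omega),
          update_of_ne (by omega), update_self, hv]
        simp [Data.ofBits, List.map_ofFn, Function.comp_def]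
      · simpa using (bN.sigma (A := fun i => {v // v ∈
          (unifBits (Nv i - (nv i + 1) * mv i)).support})).sigma
      · rw [selectVal_row]
    · simp [Data.ofBits, List.map_ofFn, Function.comp_def]
  · rw [encodeWith, PMF.map_comp, ← PMF.bind_pure_comp]
    rfl

theorem length_of_mem_support_noisySample {q : ℝ} {n : ℕ} {f : (Fin n → Bool) → Bool} {l : List Bool}
    (h : l ∈ (noisySample q f).support) : l.length = n + 1 := by
  rw [noisySample, PMF.mem_support_bind_iff] at h
  obtain ⟨x, -, h⟩ := h
  rw [PMF.support_map] at h
  obtain ⟨e, -, rfl⟩ := h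
  simp

theorem le_blockLength (n m : ℕ) : (n + 1) * m ≤ blockLength n m := by
  rw [blockLength]
  nlinarith [Nat.zero_le (m * n), Nat.zero_le (m * n * n)]

end

section

variable {𝓕 : FunctionFamily} {m : ℕ → ℕ} {adv : ℕ → Data} {pℓ pn pm : Prog} {pF : ℕ → ℕ → Prog}

theorem polyB_comp {ι : Type} {sz lam : ι → ℕ} (hlam : ∀ i, lam i ≤ sz i) {f : ℕ → ℕ}
    (hf : PolyBounded f) : PolyB sz fun i => f (lam i) := by
  obtain ⟨P, hP⟩ := hf
  exact PolyB.of_le_size (sz := lam) ⟨P, fun i => hP _⟩ hlam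

theorem polyB_blockLength {ι : Type} {sz lam : ι → ℕ} (hlam : ∀ i, lam i ≤ sz i)
    (bn : PolyBounded 𝓕.n) (bm : PolyBounded m) :
    PolyB sz fun i => blockLength (𝓕.n (lam i)) (m (lam i)) := by
  simp only [blockLength, sq]
  exact ((PolyB.const 3).mul (polyB_comp hlam bm)).mul
    (((polyB_comp hlam bn).add (.const 1)).mul ((polyB_comp hlam bn).add (.const 1)))

theorem enc_spec {β : ℝ} {ι : Type} {sz : ι → ℕ} {O : ι → Oracle} {k : ℕ} {env : ι → Store}
    (hℓ : Computes pℓ adv fun lam => Data.unary (𝓕.ℓ lam))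
    (hn : Computes pn adv fun lam => Data.unary (𝓕.n lam))
    (hm : Computes pm adv fun lam => Data.unary (m lam)) (hF : ComputesF pF adv 𝓕)
    (bℓ : PolyBounded 𝓕.ℓ) (bn : PolyBounded 𝓕.n) (bm : PolyBounded m) (lam : ι → ℕ)
    (hlam : ∀ i, lam i ≤ sz i) (hk : 2 ≤ k) (e0 : ∀ i, env i 0 = Data.unary (lam i))
    (e1 : ∀ i, env i 1 = adv (lam i)) {x : ℕ} (hx : x < k)
    (sk : ∀ i, PRFKey (𝓕.ℓ (lam i)) (blockLength (𝓕.n (lam i)) (m (lam i))))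
    (ex : ∀ i, env i x = Data.ofBits (keyBits (sk i))) :
    PEv β sz O (Prog.enc pℓ pn pm pF x) k env fun i =>
      (encode β (m (lam i)) (𝓕.F (lam i) (sk i).1) (sk i).2.1 (sk i).2.2).map
        fun c => Data.ofBits (List.ofFn c) := by
  refine setup_spec hℓ hn hm bn bm lam hlam hk e0 e1 fun env₁ h₁ eℓ en em eN => ?_
  refine parse_spec sk (by omega) (by omega) (by omega) eℓ eN
    (fun i => by rw [h₁ i x hx, ex]) (polyB_comp hlam bℓ) (polyB_blockLength hlam bn bm)
    fun env₂ h₂ es ez er => ?_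
  have bN := polyB_blockLength hlam bn bm
  refine PEv.congr (PEv.bind (A := fun _ => List (List Bool))
    (rep := fun _ bl => Data.ofList (bl.map Data.ofBits))
    (μ := fun i => iid (noisySample β (𝓕.F (lam i) (sk i).1)) (m (lam i)))
    (ν := fun i bl => (encodeWith ((𝓕.n (lam i) + 1) * m (lam i)) bl (sk i).2.1 (sk i).2.2).map
      fun c => Data.ofBits (List.ofFn c)) ?_ ?_) fun i => ?_
  · refine PEv.congr (PEv.mapM (A := fun _ => Data) (repA := fun _ => id) (B := fun _ => List Bool)
      (repB := fun _ => Data.ofBits) (f := fun i _ => noisySample β (𝓕.F (lam i) (sk i).1))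
      (l := fun i => List.replicate (m (lam i)) (Data.ofBool true)) (by omega)
      (fun i => by simp (disch := omega) [h₂, em, Data.unary_eq]) (by simpa using polyB_comp hlam bm)
      ?_) fun i => ?_
    · show PEv _ ?sz ?O _ ?kk ?env _
      refine sample_spec (sz := ?sz) (O := ?O) (k := ?kk) (env := ?env) hF bn (fun j => lam j.1)
        (fun j => hlam _) (by omega)
        (fun j => by simp (disch := omega) [h₂, h₁, e0])
        (fun j => by simp (disch := omega) [h₂, h₁, e1]) (by omega) (by omega)
        (fun j => by simp (disch := omega) [h₂, en]) (fun j => (sk j.1).1)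
        (fun j => by simp (disch := omega) [es])
    · rw [mapP_replicate]
  · show PEv _ ?sz' ?O' _ ?k' ?env' _
    refine finish_spec (sz := ?sz') (O := ?O') (k := ?k') (env := ?env')
      (Nv := fun j => blockLength (𝓕.n (lam j.1)) (m (lam j.1)))
      (nv := fun j => 𝓕.n (lam j.1)) (mv := fun j => m (lam j.1)) (fun j => j.2.1)
      (fun j => (sk j.1).2.1) (fun j => (sk j.1).2.2)
      (by omega) (by omega) (by omega) (by omega) (fun j => by simp (disch := omega) [h₂, eN])
      (fun j => by simp) (fun j => by simp (disch := omega) [ez])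
      (fun j => by simp (disch := omega) [er]) (polyB_blockLength (sz := ?sz') (lam := fun j => lam j.1) (fun j => hlam _) bn bm)
      (polyB_comp (sz := ?sz') (lam := fun j => lam j.1) (fun j => hlam _) bn)
      (polyB_comp (sz := ?sz') (lam := fun j => lam j.1) (fun j => hlam _) bm) (fun j => ?_) (fun j => le_blockLength _ _)
    have := mem_support_iid j.2.2
    exact ⟨this.1, fun l hl => length_of_mem_support_noisySample (this.2 l hl)⟩
  · rw [encode_eq_bind, PMF.map_bind]

theorem unif_prfKey (ℓ N : ℕ) : PMF.uniformOfFintype (PRFKey ℓ N) = (unifBits ℓ).bind fun s =>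
    (unifBits N).bind fun z => (unif (Equiv.Perm (Fin N))).map fun π => (s, z, π) := by
  refine (unif_prod _ _).trans ?_
  congr 1
  funext s
  rw [unif_prod, PMF.map_bind]
  congr 1
  funext z
  rw [PMF.map_comp]
  rfl

theorem key_spec {β : ℝ} {ι : Type} {sz : ι → ℕ} {O : ι → Oracle} {k : ℕ} {env : ι → Store}
    (hℓ : Computes pℓ adv fun lam => Data.unary (𝓕.ℓ lam))
    (hn : Computes pn adv fun lam => Data.unary (𝓕.n lam))
    (hm : Computes pm adv fun lam => Data.unary (m lam))
    (bℓ : PolyBounded 𝓕.ℓ) (bn : PolyBounded 𝓕.n) (bm : PolyBounded m) (lam : ι → ℕ)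
    (hlam : ∀ i, lam i ≤ sz i) (hk : 2 ≤ k) (e0 : ∀ i, env i 0 = Data.unary (lam i))
    (e1 : ∀ i, env i 1 = adv (lam i)) :
    PEv β sz O (Prog.key pℓ pn pm) k env fun i => (PMF.uniformOfFintype
      (PRFKey (𝓕.ℓ (lam i)) (blockLength (𝓕.n (lam i)) (m (lam i))))).map
        fun sk => Data.ofBits (keyBits sk) := by
  have bN := polyB_blockLength hlam bn bm
  refine setup_spec hℓ hn hm bn bm lam hlam hk e0 e1 fun env₁ h₁ eℓ en em eN => ?_
  refine PEv.congr (PEv.bind (A := fun i => Fin (𝓕.ℓ (lam i)) → Bool)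
    (PEv.bits (by omega) eℓ (polyB_comp hlam bℓ)) (ν := fun i s =>
      (unifBits (blockLength (𝓕.n (lam i)) (m (lam i)))).bind fun z =>
        (unif (Equiv.Perm (Fin (blockLength (𝓕.n (lam i)) (m (lam i)))))).bind fun π =>
          PMF.pure (Data.ofBits (keyBits (s, z, π)))) ?_) fun i => ?_
  · show PEv _ ?sz₁ ?O₁ _ ?k₁ ?env₁ _
    refine PEv.bind (sz := ?sz₁) (A := fun j => Fin (blockLength (𝓕.n (lam j.1)) (m (lam j.1))) → Bool)
      (PEv.bits (sz := ?sz₁) (O := ?O₁) (k := ?k₁) (env := ?env₁)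
        (n := fun j => blockLength (𝓕.n (lam j.1)) (m (lam j.1))) (by omega) (fun j => by simp (disch := omega) [eN])
        (polyB_blockLength (sz := ?sz₁) (lam := fun j => lam j.1) (fun j => hlam _) bn bm)) ?_
    show PEv _ ?sz₂ ?O₂ _ ?k₂ ?env₂ _
    refine PEv.bind (sz := ?sz₂) (A := fun j => Equiv.Perm (Fin (blockLength (𝓕.n (lam j.1.1)) (m (lam j.1.1)))))
      (PEv.perm (sz := ?sz₂) (O := ?O₂) (k := ?k₂) (env := ?env₂)
        (n := fun j => blockLength (𝓕.n (lam j.1.1)) (m (lam j.1.1))) (by omega) (fun j => by simp (disch := omega) [eN])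
        (polyB_blockLength (sz := ?sz₂) (lam := fun j => lam j.1.1) (fun j => hlam _) bn bm)) ?_
    show PEv _ ?sz₃ ?O₃ _ ?k₃ ?env₃ _
    refine PEv.bindD (PEv.flatten (sz := ?sz₃) (O := ?O₃) (k := ?k₃) (env := ?env₃)
      (w := fun j => blockLength (𝓕.n (lam j.1.1.1)) (m (lam j.1.1.1)))
      (l := fun j => (permRows j.2.1).map (List.map Data.ofBool))
      (by omega) (fun j => by rw [update_self, List.map_map]; rfl)
      (PolyB.mono (polyB_blockLength (sz := ?sz₃) (lam := fun j => lam j.1.1.1) (fun j => hlam _) bn bm)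
        fun j => by rw [List.length_map, permRows_length])
      (polyB_blockLength (sz := ?sz₃) (lam := fun j => lam j.1.1.1) (fun j => hlam _) bn bm) (fun j a ha => ?_)) ?_
    · rw [List.mem_map] at ha
      obtain ⟨l, hl, rfl⟩ := ha
      rw [List.length_map, length_of_mem_permRows hl]
    show PEv _ ?sz₄ ?O₄ _ ?k₄ ?env₄ _
    refine PEv.bindD (PEv.append (sz := ?sz₄) (O := ?O₄) (k := ?k₄) (env := ?env₄)
      (l := fun j => (List.ofFn j.1.2.1).map Data.ofBool)
      (l' := fun j => (permRows j.2.1).flatten.map Data.ofBool) (by omega) (by omega)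
      (fun j => by simp (disch := omega) [Data.ofBits]) (fun j => by rw [update_self, List.map_flatten])
      (by simpa using polyB_blockLength (sz := ?sz₄) (lam := fun j => lam j.1.1.1) (fun j => hlam _) bn bm)) ?_
    show PEv _ ?sz₅ ?O₅ _ ?k₅ ?env₅ _
    refine PEv.congr (PEv.append (sz := ?sz₅) (O := ?O₅) (k := ?k₅) (env := ?env₅)
      (l := fun j => (List.ofFn j.1.1.2.1).map Data.ofBool)
      (by omega) (by omega)
      (fun j => by simp (disch := omega) [Data.ofBits]) (fun j => by rw [update_self])
      (by simpa using polyB_comp (sz := ?sz₅) (lam := fun j => lam j.1.1.1) (fun j => hlam _) bℓ)) fun j => ?_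
    rw [keyBits_eq]
    simp only [Data.ofBits, List.map_append]
  · rw [unif_prfKey, PMF.map_bind]
    congr 1
    funext s
    rw [PMF.map_bind]
    congr 1
    funext z
    rw [PMF.map_comp, ← PMF.bind_pure_comp]
    rfl

end

/-! ### The decoder as a program -/

namespace Prog

/-- Computes `(π⁻¹ ∘ y) ⊕ z` from `y`, `z` and the rows of the permutation matrix of `π`: the rows
that are selected by `y` are added to `z`. -/
def unscramble (y z rows : ℕ) : Prog :=
  bind (zip y rows) fun p => fold p z fun b =>
    bind (hd (b + 2)) fun c => bind (tl (b + 2)) fun row =>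
      ite c (xorList row (b + 1)) (var (b + 1))

/-- Counts the entries `(x, w)` of `segs` with `w = F_s(x)`. -/
def count (pF : ℕ → ℕ → Prog) (n s segs : ℕ) : Prog :=
  bind nil fun e => fold segs e fun b =>
    bind (split n (b + 2)) fun p => bind (hd p) fun x => bind (tl p) fun w' => bind (hd w') fun w =>
    bind (pF s x) fun v => bind (xor w v) fun d =>
      ite d (var (b + 1)) (bind tt fun t => cons t (b + 1))

/-- The decoder on a string `y` of the right length. -/
def decode (pF : ℕ → ℕ → Prog) (ℓ n m N t x y : ℕ) : Prog :=
  parse ℓ N x fun s z rows => bind (unscramble y z rows) fun u =>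
    bind tt fun o => bind (cons o n) fun n' => bind (cut m n' u) fun segs =>
    bind (count pF n s segs) fun c => bind (drop t c) fun d => ite d tt nil

/-- The program for `Dec` with the key `x` on the string `y`. Its length is compared with `N` by
dropping as many entries of one list as the other one has, in both directions. -/
def dec (pℓ pn pm pt : Prog) (pF : ℕ → ℕ → Prog) (x y : ℕ) : Prog :=
  setup pℓ pn pm fun ℓ n m N => bind pt fun t => bind (drop N y) fun d => ite d nil
    (bind (drop y N) fun d' => ite d' nil (decode pF ℓ n m N t x y))

end Prog

section

theorem segments_eq_ofFn (c m : ℕ) (l : List Data) : segments c m l =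
    List.ofFn fun j : Fin m => List.ofFn fun i : Fin c => l[c * (j : ℕ) + i]?.getD Data.nil := by
  induction m generalizing l with
  | zero => simp [segments]
  | succ m ih =>
    rw [segments, ih, List.ofFn_succ, takePad_eq_ofFn]
    congr 1
    · simp
    · congr 1
      funext j
      congr 1
      funext i
      rw [List.getElem?_drop, Fin.val_succ]
      congr 2
      ring

theorem foldl_count {A : Type} (p : A → Bool) (l : List A) (c : ℕ) :
    l.foldl (fun c a => if p a then c + 1 else c) c = c + l.countP p := by
  induction l generalizing c with
  | nil => rfl
  | cons a l ih =>
    rw [List.foldl_cons, ih, List.countP_cons]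
    split <;> omega

theorem countP_ofFn {A : Type} (p : A → Bool) {m : ℕ} (f : Fin m → A) :
    (List.ofFn f).countP p = (Finset.univ.filter fun j => p (f j) = true).card := by
  rw [Finset.card_filter]
  induction m with
  | zero => simp
  | succ m ih =>
    rw [List.ofFn_succ, List.countP_cons, ih, Fin.sum_univ_succ, add_comm]

theorem foldl_unscramble {N : ℕ} (π : Equiv.Perm (Fin N)) (y z : Fin N → Bool) (l : List (Fin N))
    (hl : l.Nodup) (j' : Fin N) :
    l.foldl (fun s j => if y j then fun j' => xor (decide (π j = j')) (s j') else s) z j' =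
      xor (decide (π.symm j' ∈ l) && y (π.symm j')) (z j') := by
  induction l generalizing z with
  | nil => simp
  | cons a l ih =>
    rw [List.nodup_cons] at hl
    rw [List.foldl_cons, ih _ hl.2]
    by_cases h : π.symm j' = a
    · subst h
      cases hy : y (π.symm j') <;> simp [hl.1]
    · have h' : π a ≠ j' := fun e => h (by rw [← e, Equiv.symm_apply_apply])
      cases hy : y a <;> simp [h, h']

end

section

variable {β : ℝ} {ι : Type} {sz : ι → ℕ} {O : ι → Oracle} {k : ℕ} {env : ι → Store}

theorem unscramble_spec {Nv : ι → ℕ} (y z : ∀ i, Fin (Nv i) → Bool)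
    (π : ∀ i, Equiv.Perm (Fin (Nv i))) {yv zv rows : ℕ} (hy : yv < k) (hz : zv < k)
    (hrows : rows < k) (ey : ∀ i, env i yv = Data.ofBits (List.ofFn (y i)))
    (ez : ∀ i, env i zv = Data.ofBits (List.ofFn (z i)))
    (er : ∀ i, env i rows = Data.ofList ((permRows (π i)).map Data.ofBits))
    (bN : PolyB sz Nv) :
    PEv β sz O (Prog.unscramble yv zv rows) k env fun i => PMF.pure
      (Data.ofBits (List.ofFn fun j => xor (y i ((π i).symm j)) (z i j))) := by
  refine PEv.bindD (PEv.zip (l := fun i => (List.ofFn (y i)).map Data.ofBool) hy hrows ey er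
    (by simpa using bN) (fun i => by simp [permRows_length])) ?_
  refine PEv.congr (PEv.foldD (S := fun i => Fin (Nv i) → Bool) (A := fun i => Fin (Nv i))
    (rep := fun i s => Data.ofBits (List.ofFn s))
    (repA := fun i j => Data.cons (Data.ofBool (y i j))
      (Data.ofBits (List.ofFn fun j' => decide (π i j = j'))))
    (l := fun i => List.ofFn id) (s₀ := z)
    (g := fun i s j => if y i j then fun j' => xor (decide (π i j = j')) (s j') else s)
    (by omega) (by omega) (fun i => ?_) (fun i => by simp (disch := omega) [ez])
    (by simpa using bN) ?_) fun i => ?_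
  · rw [update_self]
    congr 1
    refine List.ext_get (by simp [permRows_length]) fun j h1 h2 => ?_
    simp [permRows]
  · show PEv _ ?sz₁ ?O₁ _ ?k₁ ?env₁ _
    refine PEv.bindD (PEv.hd (sz := ?sz₁) (O := ?O₁) (k := ?k₁) (env := ?env₁)
      (d := fun j => Data.cons (Data.ofBool (y j.1 j.2.cur))
      (Data.ofBits (List.ofFn fun j' => decide (π j.1 j.2.cur = j')))) (by omega)
      (fun j => by simp)) ?_
    refine PEv.bindD (PEv.tl (sz := ?sz₁) (O := ?O₁)
      (d := fun j => Data.cons (Data.ofBool (y j.1 j.2.cur))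
      (Data.ofBits (List.ofFn fun j' => decide (π j.1 j.2.cur = j')))) (by omega)
      (fun j => by simp)) ?_
    refine PEv.ite (sz := ?sz₁) (O := ?O₁) (c := fun j => y j.1 j.2.cur) (by omega)
      (fun j => by simp (disch := omega) [Data.toBool_ofBool]) ?_ ?_
    · show PEv _ ?sz₂ ?O₂ _ ?k₂ ?env₂ _
      refine PEv.congr (PEv.xorList (sz := ?sz₂) (O := ?O₂) (k := ?k₂) (env := ?env₂)
        (b := fun j => List.ofFn fun j' => decide (π j.1.1 j.1.2.cur = j'))
        (c := fun j => List.ofFn j.1.2.acc) (by omega) (by omega) (fun j => by simp)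
        (fun j => by simp) ?_ (fun j => by simp)) fun j => ?_
      · simp only [List.length_ofFn]
        exact bN.comap fun j : {j : (i : ι) × _ // _} => j.1.1
      · rw [zipWith_ofFn, if_pos j.2]
    · show PEv _ ?sz₄ ?O₄ _ ?k₄ ?env₄ _
      refine PEv.congr (PEv.var (sz := ?sz₄) (O := ?O₄) (k := ?k₄) (env := ?env₄)
        (d := fun j => Data.ofBits (List.ofFn j.1.2.acc)) (by omega) (fun j => by simp)) fun j => ?_
      rw [if_neg (by simp [j.2])]
  · congr 4
    funext j
    rw [foldl_unscramble _ _ _ _ (List.nodup_ofFn.mpr injective_id)]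
    simp

theorem count_spec {𝓕 : FunctionFamily} {adv : ℕ → Data} {pF : ℕ → ℕ → Prog}
    (hF : ComputesF pF adv 𝓕) (bn : PolyBounded 𝓕.n) (lam : ι → ℕ) (hlam : ∀ i, lam i ≤ sz i)
    (hk : 2 ≤ k) (e0 : ∀ i, env i 0 = Data.unary (lam i)) (e1 : ∀ i, env i 1 = adv (lam i))
    {n s segs : ℕ} (hn : n < k) (hs : s < k) (hsegs : segs < k)
    (en : ∀ i, env i n = Data.unary (𝓕.n (lam i))) (sv : ∀ i, Fin (𝓕.ℓ (lam i)) → Bool)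
    (es : ∀ i, env i s = Data.ofBits (List.ofFn (sv i)))
    (l : ∀ i, List ((Fin (𝓕.n (lam i)) → Bool) × Bool))
    (el : ∀ i, env i segs = Data.ofList ((l i).map fun p => Data.ofBits (List.ofFn p.1 ++ [p.2])))
    (bl : PolyB sz fun i => (l i).length) :
    PEv β sz O (Prog.count pF n s segs) k env fun i => PMF.pure
      (Data.unary ((l i).countP fun p => p.2 == 𝓕.F (lam i) (sv i) p.1)) := by
  simp only [Data.unary_eq] at en
  refine PEv.bindD PEv.nil ?_
  refine PEv.congr (PEv.foldD (S := fun i => ℕ) (A := fun i => (Fin (𝓕.n (lam i)) → Bool) × Bool)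
    (rep := fun i => Data.unary) (repA := fun i p => Data.ofBits (List.ofFn p.1 ++ [p.2]))
    (l := l) (s₀ := fun _ => 0)
    (g := fun i c p => if p.2 == 𝓕.F (lam i) (sv i) p.1 then c + 1 else c)
    (by omega) (by omega) (fun i => by simp (disch := omega) [el]) (fun i => by simp; rfl) bl ?_)
    fun i => by rw [foldl_count, zero_add]
  show PEv _ ?sz₁ ?O₁ _ ?k₁ ?env₁ _
  have hsp : ∀ (i : ι) (p : (Fin (𝓕.n (lam i)) → Bool) × Bool),
      takePad (List.replicate (𝓕.n (lam i)) (Data.ofBool true)).length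
        ((List.ofFn p.1).map Data.ofBool ++ [Data.ofBool p.2]) = (List.ofFn p.1).map Data.ofBool ∧
      ((List.ofFn p.1).map Data.ofBool ++ [Data.ofBool p.2]).drop
        (List.replicate (𝓕.n (lam i)) (Data.ofBool true)).length = [Data.ofBool p.2] := by
    intro i p
    have h := takePad_append ((List.ofFn p.1).map Data.ofBool) [Data.ofBool p.2]
    refine ⟨?_, List.drop_left' (by simp)⟩
    simpa only [List.length_map, List.length_ofFn, List.length_replicate] using h
  refine PEv.bindD (PEv.split (sz := ?sz₁) (O := ?O₁) (k := ?k₁) (env := ?env₁)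
    (l := fun j => List.replicate (𝓕.n (lam j.1)) (Data.ofBool true))
    (l' := fun j => (List.ofFn j.2.cur.1).map Data.ofBool ++ [Data.ofBool j.2.cur.2])
    (by omega) (by omega) (fun j => by simp (disch := omega) [en])
    (fun j => by simp [Data.ofBits])
    (by simpa using polyB_comp (sz := ?sz₁) (lam := fun j => lam j.1) (fun j => hlam _) bn)) ?_
  refine PEv.bindD (PEv.hd (sz := ?sz₁) (O := ?O₁) (d := fun j => Data.cons
    (Data.ofBits (List.ofFn j.2.cur.1)) (Data.ofList [Data.ofBool j.2.cur.2])) (by omega)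
    (fun j => by rw [update_self, (hsp _ _).1, (hsp _ _).2]; rfl)) ?_
  refine PEv.bindD (PEv.tl (sz := ?sz₁) (O := ?O₁) (d := fun j => Data.cons
    (Data.ofBits (List.ofFn j.2.cur.1)) (Data.ofList [Data.ofBool j.2.cur.2])) (by omega)
    (fun j => by rw [update_of_ne (by omega), update_self, (hsp _ _).1, (hsp _ _).2]; rfl)) ?_
  refine PEv.bindD (PEv.hd (sz := ?sz₁) (O := ?O₁) (d := fun j => Data.ofList
    [Data.ofBool j.2.cur.2]) (by omega) (fun j => by simp)) ?_
  show PEv _ ?sz₂ ?O₂ _ ?k₂ ?env₂ _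
  refine PEv.bindD (hF (sz := ?sz₂) (O := ?O₂) (k := ?k₂) (env := ?env₂) (fun j => lam j.1)
    (fun j => sv j.1) (fun j => j.2.cur.1) (fun j => hlam _) (by omega) (by omega) (by omega)
    (fun j => by simp (disch := omega) [e0]) (fun j => by simp (disch := omega) [e1])
    (fun j => by simp (disch := omega) [es]) (fun j => by simp (disch := omega))) ?_
  refine PEv.bindD (PEv.xor (sz := ?sz₁) (O := ?O₁) (b := fun j => j.2.cur.2)
    (c := fun j => 𝓕.F (lam j.1) (sv j.1) j.2.cur.1) (by omega) (by omega)
    (fun j => by simp (disch := omega)) (fun j => by simp (disch := omega))) ?_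
  refine PEv.ite (sz := ?sz₁) (O := ?O₁) (c := fun j => Bool.xor j.2.cur.2
    (𝓕.F (lam j.1) (sv j.1) j.2.cur.1)) (by omega)
    (fun j => by simp (disch := omega) [Data.toBool_ofBool]) ?_ ?_
  · show PEv _ ?sz₃ ?O₃ _ ?k₃ ?env₃ _
    refine PEv.congr (PEv.var (sz := ?sz₃) (O := ?O₃) (k := ?k₃) (env := ?env₃)
      (d := fun j => Data.unary j.1.2.acc) (by omega)
      (fun j => by simp (disch := omega))) fun j => ?_
    have := j.2
    rw [if_neg (by simp_all)]
  · show PEv _ ?sz₄ ?O₄ _ ?k₄ ?env₄ _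
    refine PEv.bindD (PEv.tt (sz := ?sz₄) (O := ?O₄) (k := ?k₄) (env := ?env₄)) ?_
    refine PEv.congr (PEv.cons (sz := ?sz₄) (O := ?O₄)
      (d := fun j => Data.ofBool true) (e := fun j => Data.unary j.1.2.acc) (by omega) (by omega)
      (fun j => by simp) (fun j => by simp (disch := omega))) fun j => ?_
    have := j.2
    rw [if_pos (by simp_all), unary_succ]

theorem getD_ofFn {A : Type} {n : ℕ} (f : Fin n → A) (d : A) {j : ℕ} (hj : j < n) :
    (List.ofFn f).getD j d = f ⟨j, hj⟩ := by
  rw [List.getD_eq_getElem _ _ (by simpa using hj), List.getElem_ofFn]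

/-- The blocks `(x_j, w_j)` that the decoder reads off. -/
def blocksOf (n m : ℕ) (u : List Bool) : List ((Fin n → Bool) × Bool) :=
  List.ofFn fun j : Fin m =>
    (fun i : Fin n => u.getD ((n + 1) * j + i) false, u.getD ((n + 1) * j + n) false)

theorem segments_ofBool (n m : ℕ) (u : List Bool) :
    (segments (n + 1) m (u.map Data.ofBool)).map Data.ofList =
      (blocksOf n m u).map fun p => Data.ofBits (List.ofFn p.1 ++ [p.2]) := by
  have h : ∀ j, (u.map Data.ofBool)[j]?.getD Data.nil = Data.ofBool (u.getD j false) := fun j => by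
    rw [List.getElem?_map, List.getD_eq_getElem?_getD]
    cases u[j]? <;> rfl
  rw [segments_eq_ofFn, blocksOf, List.map_ofFn, List.map_ofFn]
  congr 1
  funext j
  simp only [comp_apply, h, Data.ofBits]
  congr 1
  rw [List.ofFn_succ', List.concat_eq_append, List.map_append, List.map_ofFn]
  rfl

theorem decode_spec {𝓕 : FunctionFamily} {m : ℕ → ℕ} {adv : ℕ → Data} {pF : ℕ → ℕ → Prog}
    (hF : ComputesF pF adv 𝓕) (bℓ : PolyBounded 𝓕.ℓ) (bn : PolyBounded 𝓕.n) (bm : PolyBounded m)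
    (lam : ι → ℕ) (hlam : ∀ i, lam i ≤ sz i) (hk : 2 ≤ k) (e0 : ∀ i, env i 0 = Data.unary (lam i))
    (e1 : ∀ i, env i 1 = adv (lam i)) {ℓ n mv N t x y : ℕ} (hℓ : ℓ < k) (hn : n < k) (hm : mv < k)
    (hN : N < k) (ht : t < k) (hx : x < k) (hy : y < k)
    (eℓ : ∀ i, env i ℓ = Data.unary (𝓕.ℓ (lam i))) (en : ∀ i, env i n = Data.unary (𝓕.n (lam i)))
    (em : ∀ i, env i mv = Data.unary (m (lam i)))
    (eN : ∀ i, env i N = Data.unary (blockLength (𝓕.n (lam i)) (m (lam i))))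
    (et : ∀ i, env i t = Data.unary ⌊threshold (m (lam i))⌋₊)
    (bt : PolyB sz fun i => ⌊threshold (m (lam i))⌋₊)
    (sk : ∀ i, PRFKey (𝓕.ℓ (lam i)) (blockLength (𝓕.n (lam i)) (m (lam i))))
    (ex : ∀ i, env i x = Data.ofBits (keyBits (sk i))) (yv : ι → List Bool)
    (hyv : ∀ i, (yv i).length = blockLength (𝓕.n (lam i)) (m (lam i)))
    (ey : ∀ i, env i y = Data.ofBits (yv i)) :
    PEv β sz O (Prog.decode pF ℓ n mv N t x y) k env fun i => PMF.pure (Data.ofBool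
      (decide (⌊threshold (m (lam i))⌋₊ <
        agreement (m (lam i)) (𝓕.F (lam i) (sk i).1) (sk i).2.1 (sk i).2.2 (yv i)))) := by
  have bN := polyB_blockLength (m := m) hlam bn bm
  refine parse_spec sk hℓ hN hx eℓ eN ex (polyB_comp hlam bℓ) bN fun env₂ h₂ es ez er => ?_
  have hyv' : ∀ i, List.ofFn (fun j : Fin (blockLength (𝓕.n (lam i)) (m (lam i))) =>
      (yv i).getD j false) = yv i := fun i => by
    refine List.ext_getElem (by simp [hyv]) fun j h1 h2 => ?_
    rw [List.getElem_ofFn, List.getD_eq_getElem _ _ h2]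
  refine PEv.bindD (unscramble_spec (Nv := fun i => blockLength (𝓕.n (lam i)) (m (lam i)))
    (fun i j => (yv i).getD j false) (fun i => (sk i).2.1) (fun i => (sk i).2.2)
    (by omega) (by omega) (by omega) (fun i => by rw [h₂ i y hy, ey, hyv']) ez er bN) ?_
  refine PEv.bindD PEv.tt ?_
  refine PEv.bindD (PEv.cons (d := fun i => Data.ofBool true)
    (e := fun i => Data.unary (𝓕.n (lam i))) (by omega) (by omega) (fun i => by simp)
    (fun i => by simp (disch := omega) [h₂, en])) ?_
  refine PEv.bindD (PEv.cut (l := fun i => List.replicate (m (lam i)) (Data.ofBool true))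
    (lw := fun i => List.replicate (𝓕.n (lam i) + 1) (Data.ofBool true))
    (l' := fun i => (List.ofFn fun j => xor ((yv i).getD ((sk i).2.2.symm j) false)
      ((sk i).2.1 j)).map Data.ofBool) (by omega) (by omega) (by omega)
    (fun i => by simp (disch := omega) [h₂, em, Data.unary_eq])
    (fun i => by rw [update_self, ← unary_succ, Data.unary_eq])
    (fun i => by simp (disch := omega) [Data.ofBits])
    (by simpa using polyB_comp hlam bm) (by simpa using (polyB_comp hlam bn).add (.const 1))) ?_
  refine PEv.bindD (count_spec hF bn lam hlam (by omega)
    (fun i => by simp (disch := omega) [h₂, e0]) (fun i => by simp (disch := omega) [h₂, e1])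
    (by omega) (by omega) (by omega) (fun i => by simp (disch := omega) [h₂, en])
    (fun i => (sk i).1) (fun i => by simp (disch := omega) [es])
    (fun i => blocksOf (𝓕.n (lam i)) (m (lam i)) (List.ofFn fun j =>
      xor ((yv i).getD ((sk i).2.2.symm j) false) ((sk i).2.1 j)))
    (fun i => by rw [update_self, List.length_replicate, List.length_replicate, segments_ofBool])
    (by simpa [blocksOf] using polyB_comp hlam bm)) ?_
  have hag : ∀ i, (blocksOf (𝓕.n (lam i)) (m (lam i)) (List.ofFn fun j =>
      xor ((yv i).getD ((sk i).2.2.symm j) false) ((sk i).2.1 j))).countP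
        (fun p => p.2 == 𝓕.F (lam i) (sk i).1 p.1) =
      agreement (m (lam i)) (𝓕.F (lam i) (sk i).1) (sk i).2.1 (sk i).2.2 (yv i) := fun i => by
    rw [blocksOf, countP_ofFn, agreement]
    simp only [beq_iff_eq]
  refine PEv.bindD (PEv.drop (l := fun i => List.replicate ⌊threshold (m (lam i))⌋₊ (Data.ofBool true))
    (l' := fun i => List.replicate (agreement (m (lam i)) (𝓕.F (lam i) (sk i).1) (sk i).2.1
      (sk i).2.2 (yv i)) (Data.ofBool true)) (by omega) (by omega)
    (fun i => by simp (disch := omega) [h₂, et, Data.unary_eq])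
    (fun i => by rw [update_self, hag, Data.unary_eq])
    (by simpa using bt)) ?_
  refine PEv.ite (c := fun i => decide (⌊threshold (m (lam i))⌋₊ <
        agreement (m (lam i)) (𝓕.F (lam i) (sk i).1) (sk i).2.1 (sk i).2.2 (yv i))) (by omega)
    (fun i => ?_) (PEv.tt.congr fun j => by rw [j.2]) (PEv.nil.congr fun j => by rw [j.2]; rfl)
  rw [update_self, Data.toBool_ofList, List.length_replicate, List.drop_replicate]
  generalize ⌊threshold (m (lam i))⌋₊ = a
  generalize agreement (m (lam i)) (𝓕.F (lam i) (sk i).1) (sk i).2.1 (sk i).2.2 (yv i) = b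
  rw [Bool.eq_iff_iff]
  simp
  omega

theorem dec_spec {𝓕 : FunctionFamily} {q : ℝ} {m : ℕ → ℕ} {adv : ℕ → Data} {pℓ pn pm pt : Prog}
    {pF : ℕ → ℕ → Prog} (hℓ : Computes pℓ adv fun lam => Data.unary (𝓕.ℓ lam))
    (hn : Computes pn adv fun lam => Data.unary (𝓕.n lam))
    (hm : Computes pm adv fun lam => Data.unary (m lam))
    (ht : Computes pt adv fun lam => Data.unary ⌊threshold (m lam)⌋₊) (hF : ComputesF pF adv 𝓕)
    (bℓ : PolyBounded 𝓕.ℓ) (bn : PolyBounded 𝓕.n) (bm : PolyBounded m)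
    (bt : PolyBounded fun lam => ⌊threshold (m lam)⌋₊) (lam : ι → ℕ)
    (hlam : ∀ i, lam i ≤ sz i) (hk : 2 ≤ k) (e0 : ∀ i, env i 0 = Data.unary (lam i))
    (e1 : ∀ i, env i 1 = adv (lam i)) {x y : ℕ} (hx : x < k) (hy : y < k)
    (sk : ∀ i, PRFKey (𝓕.ℓ (lam i)) (blockLength (𝓕.n (lam i)) (m (lam i))))
    (ex : ∀ i, env i x = Data.ofBits (keyBits (sk i))) (yv : ι → List Bool)
    (ey : ∀ i, env i y = Data.ofBits (yv i)) (by' : PolyB sz fun i => (yv i).length) :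
    PEv β sz O (Prog.dec pℓ pn pm pt pF x y) k env fun i =>
      ((prfPRC 𝓕 q m).Dec (lam i) (sk i) (yv i)).map SecretKeyCode.ofDecoded := by
  have bN := polyB_blockLength (m := m) hlam bn bm
  refine setup_spec hℓ hn hm bn bm lam hlam hk e0 e1 fun env₁ h₁ eℓ en em eN => ?_
  refine PEv.bindD (ht lam hlam (by omega) (fun i => by simp (disch := omega) [h₁, e0])
    (fun i => by simp (disch := omega) [h₁, e1])) ?_
  refine PEv.bindD (PEv.drop
    (l := fun i => List.replicate (blockLength (𝓕.n (lam i)) (m (lam i))) (Data.ofBool true))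
    (l' := fun i => (yv i).map Data.ofBool) (by omega) (by omega)
    (fun i => by simp (disch := omega) [eN, Data.unary_eq])
    (fun i => by simp (disch := omega) [h₁, ey, Data.ofBits]) (by simpa using bN)) ?_
  refine PEv.ite (c := fun i => decide (blockLength (𝓕.n (lam i)) (m (lam i)) < (yv i).length))
    (by omega) (fun i => ?_) ?_ ?_
  · rw [update_self, Data.toBool_ofList, List.length_replicate, Bool.eq_iff_iff]
    simp
  · refine PEv.nil.congr fun j => ?_
    have := j.2
    rw [decide_eq_true_eq] at this
    simp only [prfPRC, PMF.pure_map]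
    rw [if_neg (by omega)]
    rfl
  show PEv _ ?sz₁ ?O₁ _ ?k₁ ?env₁ _
  refine PEv.bindD (PEv.drop (sz := ?sz₁) (O := ?O₁) (k := ?k₁) (env := ?env₁)
    (l := fun j => (yv j.1).map Data.ofBool)
    (l' := fun j => List.replicate (blockLength (𝓕.n (lam j.1)) (m (lam j.1))) (Data.ofBool true))
    (by omega) (by omega) (fun j => by simp (disch := omega) [h₁, ey, Data.ofBits])
    (fun j => by simp (disch := omega) [eN, Data.unary_eq])
    (by simpa [comp_def] using by'.comap Subtype.val)) ?_
  refine PEv.ite (sz := ?sz₁) (O := ?O₁)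
    (c := fun j => decide ((yv j.1).length < blockLength (𝓕.n (lam j.1)) (m (lam j.1))))
    (by omega) (fun j => ?_) ?_ ?_
  · rw [update_self, Data.toBool_ofList, List.length_map, Bool.eq_iff_iff, List.drop_replicate]
    simp
    omega
  · refine PEv.nil.congr fun j => ?_
    have := j.2
    rw [decide_eq_true_eq] at this
    simp only [prfPRC, PMF.pure_map]
    rw [if_neg (by omega)]
    rfl
  have hlen : ∀ j : {j : {i // decide (blockLength (𝓕.n (lam i)) (m (lam i)) < (yv i).length) =
      false} // decide ((yv j.1).length < blockLength (𝓕.n (lam j.1)) (m (lam j.1))) = false},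
      (yv j.1.1).length = blockLength (𝓕.n (lam j.1.1)) (m (lam j.1.1)) := fun j => by
    have h1 := j.1.2
    have h2 := j.2
    rw [decide_eq_false_iff_not] at h1 h2
    omega
  show PEv _ ?sz₂ ?O₂ _ ?k₂ ?env₂ _
  refine PEv.congr (decode_spec (sz := ?sz₂) (O := ?O₂) (k := ?k₂) (env := ?env₂) hF bℓ bn bm
    (fun j => lam j.1.1) (fun j => hlam _) (by omega)
    (fun j => by simp (disch := omega) [h₁, e0]) (fun j => by simp (disch := omega) [h₁, e1])
    (by omega) (by omega) (by omega) (by omega) (by omega) (by omega) (by omega)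
    (fun j => by simp (disch := omega) [eℓ]) (fun j => by simp (disch := omega) [en])
    (fun j => by simp (disch := omega) [em]) (fun j => by simp (disch := omega) [eN])
    (fun j => by simp (disch := omega))
    (polyB_comp (sz := ?sz₂) (lam := fun j => lam j.1.1) (fun j => hlam _) bt) (fun j => sk j.1.1)
    (fun j => by simp (disch := omega) [h₁, ex]) (fun j => yv j.1.1) hlen
    (fun j => by simp (disch := omega) [h₁, ey])) fun j => ?_
  have h0 : 0 ≤ threshold (m (lam j.1.1)) := by
    rw [threshold]
    have := Real.log_natCast_nonneg (m (lam j.1.1))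
    positivity
  simp only [prfPRC, PMF.pure_map]
  by_cases h : threshold (m (lam j.1.1)) < agreement (m (lam j.1.1)) (𝓕.F (lam j.1.1) (sk j.1.1).1)
    (sk j.1.1).2.1 (sk j.1.1).2.2 (yv j.1.1)
  · rw [if_pos ⟨hlen j, h⟩, decide_eq_true ((Nat.floor_lt h0).mpr h)]
    rfl
  · rw [if_neg (fun h' => h h'.2), decide_eq_false (fun h' => h ((Nat.floor_lt h0).mp h'))]
    rfl

end

/-! ### Efficiency of the code -/

theorem PolyBounded.add {f g : ℕ → ℕ} (hf : PolyBounded f) (hg : PolyBounded g) :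
    PolyBounded fun lam => f lam + g lam := by
  obtain ⟨P, hP⟩ := hf
  obtain ⟨Q, hQ⟩ := hg
  exact ⟨P + Q, fun lam => by simpa using add_le_add (hP lam) (hQ lam)⟩

theorem PolyBounded.mul {f g : ℕ → ℕ} (hf : PolyBounded f) (hg : PolyBounded g) :
    PolyBounded fun lam => f lam * g lam := by
  obtain ⟨P, hP⟩ := hf
  obtain ⟨Q, hQ⟩ := hg
  exact ⟨P * Q, fun lam => by simpa using Nat.mul_le_mul (hP lam) (hQ lam)⟩

theorem PolyBounded.const (c : ℕ) : PolyBounded fun _ => c := ⟨Polynomial.C c, fun _ => by simp⟩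

theorem PolyBounded.mono {f g : ℕ → ℕ} (hf : PolyBounded f) (h : ∀ lam, g lam ≤ f lam) :
    PolyBounded g := by
  obtain ⟨P, hP⟩ := hf
  exact ⟨P, fun lam => (h lam).trans (hP lam)⟩

theorem polyBounded_blockLength {n m : ℕ → ℕ} (hn : PolyBounded n) (hm : PolyBounded m) :
    PolyBounded fun lam => blockLength (n lam) (m lam) := by
  simp only [blockLength, sq]
  exact ((PolyBounded.const 3).mul hm).mul ((hn.add (.const 1)).mul (hn.add (.const 1)))

theorem polyBounded_threshold {m : ℕ → ℕ} (hm : PolyBounded m) :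
    PolyBounded fun lam => ⌊threshold (m lam)⌋₊ := by
  refine (hm.add (hm.mul hm)).mono fun lam => ?_
  refine Nat.floor_le_of_le ?_
  rw [threshold]
  push_cast
  set x : ℝ := (m lam : ℝ) with hx
  have h0 : 0 ≤ x := Nat.cast_nonneg _
  have h1 : Real.log x ≤ x := Real.log_le_self h0
  have h2 : Real.sqrt x ≤ x := by
    rcases Nat.eq_zero_or_pos (m lam) with h | h
    · simp [hx, h]
    · have : 1 ≤ x := by rw [hx]; exact_mod_cast h
      exact Real.sqrt_le_iff.mpr ⟨h0, by nlinarith⟩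
  have := mul_le_mul h1 h2 (Real.sqrt_nonneg _) h0
  linarith

theorem adviceOK_ofList {nonuniform : Bool} (l : List (ℕ → Data))
    (h : ∀ a ∈ l, AdviceOK nonuniform a) :
    AdviceOK nonuniform fun lam => Data.ofList (l.map fun a => a lam) := by
  induction l with
  | nil => exact ⟨PolyBounded.const _, fun _ _ => rfl⟩
  | cons a l ih =>
    simp only [List.mem_cons, forall_eq_or_imp] at h
    obtain ⟨h1, h2⟩ := h.1
    obtain ⟨h3, h4⟩ := ih h.2
    refine ⟨(h1.add h3).add (.const 1), fun hn lam => ?_⟩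
    have := h4 hn lam
    simp only [List.map_cons, Data.ofList, h2 hn lam, this]

theorem isPPT_of_pev {nonuniform : Bool} {β : ℝ} {I : ℕ → Type} {inp : ∀ lam, I lam → List Data}
    {size : ∀ lam, I lam → ℕ} {out : ∀ lam, I lam → PMF Data} {adv : ℕ → Data} {t : Prog} {k : ℕ}
    (hadv : AdviceOK nonuniform adv)
    (h : PEv β (fun j : (lam : ℕ) × I lam => size j.1 j.2) (fun _ => noOracle) t k
      (fun j x => (Data.unary j.1 :: adv j.1 :: inp j.1 j.2).getD x Data.nil)
      fun j => out j.1 j.2) : IsPPT nonuniform β inp size out := by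
  obtain ⟨P, hP⟩ := h.main
  exact ⟨t.main k, adv, P, hadv, fun lam i => hP ⟨lam, i⟩⟩

/-- Programs for all the ingredients of the code, with a common auxiliary input which moreover
provides `a`. -/
theorem exists_computes {nonuniform : Bool} {𝓕 : FunctionFamily} {m : ℕ → ℕ}
    (hF : 𝓕.IsEfficient nonuniform) (hm : IsConstructible nonuniform m)
    (ht : IsConstructible nonuniform fun lam => ⌊threshold (m lam)⌋₊) {a : ℕ → Data}
    (ha : AdviceOK nonuniform a) :
    ∃ (adv : ℕ → Data) (pℓ pn pm pt pa : Prog) (pF : ℕ → ℕ → Prog), AdviceOK nonuniform adv ∧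
      Computes pℓ adv (fun lam => Data.unary (𝓕.ℓ lam)) ∧
      Computes pn adv (fun lam => Data.unary (𝓕.n lam)) ∧
      Computes pm adv (fun lam => Data.unary (m lam)) ∧
      Computes pt adv (fun lam => Data.unary ⌊threshold (m lam)⌋₊) ∧
      Computes pa adv a ∧ ComputesF pF adv 𝓕 := by
  obtain ⟨⟨c₁, a₁, P₁, d₁, h₁, r₁⟩, ⟨c₂, a₂, P₂, d₂, h₂, r₂⟩, ⟨c₃, a₃, P₃, d₃, h₃, r₃⟩⟩ := hF
  obtain ⟨c₄, a₄, P₄, d₄, h₄, r₄⟩ := hm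
  obtain ⟨c₅, a₅, P₅, d₅, h₅, r₅⟩ := ht
  refine ⟨fun lam => Data.ofList ([a₁, a₂, a₄, a₅, a₃, a].map fun a => a lam),
    Prog.callAdvice c₁ 0 [], Prog.callAdvice c₂ 1 [], Prog.callAdvice c₄ 2 [],
    Prog.callAdvice c₅ 3 [], Prog.nth 5 1, fun s x => Prog.callAdvice c₃ 4 [s, x],
    adviceOK_ofList _ (by simp [*]),
    computes_callAdvice d₁ (fun _ => rfl) (fun _ => rfl) fun lam => r₁ lam (),
    computes_callAdvice d₂ (fun _ => rfl) (fun _ => rfl) fun lam => r₂ lam (),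
    computes_callAdvice d₄ (fun _ => rfl) (fun _ => rfl) fun lam => r₄ lam (),
    computes_callAdvice d₅ (fun _ => rfl) (fun _ => rfl) fun lam => r₅ lam (), ?_,
    computesF_callAdvice d₃ (fun _ => rfl) (fun _ => rfl) r₃⟩
  intro β ι sz O k env lam hlam hk e0 e1
  exact (nth_spec 5 (by omega) e1).congr fun i => rfl

theorem prfPRC_isEfficient {nonuniform : Bool} {𝓕 : FunctionFamily} {q : ℝ} {m : ℕ → ℕ}
    (bℓ : PolyBounded 𝓕.ℓ) (bn : PolyBounded 𝓕.n) (bm : PolyBounded m)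
    (hF : 𝓕.IsEfficient nonuniform) (hm : IsConstructible nonuniform m)
    (ht : IsConstructible nonuniform fun lam => ⌊threshold (m lam)⌋₊) :
    (prfPRC 𝓕 q m).IsEfficient nonuniform q := by
  obtain ⟨adv, pℓ, pn, pm, pt, -, pF, hadv, cℓ, cn, cm, ct, -, cF⟩ :=
    exists_computes hF hm ht (a := fun _ => Data.nil) ⟨.const _, fun _ _ => rfl⟩
  refine ⟨isPPT_of_pev (t := Prog.key pℓ pn pm) (k := 2) hadv ?_,
    isPPT_of_pev (t := Prog.enc pℓ pn pm pF 2) (k := 4) hadv ?_,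
    isPPT_of_pev (t := Prog.dec pℓ pn pm pt pF 2 3) (k := 4) hadv ?_⟩
  · exact key_spec (ι := (lam : ℕ) × Unit) (sz := fun j => j.1) cℓ cn cm bℓ bn bm (fun j => j.1)
      (fun j => le_rfl) le_rfl (fun _ => rfl) fun _ => rfl
  · show PEv _ ?sz₁ ?O₁ _ ?k₁ ?env₁ _
    exact enc_spec (sz := ?sz₁) (O := ?O₁) (k := ?k₁) (env := ?env₁) cℓ cn cm cF bℓ bn bm
      (fun j => j.1) (fun j => le_rfl) (by omega) (fun _ => rfl)
      (fun _ => rfl) (by omega) (fun j => j.2.1) fun _ => rfl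
  · show PEv _ ?sz₂ ?O₂ _ ?k₂ ?env₂ _
    exact dec_spec (sz := ?sz₂) (O := ?O₂) (k := ?k₂) (env := ?env₂) (q := q) cℓ cn cm ct cF bℓ bn bm
      (polyBounded_threshold bm) (fun j => j.1)
      (fun j => Nat.le_add_right _ _) (by omega) (fun _ => rfl) (fun _ => rfl) (by omega) (by omega)
      (fun j => j.2.1) (fun _ => rfl) (fun j => j.2.2) (fun _ => rfl)
      ⟨Polynomial.X, fun j => by simp⟩

/-! ### Simulating the encoder with samples -/

/-- The encoder with key `(z, π)` that takes its `m` blocks from the distribution `ρ`. -/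
noncomputable def blockOracle (ρ : PMF (List Bool)) (n m : ℕ) {N : ℕ} (z : Fin N → Bool)
    (π : Equiv.Perm (Fin N)) : PMF (List Bool) :=
  (iid ρ m).bind fun bl => (encodeWith ((n + 1) * m) bl z π).map List.ofFn

namespace Prog

/-- The program for `blockOracle`, which takes its blocks from the oracle. What it asks the oracle is
irrelevant, as the oracles in question ignore their queries. -/
def answer (m N z rows : ℕ) : Prog :=
  bind (mapM m fun _ => query 0) fun blocks => finish N blocks z rows

/-- Draws `z` and `π`, runs the program `c` with the auxiliary input computed by `pa`, and answers each
of its queries by encoding `m` samples from the oracle. The key `s` is that of the oracle. -/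
def attack (pℓ pn pm pa : Prog) (c : Cmd) : Prog :=
  setup pℓ pn pm fun _ _ m N => bind (bits N) fun z => bind (perm N) fun rows =>
    bind pa fun a => call c [0, a] (answer m N z rows)

end Prog

section

variable {β : ℝ} {ι : Type} {sz : ι → ℕ} {O : ι → Oracle} {k : ℕ} {env : ι → Store}

theorem answer_spec {Nv nv mv : ι → ℕ} (ρ : ι → PMF (List Bool)) (z : ∀ i, Fin (Nv i) → Bool)
    (π : ∀ i, Equiv.Perm (Fin (Nv i))) {m N zv rows : ℕ} (h0 : 0 < k) (hm : m < k) (hN : N < k)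
    (hz : zv < k) (hrows : rows < k) (hρ : ∀ i, O i (env i 0) = ρ i)
    (em : ∀ i, env i m = Data.unary (mv i)) (eN : ∀ i, env i N = Data.unary (Nv i))
    (ez : ∀ i, env i zv = Data.ofBits (List.ofFn (z i)))
    (er : ∀ i, env i rows = Data.ofList ((permRows (π i)).map Data.ofBits))
    (bN : PolyB sz Nv) (bn : PolyB sz nv) (bm : PolyB sz mv)
    (hlen : ∀ i, ∀ l ∈ (ρ i).support, l.length = nv i + 1)
    (hNv : ∀ i, (nv i + 1) * mv i ≤ Nv i) :
    PEv β sz O (Prog.answer m N zv rows) k env fun i =>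
      (blockOracle (ρ i) (nv i) (mv i) (z i) (π i)).map Data.ofBits := by
  refine PEv.congr (PEv.bind (A := fun _ => List (List Bool))
    (rep := fun _ bl => Data.ofList (bl.map Data.ofBits))
    (μ := fun i => iid (ρ i) (mv i))
    (ν := fun i bl => (encodeWith ((nv i + 1) * mv i) bl (z i) (π i)).map
      fun c => Data.ofBits (List.ofFn c)) ?_ ?_) fun i => ?_
  · refine PEv.congr (PEv.mapM (A := fun _ => Data) (repA := fun _ => id) (B := fun _ => List Bool)
      (repB := fun _ => Data.ofBits) (f := fun i _ => ρ i)
      (l := fun i => List.replicate (mv i) (Data.ofBool true)) (by omega)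
      (fun i => by simp [em, Data.unary_eq]) (by simpa using bm)
      ?_) fun i => ?_
    · show PEv _ ?sz₁ ?O₁ _ ?k₁ ?env₁ _
      refine PEv.congr (PEv.query (sz := ?sz₁) (O := ?O₁) (k := ?k₁) (env := ?env₁)
        (d := fun j => env j.1 0) (by omega) (fun j => by simp (disch := omega))) fun j => ?_
      rw [hρ]
    · rw [mapP_replicate]
  · show PEv _ ?sz₂ ?O₂ _ ?k₂ ?env₂ _
    refine finish_spec (sz := ?sz₂) (O := ?O₂) (k := ?k₂) (env := ?env₂)
      (Nv := fun j => Nv j.1) (nv := fun j => nv j.1) (mv := fun j => mv j.1) (fun j => j.2.1)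
      (fun j => z j.1) (fun j => π j.1)
      (by omega) (by omega) (by omega) (by omega) (fun j => by simp (disch := omega) [eN])
      (fun j => by simp) (fun j => by simp (disch := omega) [ez])
      (fun j => by simp (disch := omega) [er]) bN.sigma bn.sigma bm.sigma
      (fun j => ?_) (fun j => hNv _)
    have := mem_support_iid j.2.2
    exact ⟨this.1, fun l hl => hlen j.1 l (this.2 l hl)⟩
  · rw [blockOracle, PMF.map_bind]
    congr 1
    funext bl
    rw [PMF.map_comp]
    rfl

theorem attack_spec {𝓕 : FunctionFamily} {m : ℕ → ℕ} {adv a : ℕ → Data} {pℓ pn pm pa : Prog}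
    (hℓ : Computes pℓ adv fun lam => Data.unary (𝓕.ℓ lam))
    (hn : Computes pn adv fun lam => Data.unary (𝓕.n lam))
    (hm : Computes pm adv fun lam => Data.unary (m lam)) (ha : Computes pa adv a)
    (bn : PolyBounded 𝓕.n) (bm : PolyBounded m) (lam : ι → ℕ)
    (hlam : ∀ i, lam i ≤ sz i) (hk : 2 ≤ k) (e0 : ∀ i, env i 0 = Data.unary (lam i))
    (e1 : ∀ i, env i 1 = adv (lam i)) {c : Cmd} {T : Polynomial ℕ}
    (hO : ∀ i d, ∀ l ∈ (O i d).support, l.length = 𝓕.n (lam i) + 1)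
    {μ : ∀ i, (z : Fin (blockLength (𝓕.n (lam i)) (m (lam i))) → Bool) →
      Equiv.Perm (Fin (blockLength (𝓕.n (lam i)) (m (lam i)))) → PMF Data}
    (hc : ∀ i z π, Halts β (fun _ => blockOracle (O i (Data.unary (lam i))) (𝓕.n (lam i)) (m (lam i)) z π)
      (start c [Data.unary (lam i), a (lam i)]) (T.eval (lam i)) (μ i z π)) :
    PEv β sz O (Prog.attack pℓ pn pm pa c) k env fun i =>
      (unifBits (blockLength (𝓕.n (lam i)) (m (lam i)))).bind fun z =>
        (unif (Equiv.Perm (Fin (blockLength (𝓕.n (lam i)) (m (lam i)))))).bind fun π => μ i z π := by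
  have bN := polyB_blockLength (m := m) hlam bn bm
  refine setup_spec hℓ hn hm bn bm lam hlam hk e0 e1 fun env₁ h₁ eℓ en em eN => ?_
  refine PEv.bind (A := fun j => Fin (blockLength (𝓕.n (lam j)) (m (lam j))) → Bool)
      (PEv.bits (by omega) (fun j => by simp (disch := omega) [eN]) bN) ?_
  show PEv _ ?sz₂ ?O₂ _ ?k₂ ?env₂ _
  refine PEv.bind (sz := ?sz₂) (A := fun j => Equiv.Perm (Fin (blockLength (𝓕.n (lam j.1)) (m (lam j.1)))))
      (PEv.perm (sz := ?sz₂) (O := ?O₂) (k := ?k₂) (env := ?env₂)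
        (n := fun j => blockLength (𝓕.n (lam j.1)) (m (lam j.1))) (by omega) (fun j => by simp (disch := omega) [eN])
        (polyB_blockLength (sz := ?sz₂) (lam := fun j => lam j.1) (fun j => hlam _) bn bm)) ?_
  show PEv _ ?sz₃ ?O₃ _ ?k₃ ?env₃ _
  refine PEv.bindD (ha (sz := ?sz₃) (O := ?O₃) (env := ?env₃) (fun j => lam j.1.1) (fun j => hlam _)
    (by omega) (fun j => by simp (disch := omega) [h₁, e0])
    (fun j => by simp (disch := omega) [h₁, e1])) ?_
  show PEv _ ?sz₄ ?O₄ _ ?k₄ ?env₄ _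
  refine PEv.call (sz := ?sz₄) (O := ?O₄) (k := ?k₄) (env := ?env₄)
    (O₁ := fun j _ => blockOracle (O j.1.1 (Data.unary (lam j.1.1))) (𝓕.n (lam j.1.1)) (m (lam j.1.1))
      j.1.2.1 j.2.1) (T := fun j => T.eval (lam j.1.1))
    (inputs := fun j => [Data.unary (lam j.1.1), a (lam j.1.1)]) ?_
    (polyB_comp (sz := ?sz₄) (lam := fun j => lam j.1.1) (fun j => hlam _) ⟨T, fun _ => le_rfl⟩)
    (fun j => ?_) (fun j => hc j.1.1 j.1.2.1 j.2.1) ?_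
  · simp only [List.mem_cons, forall_eq_or_imp]
    exact ⟨by omega, by omega, by simp⟩
  · simp (disch := omega) [h₁, e0]
  · show PEv _ ?sz₅ ?O₅ _ ?k₅ ?env₅ _
    refine answer_spec (sz := ?sz₅) (O := ?O₅) (k := ?k₅) (env := ?env₅)
      (Nv := fun j => blockLength (𝓕.n (lam j.1.1.1)) (m (lam j.1.1.1)))
      (nv := fun j => 𝓕.n (lam j.1.1.1)) (mv := fun j => m (lam j.1.1.1))
      (fun j => O j.1.1.1 (Data.unary (lam j.1.1.1))) (fun j => j.1.1.2.1) (fun j => j.1.2.1)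
      (by omega) (by omega) (by omega) (by omega) (by omega)
      (fun j => by rw [j.2.1.2 _ (by omega)]; simp (disch := omega) [h₁, e0])
      (fun j => by rw [j.2.1.2 _ (by omega)]; simp (disch := omega) [em])
      (fun j => by rw [j.2.1.2 _ (by omega)]; simp (disch := omega) [eN])
      (fun j => by rw [j.2.1.2 _ (by omega)]; simp (disch := omega))
      (fun j => by rw [j.2.1.2 _ (by omega)]; simp (disch := omega))
      (polyB_blockLength (sz := ?sz₅) (lam := fun j => lam j.1.1.1) (fun j => hlam _) bn bm)
      (polyB_comp (sz := ?sz₅) (lam := fun j => lam j.1.1.1) (fun j => hlam _) bn)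
      (polyB_comp (sz := ?sz₅) (lam := fun j => lam j.1.1.1) (fun j => hlam _) bm)
      (fun j => hO _ _) (fun j => le_blockLength _ _)

end

theorem length_of_mem_support_blockOracle {ρ : PMF (List Bool)} {n m N : ℕ} {z : Fin N → Bool}
    {π : Equiv.Perm (Fin N)} {l : List Bool} (h : l ∈ (blockOracle ρ n m z π).support) :
    l.length = N := by
  rw [blockOracle, PMF.mem_support_bind_iff] at h
  obtain ⟨bl, -, h⟩ := h
  rw [PMF.support_map] at h
  obtain ⟨r, -, rfl⟩ := h
  simp

/-- An adversary `A` against the code yields an adversary `B` against the function family: whatever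
distribution `ρ` of samples `B` is given, it behaves like `A` with the encoder that takes its blocks
from `ρ`. -/
theorem exists_simulation {nonuniform : Bool} {𝓕 : FunctionFamily} {m : ℕ → ℕ}
    (bn : PolyBounded 𝓕.n) (bm : PolyBounded m)
    (hF : 𝓕.IsEfficient nonuniform) (hm : IsConstructible nonuniform m)
    (ht : IsConstructible nonuniform fun lam => ⌊threshold (m lam)⌋₊) {A : Adversary}
    (hA : A.IsPPT nonuniform (fun _ => []) fun lam => blockLength (𝓕.n lam) (m lam)) :
    ∃ B : Adversary,
      B.IsPPT nonuniform (fun lam => [Data.unary (𝓕.n lam)]) (fun lam => 𝓕.n lam + 1) ∧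
      ∀ (lam : ℕ) (ρ : PMF (List Bool)), (∀ l ∈ ρ.support, l.length = 𝓕.n lam + 1) →
        B.outputBit (fun lam => [Data.unary (𝓕.n lam)]) lam (fun _ => ρ) =
          (unifBits (blockLength (𝓕.n lam) (m lam))).bind fun z =>
            (unif (Equiv.Perm (Fin (blockLength (𝓕.n lam) (m lam))))).bind fun π =>
              A.outputBit (fun _ => []) lam fun _ => blockOracle ρ (𝓕.n lam) (m lam) z π := by
  obtain ⟨adv, pℓ, pn, pm, -, pa, -, hadv, cℓ, cn, cm, -, ca, -⟩ := exists_computes hF hm ht hA.1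
  obtain ⟨P, hP⟩ := PEv.main (k := 3) (inputs := fun j => [Data.unary j.1, adv j.1, Data.unary (𝓕.n j.1)])
    (attack_spec (β := 1 / 2)
    (ι := (lam : ℕ) × {O : Oracle // ∀ d, ∀ l ∈ (O d).support, l.length = 𝓕.n lam + 1})
    (sz := fun j => j.1) (O := fun j => j.2.1) (k := 3) (c := A.prog) (T := A.time)
    (μ := fun j z π => outputAfter (1 / 2)
      (fun _ => blockOracle (j.2.1 (Data.unary j.1)) (𝓕.n j.1) (m j.1) z π) A.prog
      (A.inputs (fun _ => []) j.1) (A.time.eval j.1))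
    cℓ cn cm ca bn bm (fun j => j.1) (fun j => le_rfl) (by omega) (fun _ => rfl) (fun _ => rfl)
    (fun j => j.2.2) (fun j z π => ⟨hA.2 j.1 _ fun _ _ h => length_of_mem_support_blockOracle h, rfl⟩))
  refine ⟨⟨(Prog.attack pℓ pn pm pa A.prog).main 3, adv, P⟩, ⟨hadv, fun lam O hO => (hP ⟨lam, O, hO⟩).1⟩,
    fun lam ρ hρ => ?_⟩
  have := (hP ⟨lam, fun _ => ρ, fun _ => hρ⟩).2
  rw [Adversary.outputBit]
  refine (congrArg (PMF.map Data.toBool) this).trans ?_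
  rw [PMF.map_bind]
  congr 1
  funext z
  rw [PMF.map_bind]
  rfl

open scoped ENNReal

/-! ### Expectations -/

/-- The expectation of a function with values in `[0, ∞]`. -/
noncomputable def expect {α : Type} (μ : PMF α) (f : α → ℝ≥0∞) : ℝ≥0∞ := ∑' a, μ a * f a

section Expect

variable {α γ : Type} {μ : PMF α}

theorem expect_pure (a : α) (f : α → ℝ≥0∞) : expect (PMF.pure a) f = f a := by
  classical
  rw [expect, tsum_eq_single a]
  · simp
  · intro b hb
    simp [PMF.pure_apply, hb]

theorem expect_bind (κ : α → PMF γ) (f : γ → ℝ≥0∞) :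
    expect (μ.bind κ) f = expect μ fun a => expect (κ a) f := by
  simp only [expect, PMF.bind_apply, ← ENNReal.tsum_mul_right, ← ENNReal.tsum_mul_left]
  rw [ENNReal.tsum_comm]
  simp only [mul_assoc]

theorem expect_map (g : α → γ) (f : γ → ℝ≥0∞) :
    expect (μ.map g) f = expect μ fun a => f (g a) := by
  rw [← PMF.bind_pure_comp, expect_bind]
  simp only [comp_apply, expect_pure]

theorem expect_mono {f g : α → ℝ≥0∞} (h : ∀ a ∈ μ.support, f a ≤ g a) :
    expect μ f ≤ expect μ g := by
  refine ENNReal.tsum_le_tsum fun a => ?_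
  by_cases ha : a ∈ μ.support
  · exact mul_le_mul_right (h a ha) _
  · rw [PMF.mem_support_iff, not_not] at ha
    simp [ha]

theorem expect_add (f g : α → ℝ≥0∞) :
    expect μ (fun a => f a + g a) = expect μ f + expect μ g := by
  simp only [expect, mul_add, ENNReal.tsum_add]

theorem expect_const (c : ℝ≥0∞) : expect μ (fun _ => c) = c := by
  rw [expect, ENNReal.tsum_mul_right, PMF.tsum_coe, one_mul]

theorem expect_le {f : α → ℝ≥0∞} {c : ℝ≥0∞} (h : ∀ a ∈ μ.support, f a ≤ c) : expect μ f ≤ c :=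
  (expect_mono h).trans (expect_const c).le

theorem expect_const_mul (c : ℝ≥0∞) (f : α → ℝ≥0∞) :
    expect μ (fun a => c * f a) = c * expect μ f := by
  simp only [expect, ← ENNReal.tsum_mul_left]
  congr 1
  funext a
  ring

theorem expect_const_mul_right (c : ℝ≥0∞) (f : α → ℝ≥0∞) :
    expect μ (fun a => f a * c) = expect μ f * c := by
  simp only [expect, ← ENNReal.tsum_mul_right, mul_assoc]

theorem expect_comm (ν : PMF γ) (f : α → γ → ℝ≥0∞) :
    expect μ (fun a => expect ν fun b => f a b) = expect ν fun b => expect μ fun a => f a b := by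
  simp only [expect, ← ENNReal.tsum_mul_left]
  rw [ENNReal.tsum_comm]
  congr 1
  funext b
  congr 1
  funext a
  ring

theorem expect_unif [Fintype α] [Nonempty α] (f : α → ℝ≥0∞) :
    expect (unif α) f = (Fintype.card α : ℝ≥0∞)⁻¹ * ∑ a, f a := by
  simp only [expect, unif, PMF.uniformOfFintype_apply, tsum_fintype, Finset.mul_sum]

theorem expect_unif_equiv [Fintype α] [Nonempty α] (e : α ≃ α) (f : α → ℝ≥0∞) :
    expect (unif α) (fun a => f (e a)) = expect (unif α) f := by
  rw [expect_unif, expect_unif, Equiv.sum_comp e]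

theorem expect_unif_prod [Fintype α] [Nonempty α] [Fintype γ] [Nonempty γ] (f : α × γ → ℝ≥0∞) :
    expect (unif (α × γ)) f = expect (unif α) fun a => expect (unif γ) fun b => f (a, b) := by
  rw [unif_prod, expect_bind]
  simp only [expect_map]

theorem apply_eq_expect [DecidableEq α] (a : α) :
    μ a = expect μ fun b => if b = a then 1 else 0 := by
  rw [expect, tsum_eq_single a]
  · simp
  · intro b hb
    simp [hb]

theorem expect_add_compl {f : α → ℝ≥0∞} (hf : ∀ a, f a ≤ 1) :
    expect μ f + expect μ (fun a => 1 - f a) = 1 := by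
  rw [← expect_add]
  simp only [add_tsub_cancel_of_le (hf _)]
  exact expect_const 1

end Expect

/-! ### Random functions and independent random answers -/

/-- A step either does not depend on the oracle or consists of one query to it. -/
theorem step_cases (β : ℝ) (C : Config) :
    (∃ ν, ∀ O, step β O C = ν) ∨ ∃ d G, ∀ O : Oracle, step β O C = (O d).map G := by
  obtain ⟨cs, σ⟩ := C
  match cs with
  | [] => exact .inl ⟨_, fun _ => rfl⟩
  | c :: cs =>
    cases c with
    | query x y => exact .inr ⟨_, _, fun _ => rfl⟩
    | _ => exact .inl ⟨_, fun _ => rfl⟩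

/-- The value of a uniformly random function at a point may be drawn anew. -/
theorem expect_unif_update {X : Type} [Fintype X] [DecidableEq X] (x : X)
    (Ψ : (X → Bool) → ℝ≥0∞) :
    expect (unif (X → Bool)) Ψ =
      expect (unif Bool) fun b => expect (unif (X → Bool)) fun f => Ψ (update f x b) := by
  have hinv : Involutive fun p : (X → Bool) × Bool => (update p.1 x p.2, p.1 x) := fun p => by simp
  have h := expect_unif_equiv hinv.toPerm fun p => Ψ p.1
  rw [expect_unif_prod, expect_unif_prod] at h
  simp only [expect_const] at h
  rw [← h, expect_comm]
  rfl

/-- A computation with `t` steps cannot distinguish the values of a random function, of which the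
values on `S` are known, at random points from independent random bits, unless a point occurs twice
or is in `S`. -/
theorem expect_run_randomFunction_le {X : Type} [Fintype X] [Nonempty X] [DecidableEq X] (β : ℝ)
    (e : X → Bool → List Bool) (H : Config → ℝ≥0∞) (hH : ∀ C, H C ≤ 1) (t : ℕ) (S : Finset X)
    (g : X → Bool) (C : Config) :
    expect (unif (X → Bool)) (fun f =>
        expect (run β (fun _ => (unif X).map fun x => e x (if x ∈ S then g x else f x)) t C) H) ≤
      expect (run β (fun _ => (unif X).bind fun x => (unif Bool).map (e x)) t C) H +
        (t * (S.card + t) : ℕ) / (Fintype.card X : ℝ≥0∞) := by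
  induction t generalizing S g C with
  | zero => simp [run, expect_const]
  | succ t ih =>
    simp only [run, expect_bind]
    rcases step_cases β C with ⟨ν, hν⟩ | ⟨d, G, hG⟩
    · simp only [hν]
      rw [expect_comm]
      refine (expect_mono fun C' _ => ih S g C').trans ?_
      rw [expect_add, expect_const]
      gcongr <;> omega
    · simp only [hG, expect_map, expect_bind]
      rw [expect_comm]
      -- The point `x` of the query is new unless it is in `S`, and then joins `S`.
      have hx : ∀ x, expect (unif (X → Bool)) (fun f =>
          expect (run β (fun _ => (unif X).map fun x => e x (if x ∈ S then g x else f x)) t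
            (G (e x (if x ∈ S then g x else f x)))) H) ≤
          (if x ∈ S then 1 else 0) + (expect (unif Bool) (fun b =>
            expect (run β (fun _ => (unif X).bind fun x => (unif Bool).map (e x)) t (G (e x b))) H) +
              (t * (S.card + 1 + t) : ℕ) / (Fintype.card X : ℝ≥0∞)) := by
        intro x
        by_cases h : x ∈ S
        · rw [if_pos h]
          exact (expect_le fun f _ => expect_le fun C _ => hH C).trans le_self_add
        · rw [if_neg h, zero_add, expect_unif_update x, ← expect_const (μ := unif Bool)
            ((t * (S.card + 1 + t) : ℕ) / (Fintype.card X : ℝ≥0∞)), ← expect_add]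
          refine expect_mono fun b _ => ?_
          have := ih (insert x S) (update g x b) (G (e x b))
          rw [Finset.card_insert_of_notMem h] at this
          refine le_trans (le_of_eq ?_) this
          congr 1
          funext f
          congr 2
          · funext _
            congr 1
            funext x'
            by_cases h' : x' = x
            · subst h'
              simp [h]
            · simp [h']
          · simp [h]
      refine (expect_mono fun x _ => hx x).trans ?_
      rw [expect_add, expect_add, expect_const, ← add_assoc, add_comm (expect _ _) (expect _ _),
        add_assoc]
      gcongr
      rw [expect_unif, Finset.sum_ite_mem, Finset.univ_inter, Finset.sum_const, nsmul_one, mul_comm,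
        ← div_eq_mul_inv, ENNReal.div_add_div_same]
      gcongr
      norm_cast
      nlinarith

/-- A random function at random points is as good as independent random bits: both ways to answer
lead to the same result, up to `t² / |X|`. -/
theorem abs_run_randomFunction_sub_le {X : Type} [Fintype X] [Nonempty X] [DecidableEq X] (β : ℝ)
    (e : X → Bool → List Bool) (h : Config → Bool) (t : ℕ) (C : Config) :
    |(((unif (X → Bool)).bind fun f =>
        (run β (fun _ => (unif X).map fun x => e x (f x)) t C).map h) true).toReal -
      (((run β (fun _ => (unif X).bind fun x => (unif Bool).map (e x)) t C).map h) true).toReal| ≤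
      (t : ℝ) ^ 2 / Fintype.card X := by
  set μ := (unif (X → Bool)).bind fun f => run β (fun _ => (unif X).map fun x => e x (f x)) t C
    with hμ
  set ν := run β (fun _ => (unif X).bind fun x => (unif Bool).map (e x)) t C with hν
  set H : Config → ℝ≥0∞ := fun C => if h C = true then 1 else 0 with hH
  have hH1 : ∀ C, H C ≤ 1 := fun C => by simp only [hH]; split <;> simp
  set δ : ℝ≥0∞ := (t * t : ℕ) / (Fintype.card X : ℝ≥0∞) with hδ
  have hδ' : δ ≠ ∞ := ENNReal.div_ne_top (ENNReal.natCast_ne_top _) (by simp)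
  have key : ∀ H : Config → ℝ≥0∞, (∀ C, H C ≤ 1) → expect μ H ≤ expect ν H + δ := by
    intro H hH
    have := expect_run_randomFunction_le β e H hH t ∅ (fun _ => false) C
    simpa [hμ, hν, hδ, expect_bind] using this
  -- The bound for the complementary event is the second half of the two-sided estimate.
  have h1 := key H hH1
  have h2 := key (fun C => 1 - H C) fun C => tsub_le_self
  have c1 := expect_add_compl (μ := μ) hH1
  have c2 := expect_add_compl (μ := ν) hH1
  have fin : ∀ (κ : PMF Config) (H : Config → ℝ≥0∞), (∀ C, H C ≤ 1) → expect κ H ≠ ∞ :=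
    fun κ H hH => ((expect_le fun C _ => hH C).trans_lt ENNReal.one_lt_top).ne
  have f1 := fin μ H hH1
  have f2 := fin ν H hH1
  have f3 := fin μ (fun C => 1 - H C) fun C => tsub_le_self
  have f4 := fin ν (fun C => 1 - H C) fun C => tsub_le_self
  have e1 : ((unif (X → Bool)).bind fun f =>
      (run β (fun _ => (unif X).map fun x => e x (f x)) t C).map h) true = expect μ H := by
    rw [apply_eq_expect, hμ, expect_bind, expect_bind]
    simp only [expect_map, hH]
  have e2 : (ν.map h) true = expect ν H := by
    rw [apply_eq_expect, expect_map]
  rw [e1, e2]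
  have hd : δ.toReal = (t : ℝ) ^ 2 / Fintype.card X := by
    rw [hδ, ENNReal.toReal_div, ENNReal.toReal_natCast, ENNReal.toReal_natCast]
    push_cast
    ring
  have r1 := ENNReal.toReal_mono (ENNReal.add_ne_top.mpr ⟨f2, hδ'⟩) h1
  have r2 := ENNReal.toReal_mono (ENNReal.add_ne_top.mpr ⟨f4, hδ'⟩) h2
  have r3 := congrArg ENNReal.toReal c1
  have r4 := congrArg ENNReal.toReal c2
  rw [ENNReal.toReal_add f2 hδ', hd] at r1
  rw [ENNReal.toReal_add f4 hδ', hd] at r2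
  rw [ENNReal.toReal_add f1 f3] at r3
  rw [ENNReal.toReal_add f2 f4] at r4
  rw [abs_le]
  constructor <;> linarith

/-! ### Encoding uniformly random blocks -/

theorem iid_add {α : Type} (μ : PMF α) (a b : ℕ) :
    iid μ (a + b) = (iid μ a).bind fun l => (iid μ b).map fun l' => l ++ l' := by
  induction a with
  | zero => simp [iid, PMF.pure_bind]; exact (PMF.map_id _).symm
  | succ a ih =>
    rw [Nat.succ_add, iid, iid, ih]
    simp only [PMF.bind_bind, PMF.bind_map, PMF.map_bind, PMF.map_comp, comp_def, List.cons_append]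

theorem iid_flatten {α : Type} (μ : PMF α) (a m : ℕ) :
    (iid (iid μ a) m).map List.flatten = iid μ (a * m) := by
  induction m with
  | zero => simp [iid, PMF.pure_map]
  | succ m ih =>
    rw [Nat.mul_succ, add_comm (a * m), iid_add μ a, ← ih, iid]
    simp only [PMF.map_bind, PMF.map_comp, comp_def, List.flatten_cons]

/-- The encoder maps uniformly random blocks to a uniformly random string. -/
theorem blockOracle_unif {n m N : ℕ} (hN : (n + 1) * m ≤ N) (z : Fin N → Bool)
    (π : Equiv.Perm (Fin N)) :
    blockOracle ((unifBits (n + 1)).map List.ofFn) n m z π = (unifBits N).map List.ofFn := by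
  have h1 : ∀ bl : List (List Bool), (encodeWith ((n + 1) * m) bl z π).map List.ofFn =
      ((iid (unif Bool) (N - (n + 1) * m)).map fun r => bl.flatten ++ r).map
        fun a => List.ofFn fun i => xor (a.getD (π i) false) (z (π i)) := by
    intro bl
    rw [encodeWith, ← unifBits_map_ofFn]
    simp only [PMF.map_comp, comp_def]
  rw [blockOracle]
  simp only [h1]
  rw [← PMF.map_bind, unifBits_map_ofFn]
  have h2 : ((iid (iid (unif Bool) (n + 1)) m).bind fun bl =>
      (iid (unif Bool) (N - (n + 1) * m)).map fun r => bl.flatten ++ r) =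
      (unifBits N).map List.ofFn := by
    have h3 := iid_add (unif Bool) ((n + 1) * m) (N - (n + 1) * m)
    rw [Nat.add_sub_of_le hN, ← iid_flatten, PMF.bind_map] at h3
    exact h3.symm.trans (unifBits_map_ofFn N).symm
  rw [h2, PMF.map_comp]
  have hinv : Involutive fun v : Fin N → Bool => fun i => xor (v i) (z i) := fun v => by
    funext i
    simp
  have := unif_map_equiv (hinv.toPerm.trans (Equiv.arrowCongr π.symm (Equiv.refl Bool)))
  conv_rhs => rw [unifBits, ← unif, ← this, PMF.map_comp]
  rw [unifBits, ← unif]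
  congr 1
  funext v
  simp only [comp_apply]
  congr 1
  funext i
  rw [getD_ofFn _ _ (π i).2]
  rfl

open Filter

/-! ### Negligible functions -/

theorem Negligible.of_eventually_le {f g : ℕ → ℝ} (hf : ∀ lam, 0 ≤ f lam) (hg : Negligible g)
    (h : ∀ᶠ lam in atTop, f lam ≤ g lam) : Negligible f := by
  refine ⟨hf, fun C hC => ?_⟩
  obtain ⟨a, ha⟩ := hg.2 C hC
  obtain ⟨b, hb⟩ := eventually_atTop.mp h
  exact ⟨max a b, fun lam hlam => (hb lam (le_of_lt (lt_of_le_of_lt (le_max_right _ _) hlam))).trans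
    (ha lam (lt_of_le_of_lt (le_max_left _ _) hlam))⟩

theorem exists_pow_bound (P : Polynomial ℕ) : ∃ k : ℕ, ∀ lam : ℕ, 2 ≤ lam → P.eval lam ≤ lam ^ k := by
  induction P using Polynomial.induction_on' with
  | add p q hp hq =>
    obtain ⟨a, ha⟩ := hp
    obtain ⟨b, hb⟩ := hq
    refine ⟨max a b + 1, fun lam hl => ?_⟩
    have h1 := (ha lam hl).trans (Nat.pow_le_pow_right (by omega) (le_max_left a b))
    have h2 := (hb lam hl).trans (Nat.pow_le_pow_right (by omega) (le_max_right a b))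
    rw [Polynomial.eval_add, pow_succ]
    nlinarith
  | monomial n a =>
    refine ⟨a + n, fun lam hl => ?_⟩
    rw [Polynomial.eval_monomial, pow_add]
    refine Nat.mul_le_mul_right _ ?_
    exact (Nat.lt_two_pow_self).le.trans (Nat.pow_le_pow_left hl a)

theorem Negligible.polyBounded_mul {f : ℕ → ℝ} {g : ℕ → ℕ} (hf : Negligible f)
    (hg : PolyBounded g) : Negligible fun lam => (g lam : ℝ) * f lam := by
  obtain ⟨P, hP⟩ := hg
  obtain ⟨k, hk⟩ := exists_pow_bound P
  refine ⟨fun lam => mul_nonneg (Nat.cast_nonneg _) (hf.1 lam), fun C hC => ?_⟩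
  obtain ⟨a, ha⟩ := hf.2 (C + k) (by positivity)
  refine ⟨max a 2, fun lam hlam => ?_⟩
  have h2 : 2 ≤ lam := (le_max_right a 2).trans hlam.le
  have hpos : (0 : ℝ) < lam := by exact_mod_cast (by omega : 0 < lam)
  have h1 : (g lam : ℝ) ≤ (lam : ℝ) ^ (k : ℝ) := by
    rw [Real.rpow_natCast]
    exact_mod_cast (hP lam).trans (hk lam h2)
  calc (g lam : ℝ) * f lam ≤ (lam : ℝ) ^ (k : ℝ) * (lam : ℝ) ^ (-(C + k)) :=
        mul_le_mul h1 (ha lam ((le_max_left a 2).trans_lt hlam)) (hf.1 lam) (by positivity)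
    _ = (lam : ℝ) ^ (-C) := by
        rw [← Real.rpow_add hpos]
        congr 1
        ring

theorem Negligible.add {f g : ℕ → ℝ} (hf : Negligible f) (hg : Negligible g) :
    Negligible fun lam => f lam + g lam := by
  have h : Negligible fun lam => max (f lam) (g lam) := by
    refine ⟨fun lam => le_max_of_le_left (hf.1 lam), fun C hC => ?_⟩
    obtain ⟨a, ha⟩ := hf.2 C hC
    obtain ⟨b, hb⟩ := hg.2 C hC
    exact ⟨max a b, fun lam hlam => max_le (ha lam ((le_max_left a b).trans_lt hlam))
      (hb lam ((le_max_right a b).trans_lt hlam))⟩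
  refine (h.polyBounded_mul (PolyBounded.const 2)).of_eventually_le
    (fun lam => add_nonneg (hf.1 lam) (hg.1 lam)) (Eventually.of_forall fun lam => ?_)
  have h1 := le_max_left (f lam) (g lam)
  have h2 := le_max_right (f lam) (g lam)
  push_cast
  linarith

/-- `exp(-g)` is negligible if `g` eventually exceeds every multiple of the logarithm. -/
theorem negligible_exp_neg {g : ℕ → ℝ} (hg : ∀ C : ℝ, ∀ᶠ lam : ℕ in atTop, C * Real.log lam ≤ g lam) :
    Negligible fun lam => Real.exp (-g lam) := by
  refine ⟨fun lam => (Real.exp_pos _).le, fun C hC => ?_⟩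
  obtain ⟨a, ha⟩ := eventually_atTop.mp (hg C)
  refine ⟨a, fun lam hlam => ?_⟩
  have hpos : (0 : ℝ) < lam := by exact_mod_cast (by omega : 0 < lam)
  rw [Real.rpow_def_of_pos hpos]
  refine Real.exp_le_exp.mpr ?_
  have := ha lam hlam.le
  linarith

theorem negligible_exp_neg_rpow {c ε : ℝ} (hc : 0 < c) (hε : 0 < ε) :
    Negligible fun lam : ℕ => Real.exp (-(c * (lam : ℝ) ^ ε)) := by
  refine negligible_exp_neg fun C => ?_
  have h := (isLittleO_log_rpow_atTop hε).comp_tendsto tendsto_natCast_atTop_atTop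
  have h' := h.bound (c := c / (|C| + 1)) (by positivity)
  filter_upwards [h', eventually_ge_atTop 1] with lam hl h1
  have hlog : 0 ≤ Real.log lam := Real.log_natCast_nonneg lam
  have hp : 0 ≤ (lam : ℝ) ^ ε := by positivity
  simp only [comp_apply, Real.norm_eq_abs, abs_of_nonneg hlog, abs_of_nonneg hp] at hl
  calc C * Real.log lam ≤ (|C| + 1) * Real.log lam := by
        gcongr
        linarith [le_abs_self C]
    _ ≤ (|C| + 1) * (c / (|C| + 1) * (lam : ℝ) ^ ε) := by gcongr
    _ = c * (lam : ℝ) ^ ε := by field_simp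

theorem negligible_exp_neg_log_sq {c : ℝ} (hc : 0 < c) :
    Negligible fun lam : ℕ => Real.exp (-(c * Real.log lam ^ 2)) := by
  refine negligible_exp_neg fun C => ?_
  have h : Tendsto (fun lam : ℕ => Real.log lam) atTop atTop :=
    Real.tendsto_log_atTop.comp tendsto_natCast_atTop_atTop
  filter_upwards [h.eventually_ge_atTop (max 0 (C / c))] with lam hl
  have h0 := (le_max_left _ _).trans hl
  have h1 := (div_le_iff₀ hc).mp ((le_max_right _ _).trans hl)
  nlinarith

/-! ### Undetectability -/

theorem ber_zero : ber 0 = PMF.pure false := by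
  ext b
  cases b <;> simp [ber]

theorem noisySample_zero {n : ℕ} (f : (Fin n → Bool) → Bool) :
    noisySample 0 f = (unif (Fin n → Bool)).map fun x => List.ofFn x ++ [f x] := by
  rw [noisySample, ber_zero]
  simp only [PMF.pure_map, Bool.xor_false]
  rfl

theorem unifBits_succ_map_ofFn (n : ℕ) : (unifBits (n + 1)).map List.ofFn =
    (unif (Fin n → Bool)).bind fun x => (unif Bool).map fun b => List.ofFn x ++ [b] := by
  have h := unif_map_equiv ((Equiv.prodComm _ _).trans (Fin.snocEquiv fun _ : Fin (n + 1) => Bool))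
  rw [unif_prod] at h
  rw [unifBits, ← unif, ← h]
  simp only [PMF.map_bind, PMF.map_comp]
  congr 1
  funext x
  congr 1
  funext b
  simp only [comp_apply, List.ofFn_succ', List.concat_eq_append]
  congr 2
  · funext i
    simp [Fin.snocEquiv]
  · simp [Fin.snocEquiv]

/-- The simulation turns the advantage against the code into the advantage between the noisy samples of
`F_s` and uniformly random strings. The latter differ from the samples of a random function only if a
point is drawn twice, which has probability at most `t² / 2^n` with `2^n ≥ 2^(λ^ε)`. -/
theorem prfPRC_isUndetectable {nonuniform : Bool} {𝓕 : FunctionFamily} {q : ℝ} {m : ℕ → ℕ}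
    (bn : PolyBounded 𝓕.n) (bm : PolyBounded m)
    (hε : ∃ ε : ℝ, 0 < ε ∧ ∀ᶠ lam : ℕ in atTop, (lam : ℝ) ^ ε ≤ 𝓕.n lam)
    (hF : 𝓕.IsEfficient nonuniform) (hP : 𝓕.IsWeakPRF nonuniform q)
    (hm : IsConstructible nonuniform m)
    (ht : IsConstructible nonuniform fun lam => ⌊threshold (m lam)⌋₊) :
    (prfPRC 𝓕 q m).IsUndetectable nonuniform := by
  intro A hA
  obtain ⟨B, hB, hsim⟩ := exists_simulation bn bm hF hm ht hA
  obtain ⟨ε, hε0, hε⟩ := hε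
  have h1 := hP B hB
  have h2 : Negligible fun lam => ((B.time.eval lam) ^ 2 : ℕ) * Real.exp (-(Real.log 2 * (lam : ℝ) ^ ε)) :=
    (negligible_exp_neg_rpow (Real.log_pos one_lt_two) hε0).polyBounded_mul
      ⟨B.time ^ 2, fun lam => by rw [Polynomial.eval_pow]⟩
  refine (h1.add h2).of_eventually_le (fun lam => abs_nonneg _) ?_
  filter_upwards [hε] with lam hlam
  have hreal : ((prfPRC 𝓕 q m).Key lam).bind (fun sk => A.outputBit (fun _ => []) lam fun d =>
      ((prfPRC 𝓕 q m).Enc lam sk (SecretKeyCode.toMessage ((prfPRC 𝓕 q m).k lam) d)).map List.ofFn) =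
      (unifBits (𝓕.ℓ lam)).bind fun s => B.outputBit (fun lam => [Data.unary (𝓕.n lam)]) lam
        fun _ => noisySample q (𝓕.F lam s) := by
    have := unif_prfKey (𝓕.ℓ lam) (blockLength (𝓕.n lam) (m lam))
    simp only [prfPRC]
    rw [this, PMF.bind_bind]
    congr 1
    funext s
    rw [hsim lam _ fun l hl => length_of_mem_support_noisySample hl, PMF.bind_bind]
    congr 1
    funext z
    rw [PMF.bind_map]
    congr 1
    funext π
    simp only [comp_apply, encode_eq_bind, blockOracle, PMF.map_bind]
  have hideal : A.outputBit (fun _ => []) lam (fun _ =>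
      (unifBits ((prfPRC 𝓕 q m).n lam)).map List.ofFn) =
      B.outputBit (fun lam => [Data.unary (𝓕.n lam)]) lam
        fun _ => (unifBits (𝓕.n lam + 1)).map List.ofFn := by
    rw [hsim lam _ fun l hl => ?_]
    · simp only [blockOracle_unif (le_blockLength _ _), PMF.bind_const]
      rfl
    · rw [PMF.support_map] at hl
      obtain ⟨r, -, rfl⟩ := hl
      simp
  have hswap := abs_run_randomFunction_sub_le (X := Fin (𝓕.n lam) → Bool) (1 / 2)
    (fun x b => List.ofFn x ++ [b]) (fun C => (C.2 0).toBool) (B.time.eval lam)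
    (start B.prog (B.inputs (fun lam => [Data.unary (𝓕.n lam)]) lam))
  rw [hreal, hideal]
  have e1 : ((PMF.uniformOfFintype ((Fin (𝓕.n lam) → Bool) → Bool)).bind fun f =>
      B.outputBit (fun lam => [Data.unary (𝓕.n lam)]) lam fun _ => noisySample 0 f) =
      (unif ((Fin (𝓕.n lam) → Bool) → Bool)).bind fun f =>
        (run (1 / 2) (fun _ => (unif (Fin (𝓕.n lam) → Bool)).map fun x => List.ofFn x ++ [f x])
          (B.time.eval lam)
          (start B.prog (B.inputs (fun lam => [Data.unary (𝓕.n lam)]) lam))).map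
            fun C => (C.2 0).toBool := by
    congr 1
    funext f
    rw [noisySample_zero, Adversary.outputBit, outputAfter, PMF.map_comp]
    rfl
  have e2 : B.outputBit (fun lam => [Data.unary (𝓕.n lam)]) lam
        (fun _ => (unifBits (𝓕.n lam + 1)).map List.ofFn) =
      (run (1 / 2) (fun _ => (unif (Fin (𝓕.n lam) → Bool)).bind fun x =>
        (unif Bool).map fun b => List.ofFn x ++ [b]) (B.time.eval lam)
          (start B.prog (B.inputs (fun lam => [Data.unary (𝓕.n lam)]) lam))).map
            fun C => (C.2 0).toBool := by
    rw [unifBits_succ_map_ofFn, Adversary.outputBit, outputAfter, PMF.map_comp]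
    rfl
  rw [← e1, ← e2] at hswap
  refine (abs_sub_le _ _ _).trans (add_le_add le_rfl (hswap.trans ?_))
  rw [div_eq_mul_inv]
  push_cast
  gcongr
  rw [Fintype.card_fun, Fintype.card_bool, Fintype.card_fin, Real.exp_neg, Real.exp_mul,
    Real.exp_log two_pos]
  refine inv_anti₀ (by positivity) ?_
  push_cast
  rw [← Real.rpow_natCast]
  exact Real.rpow_le_rpow_of_exponent_le one_le_two hlam

/-! ### Agreements in independent blocks -/

/-- The block `b = (x, w)` satisfies `w = f(x)`. -/
def agrees {n : ℕ} (f : (Fin n → Bool) → Bool) (b : List Bool) : Bool :=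
  b.getD n false == f fun i => b.getD i false

/-- The number of blocks `(x_j, w_j)`, `j < m`, of the string `u` with `w_j = f(x_j)`. -/
def agreements {n : ℕ} (m : ℕ) (f : (Fin n → Bool) → Bool) (u : List Bool) : ℕ :=
  (Finset.univ.filter fun j : Fin m =>
    u.getD ((n + 1) * j + n) false = f fun i => u.getD ((n + 1) * j + i) false).card

theorem agreement_eq {n : ℕ} (m : ℕ) {N : ℕ} (f : (Fin n → Bool) → Bool) (z : Fin N → Bool)
    (π : Equiv.Perm (Fin N)) (y : List Bool) : agreement m f z π y =
      agreements m f (List.ofFn fun j : Fin N => xor (y.getD (π.symm j) false) (z j)) := rfl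

theorem getD_flatten_append {c : ℕ} (bl : List (List Bool)) (hbl : ∀ b ∈ bl, b.length = c)
    (r : List Bool) {j i : ℕ} (hj : j < bl.length) (hi : i < c) :
    (bl.flatten ++ r).getD (c * j + i) false = bl[j].getD i false := by
  induction bl generalizing j with
  | nil => simp at hj
  | cons b bl ih =>
    have hb : b.length = c := hbl b (by simp)
    cases j with
    | zero =>
      rw [List.flatten_cons, List.append_assoc, mul_zero, zero_add, List.getD_append _ _ _ _ (by omega)]
      rfl
    | succ j =>
      have e : c * (j + 1) + i = b.length + (c * j + i) := by rw [hb]; ring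
      rw [List.flatten_cons, List.append_assoc, e, List.getD_append_right _ _ _ _ (by omega),
        Nat.add_sub_cancel_left, ih (fun b hb => hbl b (by simp [hb])) (by simpa using hj)]
      rfl

theorem agreements_flatten {n m : ℕ} (f : (Fin n → Bool) → Bool) {bl : List (List Bool)}
    (hm : bl.length = m) (hbl : ∀ b ∈ bl, b.length = n + 1) (r : List Bool) :
    agreements m f (bl.flatten ++ r) = bl.countP (agrees f) := by
  subst hm
  conv_rhs => rw [← List.ofFn_getElem (xs := bl), countP_ofFn]
  rw [agreements]
  congr 1
  refine Finset.filter_congr fun j _ => ?_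
  rw [agrees, beq_iff_eq, getD_flatten_append bl hbl r j.2 (by omega)]
  simp only [getD_flatten_append bl hbl r j.2 (Nat.lt_succ_of_lt (Fin.is_lt _))]

theorem expect_iid_prod {α : Type} (μ : PMF α) (φ : α → ℝ≥0∞) (m : ℕ) :
    expect (iid μ m) (fun l => (l.map φ).prod) = expect μ φ ^ m := by
  induction m with
  | zero => simp [iid, expect_pure]
  | succ m ih =>
    rw [iid, expect_bind]
    simp only [expect_map, List.map_cons, List.prod_cons, expect_const_mul, ih]
    rw [pow_succ, mul_comm (expect μ φ ^ m), expect_const_mul_right]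

/-- The exponential moment method for the number of independent samples that satisfy `g`. -/
theorem expect_iid_tail_le {α : Type} (μ : PMF α) (g : α → Bool) (m : ℕ) (t c : ℝ)
    (E : List α → Prop) [DecidablePred E]
    (hE : ∀ l : List α, l.length = m → E l → c ≤ t * (2 * (l.countP g : ℝ) - m)) :
    expect (iid μ m) (fun l => if E l then 1 else 0) ≤ ENNReal.ofReal (Real.exp (-c)) *
      expect μ (fun a => ENNReal.ofReal (Real.exp (if g a then t else -t))) ^ m := by
  have hprod : ∀ l : List α,
      (l.map fun a => ENNReal.ofReal (Real.exp (if g a then t else -t))).prod =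
        ENNReal.ofReal (Real.exp (t * (2 * (l.countP g : ℝ) - l.length))) := by
    intro l
    induction l with
    | nil => simp
    | cons a l ih =>
      rw [List.map_cons, List.prod_cons, ih, ← ENNReal.ofReal_mul (Real.exp_pos _).le,
        ← Real.exp_add, List.countP_cons, List.length_cons]
      congr 2
      split <;> push_cast <;> ring
  rw [← expect_iid_prod, ← expect_const_mul]
  refine expect_mono fun l hl => ?_
  have hlen := (mem_support_iid hl).1
  split
  · rename_i h
    rw [hprod, ← ENNReal.ofReal_mul (Real.exp_pos _).le, ← Real.exp_add, ENNReal.one_le_ofReal,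
      Real.one_le_exp_iff, hlen]
    linarith [hE l hlen h]
  · exact zero_le

/-! ### Soundness -/

theorem expect_unifBits_eq_iid (N : ℕ) (Φ : List Bool → ℝ≥0∞) :
    expect (unif (Fin N → Bool)) (fun u => Φ (List.ofFn u)) = expect (iid (unif Bool) N) Φ := by
  rw [iid_unif, expect_map]

/-- A uniformly random string consists of independent blocks. -/
theorem expect_unif_agreements {n m N : ℕ} (hN : (n + 1) * m ≤ N) (f : (Fin n → Bool) → Bool)
    (h : ℕ → ℝ≥0∞) :
    expect (unif (Fin N → Bool)) (fun u => h (agreements m f (List.ofFn u))) =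
      expect (iid (iid (unif Bool) (n + 1)) m) fun bl => h (bl.countP (agrees f)) := by
  have e := iid_add (unif Bool) ((n + 1) * m) (N - (n + 1) * m)
  rw [Nat.add_sub_of_le hN, ← iid_flatten] at e
  rw [expect_unifBits_eq_iid N fun l => h (agreements m f l), e, expect_bind, expect_map]
  refine le_antisymm (expect_mono fun bl hbl => ?_) (expect_mono fun bl hbl => ?_) <;>
  · have hb := mem_support_iid hbl
    have : ∀ r, agreements m f (bl.flatten ++ r) = bl.countP (agrees f) :=
      agreements_flatten f hb.1 fun b h => (mem_support_iid (hb.2 b h)).1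
    simp only [expect_map, this, expect_const, le_refl]

theorem expect_unif_bool (φ : Bool → ℝ≥0∞) : expect (unif Bool) φ = 2⁻¹ * (φ true + φ false) := by
  rw [expect_unif, Fintype.card_bool, Fintype.sum_bool]
  rfl

theorem agrees_append {n : ℕ} (f : (Fin n → Bool) → Bool) {x : List Bool} (hx : x.length = n)
    (w : Bool) : agrees f (x ++ [w]) = (w == f fun i => x.getD i false) := by
  have h1 : (x ++ [w]).getD n false = w := by
    rw [← hx, List.getD_append_right _ _ _ _ le_rfl]
    simp
  have h2 : ∀ i : Fin n, (x ++ [w]).getD i false = x.getD i false := fun i =>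
    List.getD_append _ _ _ _ (by omega)
  simp only [agrees, h1, h2]

theorem expect_uniform_block {n : ℕ} (f : (Fin n → Bool) → Bool) (φ : Bool → ℝ≥0∞) :
    expect (iid (unif Bool) (n + 1)) (fun b => φ (agrees f b)) = expect (unif Bool) φ := by
  rw [iid_add, expect_bind]
  have h : ∀ x ∈ (iid (unif Bool) n).support,
      expect ((iid (unif Bool) 1).map fun l => x ++ l) (fun b => φ (agrees f b)) =
        expect (unif Bool) φ := by
    intro x hx
    have hx := (mem_support_iid hx).1
    simp only [iid, PMF.pure_map, expect_map, expect_bind, expect_pure, agrees_append f hx,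
      expect_unif_bool]
    cases f fun i => x.getD i false <;> simp [add_comm]
  exact le_antisymm (expect_le fun x hx => (h x hx).le)
    ((expect_const _).symm.le.trans (expect_mono fun x hx => (h x hx).ge))

/-- The agreements in a uniformly random string are `m` fair coins, and exceed `m/2` by `ln(m) √m` with
probability at most `exp(-2 ln(m)²)`. -/
theorem expect_agreements_uniform_le {n m N : ℕ} (hN : (n + 1) * m ≤ N) (f : (Fin n → Bool) → Bool) :
    expect (unif (Fin N → Bool)) (fun u =>
      open Classical in if threshold m < agreements m f (List.ofFn u) then 1 else 0) ≤
      ENNReal.ofReal (Real.exp (-(2 * Real.log m ^ 2))) := by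
  classical
  -- for `m = 0` the bound is one, as `log 0 = 0`
  rcases Nat.eq_zero_or_pos m with rfl | hm
  · simp only [CharP.cast_eq_zero, Real.log_zero]
    refine expect_le fun u _ => ?_
    norm_num
    split <;> simp
  have hm' : (0 : ℝ) < m := by exact_mod_cast hm
  have hs : 0 < Real.sqrt m := Real.sqrt_pos.mpr hm'
  have hss : Real.sqrt m * Real.sqrt m = m := Real.mul_self_sqrt hm'.le
  -- the value of `t` that minimizes `m t² / 2 - 2 t ln(m) √m`
  set t : ℝ := 2 * Real.log m / Real.sqrt m with ht
  have ht0 : 0 ≤ t := by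
    have := Real.log_natCast_nonneg m
    positivity
  have h1 := expect_unif_agreements hN f fun k => if threshold m < k then 1 else 0
  refine (le_of_eq (by convert h1)).trans ?_
  refine (expect_iid_tail_le _ (agrees f) m t (4 * Real.log m ^ 2) _ fun l hl h => ?_).trans ?_
  · rw [threshold] at h
    have h2 : 2 * (Real.log m * Real.sqrt m) ≤ 2 * (l.countP (agrees f) : ℝ) - m := by linarith
    refine le_trans (le_of_eq ?_) (mul_le_mul_of_nonneg_left h2 ht0)
    rw [ht]
    field_simp
    ring
  · rw [expect_uniform_block f fun b => ENNReal.ofReal (Real.exp (if b then t else -t)),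
      expect_unif_bool]
    have h3 : 2⁻¹ * (ENNReal.ofReal (Real.exp (if true = true then t else -t)) +
        ENNReal.ofReal (Real.exp (if false = true then t else -t))) =
          ENNReal.ofReal (Real.cosh t) := by
      rw [← ENNReal.ofReal_add (Real.exp_pos _).le (Real.exp_pos _).le, Real.cosh_eq,
        show (2⁻¹ : ℝ≥0∞) = ENNReal.ofReal 2⁻¹ by
          rw [ENNReal.ofReal_inv_of_pos two_pos, ENNReal.ofReal_ofNat],
        ← ENNReal.ofReal_mul (by norm_num)]
      congr 1
      simp
      ring
    rw [h3]
    have h4 : ENNReal.ofReal (Real.cosh t) ≤ ENNReal.ofReal (Real.exp (t ^ 2 / 2)) :=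
      ENNReal.ofReal_le_ofReal (Real.cosh_le_exp_half_sq t)
    refine (mul_le_mul_right (pow_le_pow_left' h4 m) _).trans ?_
    rw [← ENNReal.ofReal_pow (Real.exp_pos _).le, ← Real.exp_nat_mul,
      ← ENNReal.ofReal_mul (Real.exp_pos _).le, ← Real.exp_add]
    refine ENNReal.ofReal_le_ofReal (Real.exp_le_exp.mpr (le_of_eq ?_))
    have : t ^ 2 = 4 * Real.log m ^ 2 / m := by
      rw [ht, div_pow, sq (Real.sqrt m), hss]
      ring
    rw [this]
    field_simp
    ring

theorem one_sub_le_toReal {a b : ℝ≥0∞} {ν : ℝ} (hν : 0 ≤ ν) (h : a + b = 1)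
    (hb : b ≤ ENNReal.ofReal ν) : 1 - ν ≤ a.toReal := by
  have ha : a ≠ ∞ := ne_top_of_le_ne_top ENNReal.one_ne_top (h ▸ le_self_add)
  have hb' : b ≠ ∞ := ne_top_of_le_ne_top ENNReal.one_ne_top (h ▸ le_add_self)
  have h1 := congrArg ENNReal.toReal h
  rw [ENNReal.toReal_add ha hb', ENNReal.toReal_one] at h1
  have h2 := ENNReal.toReal_mono ENNReal.ofReal_ne_top hb
  rw [ENNReal.toReal_ofReal hν] at h2
  linarith

/-- For every string `y`, the string `(π⁻¹ ∘ y) ⊕ z` that the decoder looks at is uniformly random, already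
by the choice of `z`. -/
theorem prfPRC_isSound {𝓕 : FunctionFamily} {q : ℝ} {m : ℕ → ℕ} {c : ℝ} (hc : 0 < c)
    (hm : ∀ᶠ lam : ℕ in atTop, (lam : ℝ) ^ c ≤ m lam) : (prfPRC 𝓕 q m).IsSound := by
  classical
  refine ⟨fun lam => Real.exp (-(2 * Real.log (m lam) ^ 2)), ?_, fun lam y => ?_⟩
  · refine (negligible_exp_neg_log_sq (c := 2 * c ^ 2) (by positivity)).of_eventually_le
      (fun lam => (Real.exp_pos _).le) ?_
    filter_upwards [hm, eventually_ge_atTop 1] with lam hlam h1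
    have hpos : (0 : ℝ) < lam := by exact_mod_cast h1
    have h2 := Real.log_le_log (by positivity) hlam
    rw [Real.log_rpow hpos] at h2
    have h3 := Real.log_natCast_nonneg lam
    refine Real.exp_le_exp.mpr (neg_le_neg ?_)
    rw [mul_assoc, ← mul_pow]
    gcongr
  set N := blockLength (𝓕.n lam) (m lam) with hN
  set cond : PRFKey (𝓕.ℓ lam) N → Prop := fun sk => y.length = N ∧
    threshold (m lam) < agreement (m lam) (𝓕.F lam sk.1) sk.2.1 sk.2.2 y with hcond
  refine one_sub_le_toReal (b := expect (PMF.uniformOfFintype (PRFKey (𝓕.ℓ lam) N)) fun sk => if cond sk then 1 else 0)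
    (Real.exp_pos _).le ?_ ?_
  · rw [apply_eq_expect, expect_bind]
    simp only [prfPRC, expect_pure]
    rw [← expect_add]
    refine Eq.trans ?_ (expect_const (μ := unif (PRFKey (𝓕.ℓ lam) N)) 1)
    congr 1
    funext sk
    by_cases h : cond sk
    · rw [if_pos h, if_pos h]
      simp
    · rw [if_neg h, if_neg h]
      simp
  · rw [unif_prfKey, expect_bind]
    refine expect_le fun s _ => ?_
    rw [expect_bind]
    simp only [expect_map]
    rw [expect_comm]
    refine expect_le fun π _ => ?_
    by_cases hy : y.length = N
    · have hinv : Involutive fun z : Fin N → Bool => fun j => xor (y.getD (π.symm j) false) (z j) :=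
        fun z => by
          funext j
          simp
      have h1 := expect_agreements_uniform_le (le_blockLength (𝓕.n lam) (m lam)) (𝓕.F lam s)
      rw [← expect_unif_equiv hinv.toPerm] at h1
      refine le_trans (le_of_eq ?_) h1
      rw [unifBits]
      congr 1
      funext z
      simp only [hcond, hy, true_and, agreement_eq]
      congr
    · simp [hcond, hy, expect_const]

/-! ### Noise stability of functions of few variables -/

/-- The noise stability `𝔼 f(x) g(x ⊕ δ)` of functions of the first `n` bits, for uniform `x` and
bits of `δ` that are one with probability `ρ`. -/
noncomputable def stability (ρ : ℝ) : ℕ → (List Bool → ℝ) → (List Bool → ℝ) → ℝ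
  | 0, f, g => f [] * g []
  | n + 1, f, g =>
    ((1 - ρ) * (stability ρ n (fun l => f (false :: l)) (fun l => g (false :: l)) +
        stability ρ n (fun l => f (true :: l)) fun l => g (true :: l)) +
      ρ * (stability ρ n (fun l => f (false :: l)) (fun l => g (true :: l)) +
        stability ρ n (fun l => f (true :: l)) fun l => g (false :: l))) / 2

theorem stability_add_left (ρ : ℝ) (n : ℕ) (f f' g : List Bool → ℝ) :
    stability ρ n (fun l => f l + f' l) g = stability ρ n f g + stability ρ n f' g := by
  induction n generalizing f f' g with
  | zero => simp only [stability]; ring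
  | succ n ih => simp only [stability, ih]; ring

theorem stability_add_right (ρ : ℝ) (n : ℕ) (f g g' : List Bool → ℝ) :
    stability ρ n f (fun l => g l + g' l) = stability ρ n f g + stability ρ n f g' := by
  induction n generalizing f g g' with
  | zero => simp only [stability]; ring
  | succ n ih => simp only [stability, ih]; ring

/-- The recursion with nonnegative weights, from which the lower bounds for the noise stability follow. -/
theorem stability_succ_self (ρ : ℝ) (n : ℕ) (f : List Bool → ℝ) :
    stability ρ (n + 1) f f =
      ((1 - 2 * ρ) * (stability ρ n (fun l => f (false :: l)) (fun l => f (false :: l)) +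
          stability ρ n (fun l => f (true :: l)) fun l => f (true :: l)) +
        ρ * stability ρ n (fun l => f (false :: l) + f (true :: l))
          (fun l => f (false :: l) + f (true :: l))) / 2 := by
  rw [stability_add_left, stability_add_right, stability_add_right, stability]
  ring

theorem stability_self_nonneg {ρ : ℝ} (h0 : 0 ≤ ρ) (h1 : ρ ≤ 1 / 2) (n : ℕ) (f : List Bool → ℝ) :
    0 ≤ stability ρ n f f := by
  induction n generalizing f with
  | zero => exact mul_self_nonneg _
  | succ n ih =>
    rw [stability_succ_self]
    have h2 : 0 ≤ 1 - 2 * ρ := by linarith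
    have := ih fun l => f (false :: l)
    have := ih fun l => f (true :: l)
    have := ih fun l => f (false :: l) + f (true :: l)
    positivity

/-- A `±1`-valued function that depends on the positions in `J` has noise stability at least
`(1 - 2ρ)^|J|`: in the recursion over the coordinates, only those in `J` cost a factor. -/
theorem le_stability_self {ρ : ℝ} (h0 : 0 ≤ ρ) (h1 : ρ ≤ 1 / 2) (n : ℕ) (f : List Bool → ℝ)
    (hf : ∀ l, f l * f l = 1) (J : Finset ℕ)
    (hJ : ∀ l l' : List Bool, (∀ j ∈ J, l.getD j false = l'.getD j false) → f l = f l') :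
    (1 - 2 * ρ) ^ J.card ≤ stability ρ n f f := by
  have h2 : 0 ≤ 1 - 2 * ρ := by linarith
  induction n generalizing f J with
  | zero =>
    rw [stability, hf]
    exact pow_le_one₀ h2 (by linarith)
  | succ n ih =>
    set J' := (J.erase 0).image Nat.pred with hJ'
    have hdep : ∀ (b : Bool) (l l' : List Bool), (∀ j ∈ J', l.getD j false = l'.getD j false) →
        f (b :: l) = f (b :: l') := by
      intro b l l' h
      refine hJ _ _ fun j hj => ?_
      cases j with
      | zero => rfl
      | succ j => exact h j (Finset.mem_image.mpr ⟨j + 1, Finset.mem_erase.mpr ⟨by simp, hj⟩, rfl⟩)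
    have i0 := ih (fun l => f (false :: l)) (fun l => hf _) J' (hdep false)
    have i1 := ih (fun l => f (true :: l)) (fun l => hf _) J' (hdep true)
    by_cases h : 0 ∈ J
    · have hcard : J'.card + 1 ≤ J.card := by
        have := Finset.card_image_le (s := J.erase 0) (f := Nat.pred)
        rw [Finset.card_erase_of_mem h, ← hJ'] at this
        have := Finset.card_pos.mpr ⟨_, h⟩
        omega
      have h3 := stability_self_nonneg h0 h1 n fun l => f (false :: l) + f (true :: l)
      rw [stability_succ_self]
      have h4 : (1 - 2 * ρ) ^ J.card ≤ (1 - 2 * ρ) * (1 - 2 * ρ) ^ J'.card := by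
        rw [← pow_succ']
        exact pow_le_pow_of_le_one h2 (by linarith) hcard
      nlinarith [mul_nonneg h0 h3]
    · have hcard : J'.card ≤ J.card := Finset.card_image_le.trans (Finset.card_erase_le)
      have heq : (fun l => f (true :: l)) = fun l => f (false :: l) := by
        funext l
        refine hJ _ _ fun j hj => ?_
        cases j with
        | zero => exact absurd hj h
        | succ j => rfl
      rw [stability, heq]
      have h4 : (1 - 2 * ρ) ^ J.card ≤ (1 - 2 * ρ) ^ J'.card :=
        pow_le_pow_of_le_one h2 (by linarith) hcard
      linarith

theorem expect_ber {ρ : ℝ} (h0 : 0 ≤ ρ) (h1 : ρ ≤ 1) (φ : Bool → ℝ≥0∞) :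
    expect (ber ρ) φ = ENNReal.ofReal ρ * φ true + ENNReal.ofReal (1 - ρ) * φ false := by
  have h : ENNReal.ofReal ρ ≤ 1 := ENNReal.ofReal_le_one.mpr h1
  rw [expect, tsum_fintype, Fintype.sum_bool, ENNReal.ofReal_sub _ h0, ENNReal.ofReal_one]
  simp [ber, h]

theorem toReal_expect_ber {ρ : ℝ} (h0 : 0 ≤ ρ) (h1 : ρ ≤ 1) {φ : Bool → ℝ≥0∞} (hφ : ∀ b, φ b ≠ ∞) :
    (expect (ber ρ) φ).toReal = ρ * (φ true).toReal + (1 - ρ) * (φ false).toReal := by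
  rw [expect_ber h0 h1, ENNReal.toReal_add (ENNReal.mul_ne_top ENNReal.ofReal_ne_top (hφ _))
    (ENNReal.mul_ne_top ENNReal.ofReal_ne_top (hφ _)), ENNReal.toReal_mul, ENNReal.toReal_mul,
    ENNReal.toReal_ofReal h0, ENNReal.toReal_ofReal (by linarith)]

theorem toReal_expect_unif_bool {φ : Bool → ℝ≥0∞} (hφ : ∀ b, φ b ≠ ∞) :
    (expect (unif Bool) φ).toReal = ((φ true).toReal + (φ false).toReal) / 2 := by
  rw [expect_unif_bool, ENNReal.toReal_mul, ENNReal.toReal_add (hφ _) (hφ _), ENNReal.toReal_inv,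
    ENNReal.toReal_ofNat]
  ring

theorem expect_ne_top {α : Type} {μ : PMF α} {f : α → ℝ≥0∞} (hf : ∀ a, f a ≤ 1) :
    expect μ f ≠ ∞ :=
  ((expect_le fun a _ => hf a).trans_lt ENNReal.one_lt_top).ne

theorem expect_le_one {α : Type} {μ : PMF α} {f : α → ℝ≥0∞} (hf : ∀ a, f a ≤ 1) :
    expect μ f ≤ 1 := expect_le fun a _ => hf a

/-- The probability that `f(x) ≠ g(x ⊕ δ)`. -/
noncomputable def disagreement (ρ : ℝ) (n : ℕ) (f g : List Bool → Bool) : ℝ≥0∞ :=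
  expect (iid (unif Bool) n) fun x => expect (iid (ber ρ) n) fun δ =>
    if f x = g (List.zipWith Bool.xor x δ) then 0 else 1

/-- The sign `(-1)^b`. -/
def sign (b : Bool) : ℝ := if b then -1 else 1

theorem toReal_disagreement {ρ : ℝ} (h0 : 0 ≤ ρ) (h1 : ρ ≤ 1) (n : ℕ) (f g : List Bool → Bool) :
    (disagreement ρ n f g).toReal =
      (1 - stability ρ n (fun l => sign (f l)) fun l => sign (g l)) / 2 := by
  have hle : ∀ (n : ℕ) (f g : List Bool → Bool), disagreement ρ n f g ≠ ∞ := fun n f g =>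
    expect_ne_top fun x => expect_le_one fun δ => by split <;> simp
  induction n generalizing f g with
  | zero =>
    simp only [disagreement, iid, expect_pure, stability, List.zipWith_nil_left]
    rcases Bool.eq_false_or_eq_true (f []) with h | h <;>
      rcases Bool.eq_false_or_eq_true (g []) with h' | h' <;> norm_num [h, h', sign]
  | succ n ih =>
    have hrec : disagreement ρ (n + 1) f g = expect (unif Bool) fun b => expect (ber ρ) fun d =>
        disagreement ρ n (fun l => f (b :: l)) fun l => g (xor b d :: l) := by
      simp only [disagreement, iid, expect_bind, expect_map, List.zipWith_cons_cons]
      congr 1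
      funext b
      rw [expect_comm]
      congr!
    have h2 : ∀ b : Bool, (expect (ber ρ) fun d =>
        disagreement ρ n (fun l => f (b :: l)) fun l => g (xor b d :: l)).toReal =
        ρ * (disagreement ρ n (fun l => f (b :: l)) fun l => g (xor b true :: l)).toReal +
        (1 - ρ) * (disagreement ρ n (fun l => f (b :: l)) fun l => g (xor b false :: l)).toReal :=
      fun b => toReal_expect_ber h0 h1 fun d => hle _ _ _
    rw [hrec, toReal_expect_unif_bool, h2, h2, ih, ih, ih, ih, stability]
    · simp only [Bool.xor_true, Bool.xor_false, Bool.not_true, Bool.not_false]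
      ring
    · intro b
      rw [expect_ber h0 h1]
      exact ENNReal.add_ne_top.mpr ⟨ENNReal.mul_ne_top ENNReal.ofReal_ne_top (hle _ _ _),
        ENNReal.mul_ne_top ENNReal.ofReal_ne_top (hle _ _ _)⟩

/-- The probability that a noisy sample, with further noise of rate `ρ`, is no longer a valid pair
`(x, f(x))`. -/
theorem expect_block_le {q ρ : ℝ} (hq0 : 0 ≤ q) (hq1 : q ≤ 1 / 2) (h0 : 0 ≤ ρ) (h1 : ρ ≤ 1 / 2)
    {n : ℕ} (f : (Fin n → Bool) → Bool) (J : Finset (Fin n))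
    (hJ : ∀ x x' : Fin n → Bool, (∀ j ∈ J, x j = x' j) → f x = f x') :
    expect (noisySample q f) (fun b => expect (iid (ber ρ) (n + 1)) fun d =>
      if agrees f (List.zipWith Bool.xor b d) = true then 0 else 1) ≤
      ENNReal.ofReal ((1 - (1 - 2 * q) * (1 - 2 * ρ) ^ (J.card + 1)) / 2) := by
  set F : List Bool → Bool := fun l => f fun i => l.getD i false with hF
  -- The block is valid if the number of changes among `e`, `d` and the value of `F` is even, where
  -- the noise changes the value of `F` with probability `D`, and `A = 1 - D`.
  set D := disagreement ρ n F F with hD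
  set A := expect (iid (unif Bool) n) fun x => expect (iid (ber ρ) n) fun δ =>
    if F x = F (List.zipWith Bool.xor x δ) then (1 : ℝ≥0∞) else 0 with hA
  have hD1 : D ≤ 1 := expect_le_one fun x => expect_le_one fun δ => by split <;> simp
  have hA1 : A ≤ 1 := expect_le_one fun x => expect_le_one fun δ => by split <;> simp
  have hAD : A + D = 1 := by
    rw [hA, hD, disagreement, ← expect_add]
    refine Eq.trans ?_ (expect_const (μ := iid (unif Bool) n) 1)
    congr 1
    funext x
    rw [← expect_add]
    refine Eq.trans ?_ (expect_const (μ := iid (ber ρ) n) 1)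
    congr 1
    funext δ
    split <;> simp
  have hmain : expect (noisySample q f) (fun b => expect (iid (ber ρ) (n + 1)) fun d =>
      if agrees f (List.zipWith Bool.xor b d) = true then 0 else 1) =
      expect (ber q) fun e => expect (ber ρ) fun d => if xor e d = true then A else D := by
    have e1 : noisySample q f = (ber q).bind fun e => (iid (unif Bool) n).map fun x =>
        x ++ [xor (F x) e] := by
      rw [noisySample, ← unifBits_map_ofFn]
      simp only [← PMF.bind_pure_comp, PMF.bind_bind, PMF.pure_bind, comp_def]
      rw [PMF.bind_comm]
      congr 1
      funext e
      congr 1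
      funext x
      rw [hF]
      simp only [getD_ofFn, Fin.is_lt]
    have e2 : iid (ber ρ) (n + 1) = (ber ρ).bind fun d => (iid (ber ρ) n).map fun δ => δ ++ [d] := by
      rw [iid_add]
      simp only [iid, ← PMF.bind_pure_comp, PMF.bind_bind, PMF.pure_bind, comp_def]
      rw [PMF.bind_comm]
    rw [e1, e2, expect_bind]
    simp only [expect_map, expect_bind]
    congr 1
    funext e
    rw [expect_comm]
    congr 1
    funext d
    have h : ∀ x ∈ (iid (unif Bool) n).support, ∀ δ ∈ (iid (ber ρ) n).support,
        agrees f (List.zipWith Bool.xor (x ++ [xor (F x) e]) (δ ++ [d])) =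
          (xor (xor (F x) e) d == F (List.zipWith Bool.xor x δ)) := by
      intro x hx δ hδ
      have hx := (mem_support_iid hx).1
      have hδ := (mem_support_iid hδ).1
      rw [List.zipWith_append (by rw [hx, hδ])]
      exact agrees_append f (by simp [hx, hδ]) _
    have key : ∀ φ ψ : List Bool → List Bool → ℝ≥0∞,
        (∀ x ∈ (iid (unif Bool) n).support, ∀ δ ∈ (iid (ber ρ) n).support, φ x δ = ψ x δ) →
        expect (iid (unif Bool) n) (fun x => expect (iid (ber ρ) n) (φ x)) =
          expect (iid (unif Bool) n) (fun x => expect (iid (ber ρ) n) (ψ x)) := fun φ ψ h =>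
      le_antisymm (expect_mono fun x hx => expect_mono fun δ hδ => (h x hx δ hδ).le)
        (expect_mono fun x hx => expect_mono fun δ hδ => (h x hx δ hδ).ge)
    cases hed : xor e d
    · rw [if_neg (by simp), hD, disagreement]
      refine key _ _ fun x hx δ hδ => ?_
      rw [h x hx δ hδ, Bool.xor_assoc, hed]
      simp
    · rw [if_pos rfl, hA]
      refine key _ _ fun x hx δ hδ => ?_
      rw [h x hx δ hδ, Bool.xor_assoc, hed]
      cases F x <;> cases F (List.zipWith Bool.xor x δ) <;> simp
  rw [hmain, ← ENNReal.ofReal_toReal (a := expect (ber q) _)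
    (expect_ne_top fun e => expect_le_one fun d => by split <;> assumption)]
  refine ENNReal.ofReal_le_ofReal ?_
  have hAt : A ≠ ∞ := (hA1.trans_lt ENNReal.one_lt_top).ne
  have hDt : D ≠ ∞ := (hD1.trans_lt ENNReal.one_lt_top).ne
  have h2 : ∀ e : Bool, (expect (ber ρ) fun d => if xor e d = true then A else D).toReal =
      ρ * (if xor e true = true then A else D).toReal +
      (1 - ρ) * (if xor e false = true then A else D).toReal := fun e =>
    toReal_expect_ber h0 (by linarith) fun d => by split <;> assumption
  rw [toReal_expect_ber hq0 (by linarith)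
    (fun e => expect_ne_top fun d => by split <;> assumption), h2, h2]
  have hDr := toReal_disagreement h0 (by linarith : ρ ≤ 1) n F F
  have hAr := congrArg ENNReal.toReal hAD
  rw [ENNReal.toReal_add hAt hDt, ENNReal.toReal_one] at hAr
  have hS := le_stability_self h0 h1 n (fun l => sign (F l))
    (fun l => by cases F l <;> norm_num [sign]) (J.image Fin.val) fun l l' hl => by
      have : F l = F l' := hJ _ _ fun j hj => hl j (Finset.mem_image_of_mem _ hj)
      simp only [this]
  rw [Finset.card_image_of_injective _ Fin.val_injective] at hS
  set S := stability ρ n (fun l => sign (F l)) fun l => sign (F l)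
  rw [← hD] at hDr
  have hAr' : A.toReal = (1 + S) / 2 := by linarith
  simp only [Bool.xor_true, Bool.xor_false, Bool.not_true, Bool.not_false, if_true,
    Bool.false_eq_true, if_false, hDr, hAr']
  rw [pow_succ]
  have h3 : 0 ≤ (1 - 2 * q) * (1 - 2 * ρ) := mul_nonneg (by linarith) (by linarith)
  nlinarith [mul_le_mul_of_nonneg_left hS h3]

/-! ### Random permutations of a fixed string and independent bits -/

theorem expect_iid_eq_sum {α : Type} [Fintype α] (μ : PMF α) (N : ℕ) (Φ : List α → ℝ≥0∞) :
    expect (iid μ N) Φ = ∑ δ : Fin N → α, (∏ i, μ (δ i)) * Φ (List.ofFn δ) := by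
  induction N generalizing Φ with
  | zero => simp [iid, expect_pure]
  | succ N ih =>
    rw [iid, expect_bind]
    simp only [expect_map, ih]
    rw [← (Fin.consEquiv fun _ : Fin (N + 1) => α).sum_comp, Fintype.sum_prod_type, expect,
      tsum_fintype]
    simp only [Fin.consEquiv_apply, Fin.prod_univ_succ, Fin.cons_zero, Fin.cons_succ, List.ofFn_succ,
      Finset.mul_sum, mul_assoc]

/-- The number of ones. -/
def weight {N : ℕ} (δ : Fin N → Bool) : ℕ := (Finset.univ.filter fun i => δ i = true).card

theorem weight_le {N : ℕ} (δ : Fin N → Bool) : weight δ ≤ N :=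
  (Finset.card_le_univ _).trans (by simp)

theorem exists_perm_of_weight_eq {N : ℕ} {δ ε : Fin N → Bool} (h : weight δ = weight ε) :
    ∃ σ : Equiv.Perm (Fin N), ∀ i, δ i = ε (σ i) := by
  have hcard : Fintype.card {i // δ i = true} = Fintype.card {i // ε i = true} := by
    rw [Fintype.card_subtype, Fintype.card_subtype]
    exact h
  obtain ⟨e⟩ := Fintype.card_eq.mp hcard
  refine ⟨e.extendSubtype, fun i => ?_⟩
  by_cases hi : δ i = true
  · rw [hi, e.extendSubtype_mem i hi]
  · have := e.extendSubtype_not_mem i hi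
    rw [Bool.not_eq_true] at hi this
    rw [hi, this]

theorem prod_eq_pow_weight {N : ℕ} (W : Bool → ℝ≥0∞) (δ : Fin N → Bool) :
    ∏ i, W (δ i) = W true ^ weight δ * W false ^ (N - weight δ) := by
  have h : ∀ i, W (δ i) = if δ i = true then W true else W false := fun i => by
    cases δ i <;> simp
  simp only [h]
  rw [Finset.prod_ite, Finset.prod_const, Finset.prod_const, weight, Finset.filter_not,
    Finset.card_sdiff_of_subset (Finset.filter_subset _ _), Finset.card_univ, Fintype.card_fin]

theorem card_weight_eq (N w : ℕ) :
    (Finset.univ.filter fun δ : Fin N → Bool => weight δ = w).card = N.choose w := by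
  have h := Finset.card_powersetCard w (Finset.univ : Finset (Fin N))
  rw [Finset.card_univ, Fintype.card_fin] at h
  rw [← h]
  refine Finset.card_bij (fun δ _ => Finset.univ.filter fun i => δ i = true) (fun δ hδ => ?_)
    (fun δ _ ε _ hε => ?_) fun s hs => ⟨fun i => decide (i ∈ s), ?_, ?_⟩
  · exact Finset.mem_powersetCard.mpr ⟨Finset.subset_univ _, (Finset.mem_filter.mp hδ).2⟩
  · funext i
    have := congrArg (fun s => i ∈ s) hε
    simp only [Finset.mem_filter, Finset.mem_univ, true_and, eq_iff_iff] at this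
    exact Bool.eq_iff_iff.mpr this
  · rw [Finset.mem_filter]
    simpa [weight] using (Finset.mem_powersetCard.mp hs).2
  · simp

/-- The binomial distribution with parameters `a + b` and `a / (a + b)` has its mode at `a`. -/
theorem binomial_le_mode {N a b : ℕ} (hab : a + b = N) {k : ℕ} (hk : k ≤ N) :
    N.choose k * (a ^ k * b ^ (N - k)) ≤ N.choose a * (a ^ a * b ^ b) := by
  set g : ℕ → ℕ := fun k => N.choose k * (a ^ k * b ^ (N - k)) with hg
  have hrec : ∀ k < N, g (k + 1) * ((k + 1) * b) = g k * ((N - k) * a) := by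
    intro k hk
    have h1 := Nat.choose_succ_right_eq N k
    have h2 : b ^ (N - k) = b ^ (N - (k + 1)) * b := by
      rw [← pow_succ]
      congr 1
      omega
    simp only [hg, h2]
    calc _ = (N.choose (k + 1) * (k + 1)) * (a ^ (k + 1) * b ^ (N - (k + 1)) * b) := by ring
      _ = _ := by rw [h1]; ring
  have hup : ∀ k < a, g k ≤ g (k + 1) := by
    intro k hk
    rcases Nat.eq_zero_or_pos b with hb | hb
    · have : g k = 0 := by
        simp only [hg, hb]
        rw [zero_pow (by omega), mul_zero, mul_zero]
      omega
    · refine Nat.le_of_mul_le_mul_right (c := (k + 1) * b) ?_ (by positivity)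
      rw [hrec k (by omega)]
      refine Nat.mul_le_mul_left _ ?_
      rw [mul_comm (k + 1)]
      exact Nat.mul_le_mul (by omega) hk
  have hdown : ∀ k, a ≤ k → k < N → g (k + 1) ≤ g k := by
    intro k hak hk
    refine Nat.le_of_mul_le_mul_right (c := (k + 1) * b) ?_ (Nat.mul_pos (by omega) (by omega))
    rw [hrec k hk]
    refine Nat.mul_le_mul_left _ ?_
    rw [mul_comm (k + 1)]
    exact Nat.mul_le_mul (by omega) (by omega)
  have hga : g a = N.choose a * (a ^ a * b ^ b) := by
    simp only [hg]
    rw [show N - a = b by omega]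
  rw [← hga]
  show g k ≤ g a
  rcases le_total k a with h | h
  · exact Nat.decreasingInduction' (P := fun k => g k ≤ g a)
      (fun j hj _ ih => (hup j hj).trans ih) h le_rfl
  · clear_value g
    induction k, h using Nat.le_induction with
    | base => exact le_rfl
    | succ j hj ih => exact (hdown j hj (by omega)).trans (ih (by omega))

theorem pow_le_succ_mul_mode {N a b : ℕ} (hab : a + b = N) :
    N ^ N ≤ (N + 1) * (N.choose a * (a ^ a * b ^ b)) := by
  have h : (a + b) ^ N ≤ ∑ _k ∈ Finset.range (N + 1), N.choose a * (a ^ a * b ^ b) := by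
    rw [add_pow]
    refine Finset.sum_le_sum fun k hk => ?_
    rw [mul_comm]
    exact binomial_le_mode hab (by simpa [Nat.lt_succ_iff] using hk)
  rwa [hab, Finset.sum_const, Finset.card_range, smul_eq_mul] at h

/-- A randomly permuted string of weight `w` is dominated by independent bits of bias `w / N`, up to
a factor `N + 1`: conditioned on the weight, which is `w` with probability at least `1 / (N + 1)`,
the latter have the same distribution. -/
theorem expect_perm_le {N : ℕ} (ε : Fin N → Bool) (Φ : List Bool → ℝ≥0∞) :
    expect (unif (Equiv.Perm (Fin N))) (fun π => Φ (List.ofFn fun j => ε (π.symm j))) ≤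
      (N + 1 : ℕ) * expect (iid (ber (weight ε / N)) N) Φ := by
  set μ := ber (weight ε / N) with hμ
  set A := expect (unif (Equiv.Perm (Fin N))) fun π => Φ (List.ofFn fun j => ε (π.symm j)) with hA
  set P : (Fin N → Bool) → ℝ≥0∞ := fun δ => ∏ i, μ (δ i) with hP
  set T := Finset.univ.filter fun δ : Fin N → Bool => weight δ = weight ε with hT
  have hinv : ∀ π : Equiv.Perm (Fin N),
      ∑ δ, P δ * Φ (List.ofFn fun j => δ (π.symm j)) = expect (iid μ N) Φ := by
    intro π
    rw [expect_iid_eq_sum]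
    refine Eq.trans (Finset.sum_congr rfl fun δ _ => ?_)
      ((Equiv.arrowCongr π (Equiv.refl Bool)).sum_comp fun δ => P δ * Φ (List.ofFn δ))
    have e : (Equiv.arrowCongr π (Equiv.refl Bool)) δ = fun j => δ (π.symm j) := rfl
    rw [e]
    congr 1
    exact (Equiv.prod_comp π.symm fun i => μ (δ i)).symm
  have h1 : ∑ δ ∈ T, P δ * A ≤ expect (iid μ N) Φ := by
    rw [← expect_const (μ := unif (Equiv.Perm (Fin N))) (expect (iid μ N) Φ)]
    have hsw : expect (unif (Equiv.Perm (Fin N)))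
        (fun π => ∑ δ, P δ * Φ (List.ofFn fun j => δ (π.symm j))) =
        ∑ δ, P δ * expect (unif (Equiv.Perm (Fin N))) fun π =>
          Φ (List.ofFn fun j => δ (π.symm j)) := by
      simp only [← expect_const_mul]
      simp only [expect_unif, Finset.mul_sum]
      rw [Finset.sum_comm]
    have : (fun π : Equiv.Perm (Fin N) => expect (iid μ N) Φ) =
        fun π => ∑ δ, P δ * Φ (List.ofFn fun j => δ (π.symm j)) := funext fun π => (hinv π).symm
    rw [this, hsw]
    refine (Finset.sum_le_sum fun δ hδ => ?_).trans
      (Finset.sum_le_sum_of_subset (Finset.subset_univ T))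
    obtain ⟨σ, hσ⟩ := exists_perm_of_weight_eq (Finset.mem_filter.mp hδ).2
    refine le_of_eq ?_
    congr 1
    rw [hA, ← expect_unif_equiv (Equiv.mulRight σ) fun π => Φ (List.ofFn fun j => δ (π.symm j))]
    congr 1
    funext π
    congr 2
    funext j
    rw [hσ]
    show ε (π.symm j) = ε (σ (σ.symm (π.symm j)))
    rw [Equiv.apply_symm_apply]
  have hw := weight_le ε
  have h2 : 1 ≤ (N + 1 : ℕ) * ∑ δ ∈ T, P δ := by
    have hPδ : ∀ δ ∈ T, P δ = μ true ^ weight ε * μ false ^ (N - weight ε) := fun δ hδ => by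
      rw [hP]
      simp only
      rw [prod_eq_pow_weight μ δ, (Finset.mem_filter.mp hδ).2]
    rw [Finset.sum_congr rfl hPδ, Finset.sum_const, hT, card_weight_eq, nsmul_eq_mul]
    rcases Nat.eq_zero_or_pos N with hN | hN
    · have : weight ε = 0 := by omega
      simp [this, hN]
    have hN' : (0 : ℝ) < N := by exact_mod_cast hN
    have hρ : (weight ε : ℝ) / N ≤ 1 := by
      rw [div_le_one hN']
      exact_mod_cast hw
    have ht : μ true = ENNReal.ofReal (weight ε / N) := by
      rw [hμ]
      simp [ber, ENNReal.ofReal_le_one.mpr hρ]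
    have hf : μ false = ENNReal.ofReal ((N - weight ε : ℕ) / N) := by
      rw [hμ, Nat.cast_sub hw, sub_div, div_self hN'.ne', ENNReal.ofReal_sub _ (by positivity)]
      simp [ber, ENNReal.ofReal_le_one.mpr hρ]
    rw [ht, hf, ← ENNReal.ofReal_pow (by positivity), ← ENNReal.ofReal_pow (by positivity),
      ← ENNReal.ofReal_mul (by positivity), ← ENNReal.ofReal_natCast (N.choose _),
      ← ENNReal.ofReal_natCast (N + 1), ← ENNReal.ofReal_mul (by positivity),
      ← ENNReal.ofReal_mul (by positivity), ENNReal.one_le_ofReal]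
    have h3 := pow_le_succ_mul_mode (Nat.add_sub_of_le hw)
    have h4 : (N : ℝ) ^ N ≤ (N + 1 : ℕ) * (N.choose (weight ε) *
        ((weight ε : ℝ) ^ weight ε * ((N - weight ε : ℕ) : ℝ) ^ (N - weight ε))) := by
      exact_mod_cast h3
    have h5 : (N : ℝ) ^ N = (N : ℝ) ^ weight ε * (N : ℝ) ^ (N - weight ε) := by
      rw [← pow_add, Nat.add_sub_of_le hw]
    rw [div_pow, div_pow, div_mul_div_comm, ← h5, mul_div_assoc', mul_div_assoc',
      le_div_iff₀ (by positivity), one_mul]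
    exact h4
  calc A ≤ ((N + 1 : ℕ) * ∑ δ ∈ T, P δ) * A := le_mul_of_one_le_left' h2
    _ = (N + 1 : ℕ) * ∑ δ ∈ T, P δ * A := by rw [mul_assoc, Finset.sum_mul]
    _ ≤ _ := mul_le_mul_right h1 _

/-! ### Decoding a codeword with errors -/

theorem iid_zipWith {α γ ξ : Type} (μ : PMF α) (ν : PMF γ) (g : α → γ → ξ) (m : ℕ) :
    ((iid μ m).bind fun l => (iid ν m).map fun l' => List.zipWith g l l') =
      iid (μ.bind fun a => ν.map (g a)) m := by
  induction m with
  | zero => simp [iid, PMF.pure_map]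
  | succ m ih =>
    simp only [iid, ← ih]
    simp only [← PMF.bind_pure_comp, PMF.bind_bind, PMF.pure_bind, comp_def,
      List.zipWith_cons_cons]
    congr 1
    funext a
    rw [PMF.bind_comm]

theorem zipWith_flatten {α γ ξ : Type} (g : α → γ → ξ) {c : ℕ} {l : List (List α)} {l' : List (List γ)}
    (hl : ∀ a ∈ l, a.length = c) (hl' : ∀ a ∈ l', a.length = c) (h : l.length = l'.length) :
    List.zipWith g l.flatten l'.flatten = (List.zipWith (List.zipWith g) l l').flatten := by
  induction l generalizing l' with
  | nil => simp
  | cons a l ih =>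
    cases l' with
    | nil => simp at h
    | cons a' l' =>
      rw [List.flatten_cons, List.flatten_cons, List.zipWith_cons_cons, List.flatten_cons,
        List.zipWith_append (by rw [hl a (by simp), hl' a' (by simp)]),
        ih (fun a ha => hl a (by simp [ha])) (fun a ha => hl' a (by simp [ha])) (by simpa using h)]

/-- One factor of the exponential moment of the number of agreements, for an agreement probability of
at least `(1 + b) / 2`. -/
theorem expect_exp_le {α : Type} (μ : PMF α) (g : α → Bool) {b : ℝ} (hb0 : 0 ≤ b) (hb1 : b ≤ 1)
    (h : expect μ (fun a => if g a = true then 0 else 1) ≤ ENNReal.ofReal ((1 - b) / 2)) :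
    expect μ (fun a => ENNReal.ofReal (Real.exp (if g a then -(b / 2) else - -(b / 2)))) ≤
      ENNReal.ofReal (Real.exp (-(b ^ 2 / 4))) := by
  have hd : 0 ≤ Real.exp (b / 2) - Real.exp (-(b / 2)) := by
    rw [sub_nonneg]
    exact Real.exp_le_exp.mpr (by linarith)
  have hpt : ∀ a, ENNReal.ofReal (Real.exp (if g a then -(b / 2) else - -(b / 2))) =
      ENNReal.ofReal (Real.exp (-(b / 2))) +
        ENNReal.ofReal (Real.exp (b / 2) - Real.exp (-(b / 2))) * if g a = true then 0 else 1 := by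
    intro a
    cases g a
    · rw [if_neg (by simp), if_neg (by simp), mul_one, ← ENNReal.ofReal_add (Real.exp_pos _).le hd,
        neg_neg]
      congr 1
      ring
    · simp
  simp only [hpt]
  rw [expect_add, expect_const, expect_const_mul]
  refine (add_le_add le_rfl (mul_le_mul_right h _)).trans ?_
  rw [← ENNReal.ofReal_mul hd, ← ENNReal.ofReal_add (Real.exp_pos _).le
    (mul_nonneg hd (by linarith))]
  refine ENNReal.ofReal_le_ofReal ?_
  have h1 := (abs_le.mp (Real.abs_exp_sub_one_sub_id_le (x := b / 2)
    (abs_le.mpr ⟨by linarith, by linarith⟩))).2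
  have h2 := (abs_le.mp (Real.abs_exp_sub_one_sub_id_le (x := -(b / 2))
    (abs_le.mpr ⟨by linarith, by linarith⟩))).2
  have h3 := Real.add_one_le_exp (-(b ^ 2 / 4))
  nlinarith [mul_nonneg hb0 (sub_nonneg.mpr hb1)]

/-- The failure probability of the decoder under independent noise of rate `ρ`, where `b` bounds the
bias of a block from below: the exponential moment method with parameter `-b/2`. -/
theorem expect_agreements_noise_le {q ρ : ℝ} (hq0 : 0 ≤ q) (hq1 : q ≤ 1 / 2) (h0 : 0 ≤ ρ)
    (h1 : ρ ≤ 1 / 2) {n m N : ℕ} (hN : (n + 1) * m ≤ N) (f : (Fin n → Bool) → Bool)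
    (J : Finset (Fin n)) (hJ : ∀ x x' : Fin n → Bool, (∀ j ∈ J, x j = x' j) → f x = f x')
    {b : ℝ} (hb0 : 0 ≤ b) (hb1 : b ≤ 1) (hb : b ≤ (1 - 2 * q) * (1 - 2 * ρ) ^ (J.card + 1))
    (r : List Bool) :
    expect (iid (noisySample q f) m) (fun bl => expect (iid (ber ρ) N) fun δ =>
      open Classical in
      if threshold m < agreements m f (List.zipWith Bool.xor (bl.flatten ++ r) δ) then 0 else 1) ≤
      ENNReal.ofReal (Real.exp (b * (Real.log m * Real.sqrt m) - m * (b ^ 2 / 4))) := by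
  classical
  have e := iid_add (ber ρ) ((n + 1) * m) (N - (n + 1) * m)
  rw [Nat.add_sub_of_le hN, ← iid_flatten] at e
  have hstep : expect (iid (noisySample q f) m) (fun bl => expect (iid (ber ρ) N) fun δ =>
      if threshold m < agreements m f (List.zipWith Bool.xor (bl.flatten ++ r) δ) then 0 else 1) ≤
      expect (iid ((noisySample q f).bind fun a =>
        (iid (ber ρ) (n + 1)).map (List.zipWith Bool.xor a)) m) fun l =>
          if (l.countP (agrees f) : ℝ) ≤ threshold m then 1 else 0 := by
    rw [e, ← iid_zipWith, expect_bind]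
    refine expect_mono fun bl hbl => ?_
    rw [expect_bind, expect_map, expect_map]
    refine expect_mono fun db hdb => ?_
    rw [expect_map]
    refine expect_le fun δ _ => ?_
    have hbl := mem_support_iid hbl
    have hdb := mem_support_iid hdb
    have h1 : ∀ a ∈ bl, a.length = n + 1 := fun a ha => length_of_mem_support_noisySample (hbl.2 a ha)
    have h2 : ∀ a ∈ db, a.length = n + 1 := fun a ha => (mem_support_iid (hdb.2 a ha)).1
    have hlen : ∀ l : List (List Bool), (∀ a ∈ l, a.length = n + 1) →
        l.flatten.length = l.length * (n + 1) := fun l hl => by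
      rw [List.length_flatten, List.eq_replicate_iff.mpr ⟨List.length_map _, fun x hx => ?_⟩,
        List.sum_replicate, smul_eq_mul]
      obtain ⟨a, ha, rfl⟩ := List.mem_map.mp hx
      exact hl a ha
    rw [List.zipWith_append (by rw [hlen bl h1, hlen db h2, hbl.1, hdb.1]),
      zipWith_flatten _ h1 h2 (by rw [hbl.1, hdb.1]),
      agreements_flatten f (by simp [hbl.1, hdb.1]) fun a ha => ?_]
    · split
      · exact zero_le
      · rw [if_pos (by linarith)]
    · obtain ⟨i, hi, rfl⟩ := List.getElem_of_mem ha
      simp only [List.length_zipWith] at hi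
      rw [List.getElem_zipWith, List.length_zipWith, h1 _ (List.getElem_mem _),
        h2 _ (List.getElem_mem _), min_self]
  refine hstep.trans ((expect_iid_tail_le _ (agrees f) m (-(b / 2))
    (-(b * (Real.log m * Real.sqrt m))) _ fun l hl h => ?_).trans ?_)
  · rw [threshold] at h
    nlinarith
  · have hblock := expect_block_le hq0 hq1 h0 h1 f J hJ
    have h2 := expect_exp_le ((noisySample q f).bind fun a =>
        (iid (ber ρ) (n + 1)).map (List.zipWith Bool.xor a)) (agrees f) hb0 hb1 (by
      rw [expect_bind]
      simp only [expect_map]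
      exact hblock.trans (ENNReal.ofReal_le_ofReal (by linarith)))
    refine (mul_le_mul_right (pow_le_pow_left' h2 m) _).trans (le_of_eq ?_)
    rw [← ENNReal.ofReal_pow (Real.exp_pos _).le, ← Real.exp_nat_mul,
      ← ENNReal.ofReal_mul (Real.exp_pos _).le, ← Real.exp_add]
    congr 2
    ring

theorem card_filter_range_eq_weight {N : ℕ} (x : Fin N → Bool) (y : List Bool) :
    ((List.range (List.ofFn x).length).filter fun i =>
      (List.ofFn x).getD i false != y.getD i false).length =
      weight fun i => xor (x i) (y.getD i false) := by
  rw [← List.countP_eq_length_filter, List.length_ofFn]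
  have h : List.range N = List.ofFn fun i : Fin N => (i : ℕ) := by
    refine List.ext_getElem (by simp) fun i h1 h2 => by simp
  rw [h, countP_ofFn, weight]
  simp only [getD_ofFn x false (Fin.is_lt _)]

/-- The failure probability of the decoder for random `π`, if the errors `ε` do not depend on `π`. -/
theorem expect_agreements_perm_le {p q : ℝ} (hp : p ≤ 1 / 2) (hq0 : 0 ≤ q) (hq1 : q ≤ 1 / 2)
    {n m N : ℕ} (hN : (n + 1) * m ≤ N) (f : (Fin n → Bool) → Bool)
    (J : Finset (Fin n)) (hJ : ∀ x x' : Fin n → Bool, (∀ j ∈ J, x j = x' j) → f x = f x')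
    {b : ℝ} (hb0 : 0 ≤ b) (hb1 : b ≤ 1) (hb : b ≤ (1 - 2 * q) * (1 - 2 * p) ^ (J.card + 1))
    (hp0 : 0 ≤ p) (ε : Fin N → Bool) (hε : (weight ε : ℝ) ≤ p * N) :
    expect (unif (Equiv.Perm (Fin N))) (fun π => expect (iid (noisySample q f) m) fun bl =>
      expect (unifBits (N - (n + 1) * m)) fun r =>
      open Classical in
      if threshold m < agreements m f (List.ofFn fun j =>
        xor ((bl.flatten ++ List.ofFn r).getD j false) (ε (π.symm j))) then 0 else 1) ≤
      (N + 1 : ℕ) *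
        ENNReal.ofReal (Real.exp (b * (Real.log m * Real.sqrt m) - m * (b ^ 2 / 4))) := by
  classical
  have hρ : (weight ε : ℝ) / N ≤ p := div_le_of_le_mul₀ (Nat.cast_nonneg _) hp0 hε
  have h0 : 0 ≤ (weight ε : ℝ) / N := by positivity
  have hpow : (1 - 2 * p) ^ (J.card + 1) ≤ (1 - 2 * ((weight ε : ℝ) / N)) ^ (J.card + 1) :=
    pow_le_pow_left₀ (by linarith) (by linarith) _
  rw [expect_comm]
  simp only [expect_comm (μ := unif (Equiv.Perm (Fin N)))]
  rw [expect_comm]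
  refine expect_le fun r _ => ?_
  have hlen : ∀ bl ∈ (iid (noisySample q f) m).support,
      (bl.flatten ++ List.ofFn r).length = N := fun bl hbl => by
    have hbl := mem_support_iid hbl
    have h : bl.map List.length = List.replicate m (n + 1) := by
      refine List.eq_replicate_iff.mpr ⟨by rw [List.length_map, hbl.1], fun x hx => ?_⟩
      obtain ⟨a, ha, rfl⟩ := List.mem_map.mp hx
      exact length_of_mem_support_noisySample (hbl.2 a ha)
    rw [List.length_append, List.length_flatten, h, List.sum_replicate, smul_eq_mul,
      List.length_ofFn, mul_comm m]
    omega
  have hzip : ∀ bl ∈ (iid (noisySample q f) m).support, ∀ δ : Fin N → Bool,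
      (List.ofFn fun j => xor ((bl.flatten ++ List.ofFn r).getD j false) (δ j)) =
        List.zipWith Bool.xor (bl.flatten ++ List.ofFn r) (List.ofFn δ) := fun bl hbl δ => by
    have := hlen bl hbl
    refine List.ext_getElem (by rw [List.length_zipWith, this]; simp) fun i h1 h2 => ?_
    rw [List.getElem_zipWith, List.getElem_ofFn, List.getElem_ofFn,
      List.getD_eq_getElem _ _ (by rw [this]; simpa using h1)]
  refine (expect_mono fun bl hbl => ?_).trans
    ((expect_const_mul _ _).le.trans (mul_le_mul_right
      (expect_agreements_noise_le hq0 hq1 h0 (hρ.trans hp) hN f J hJ hb0 hb1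
        (hb.trans (mul_le_mul_of_nonneg_left hpow (by linarith))) (List.ofFn r)) _))
  simp only [fun π : Equiv.Perm (Fin N) => hzip bl hbl fun j => ε (π.symm j)]
  exact expect_perm_le ε fun δ => if threshold m < agreements m f
    (List.zipWith Bool.xor (bl.flatten ++ List.ofFn r) δ) then 0 else 1

/-- The law of a uniformly random string together with its image under a channel. -/
noncomputable def throughChannel (N : ℕ) (E : Channel) : PMF (List Bool × List Bool) :=
  (unifBits N).bind fun x => (E (List.ofFn x)).map fun y => (List.ofFn x, y)

/-- As `z` is uniform and independent of `π` and of the blocks, so is the codeword: the failure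
probability is that for a uniformly random `x`, of which the channel makes `y`, and independent
blocks and `π`, which are the blocks of the codeword `x` for `z = a ⊕ (π⁻¹ ∘ x)`. -/
theorem expect_decode_le {p q : ℝ} (hp0 : 0 ≤ p) (hp : p ≤ 1 / 2) (hq0 : 0 ≤ q) (hq1 : q ≤ 1 / 2)
    {n m N : ℕ} (hN : (n + 1) * m ≤ N) (f : (Fin n → Bool) → Bool)
    (J : Finset (Fin n)) (hJ : ∀ x x' : Fin n → Bool, (∀ j ∈ J, x j = x' j) → f x = f x')
    {b : ℝ} (hb0 : 0 ≤ b) (hb1 : b ≤ 1) (hb : b ≤ (1 - 2 * q) * (1 - 2 * p) ^ (J.card + 1))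
    (E : Channel) :
    expect (unifBits N) (fun z => expect (unif (Equiv.Perm (Fin N))) fun π =>
      expect (encode q m f z π) fun c => expect (E (List.ofFn c)) fun y =>
      open Classical in
      if y.length = N ∧ threshold m < agreement m f z π y then 0 else 1) ≤
      (N + 1 : ℕ) *
        ENNReal.ofReal (Real.exp (b * (Real.log m * Real.sqrt m) - m * (b ^ 2 / 4))) +
      expect (throughChannel N E) fun xy =>
        open Classical in if HammingClose p xy.1 xy.2 then 0 else 1 := by
  classical
  set B : ℝ≥0∞ := (N + 1 : ℕ) *
    ENNReal.ofReal (Real.exp (b * (Real.log m * Real.sqrt m) - m * (b ^ 2 / 4))) with hB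
  set κ := (unifBits N).bind fun x => (E (List.ofFn x)).map fun y => (x, y) with hκ
  have hκ' : throughChannel N E = κ.map fun xy => (List.ofFn xy.1, xy.2) := by
    simp only [throughChannel, hκ, PMF.map_bind, PMF.map_comp, comp_def]
  rw [hκ', expect_map, ← expect_const (μ := κ) B, ← expect_add]
  have hsubst : ∀ (π : Equiv.Perm (Fin N)) (a : List Bool),
      expect (unifBits N) (fun z => expect (E (List.ofFn fun i =>
        xor (a.getD (π i) false) (z (π i)))) fun y =>
          if y.length = N ∧ threshold m < agreement m f z π y then (0 : ℝ≥0∞) else 1) =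
      expect κ fun xy => if xy.2.length = N ∧ threshold m <
          agreement m f (fun j => xor (a.getD j false) (xy.1 (π.symm j))) π xy.2 then 0 else 1 := by
    intro π a
    have hinv : Involutive fun v : Fin N → Bool => fun i => xor (a.getD i false) (v i) := fun v => by
      funext i
      simp
    rw [hκ, expect_bind]
    simp only [expect_map]
    rw [unifBits, ← expect_unif_equiv
      ((Equiv.arrowCongr π (Equiv.refl Bool)).trans hinv.toPerm)]
    congr 1
    funext x
    have e1 : (((Equiv.arrowCongr π (Equiv.refl Bool)).trans hinv.toPerm) x) =
      fun j : Fin N => xor (a.getD j false) (x (π.symm j)) := rfl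
    have e2 : (fun i => xor (a.getD (π i) false) (xor (a.getD (π i) false) (x (π.symm (π i))))) =
        x := by
      funext i
      simp
    rw [e1, e2]
  have hexp : expect (unifBits N) (fun z => expect (unif (Equiv.Perm (Fin N))) fun π =>
      expect (encode q m f z π) fun c => expect (E (List.ofFn c)) fun y =>
      if y.length = N ∧ threshold m < agreement m f z π y then (0 : ℝ≥0∞) else 1) =
      expect κ fun xy => expect (unif (Equiv.Perm (Fin N))) fun π =>
        expect (iid (noisySample q f) m) fun bl => expect (unifBits (N - (n + 1) * m)) fun r =>
        if xy.2.length = N ∧ threshold m < agreement m f (fun j =>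
          xor ((bl.flatten ++ List.ofFn r).getD j false) (xy.1 (π.symm j))) π xy.2 then 0 else 1 := by
    simp only [encode, expect_bind, expect_map]
    rw [expect_comm, expect_comm (μ := κ)]
    congr 1
    funext π
    rw [expect_comm, expect_comm (μ := κ)]
    congr 1
    funext bl
    rw [expect_comm, expect_comm (μ := κ)]
    congr 1
    funext r
    exact hsubst π (bl.flatten ++ List.ofFn r)
  rw [hexp]
  refine expect_mono fun xy _ => ?_
  by_cases hclose : HammingClose p (List.ofFn xy.1) xy.2
  · obtain ⟨hlen, hw⟩ := hclose
    rw [card_filter_range_eq_weight] at hw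
    rw [List.length_ofFn] at hw hlen
    rw [if_pos ⟨by rw [hlen, List.length_ofFn], by
      rw [card_filter_range_eq_weight, List.length_ofFn]; exact hw⟩, add_zero]
    refine le_trans (le_of_eq ?_) (expect_agreements_perm_le hp hq0 hq1 hN f J hJ hb0 hb1 hb hp0
      (fun i => xor (xy.1 i) (xy.2.getD i false)) hw)
    congr 1
    funext π
    congr 1
    funext bl
    congr 1
    funext r
    simp only [hlen, true_and, agreement_eq]
    have : ∀ j : Fin N, xor (xy.2.getD (π.symm j) false)
        (xor ((bl.flatten ++ List.ofFn r).getD j false) (xy.1 (π.symm j))) =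
        xor ((bl.flatten ++ List.ofFn r).getD j false)
          (xor (xy.1 (π.symm j)) (xy.2.getD (π.symm j) false)) := fun j => by
      cases xy.2.getD (π.symm j) false <;> cases (bl.flatten ++ List.ofFn r).getD j false <;>
        cases xy.1 (π.symm j) <;> rfl
    simp only [this]
  · rw [if_neg hclose]
    exact (expect_le fun π _ => expect_le fun bl _ => expect_le fun r _ => by
      split <;> simp).trans le_add_self

theorem expect_throughChannel_of_bounded {p : ℝ} {E : Channel} (hE : SubstitutionBounded p E)
    (N : ℕ) : expect (throughChannel N E) (fun xy =>
      open Classical in if HammingClose p xy.1 xy.2 then 0 else 1) = 0 := by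
  classical
  rw [← nonpos_iff_eq_zero, throughChannel, expect_bind]
  refine expect_le fun x _ => ?_
  rw [expect_map]
  exact expect_le fun y hy => by rw [if_pos (hE _ _ hy)]

theorem expect_throughChannel_of_weaklyBounded {p : ℝ} {ν : ℕ → ℝ} {E : Channel}
    (hE : WeaklySubstitutionBoundedBy p ν E) (N : ℕ) : expect (throughChannel N E) (fun xy =>
      open Classical in if HammingClose p xy.1 xy.2 then 0 else 1) ≤ ENNReal.ofReal (ν N) := by
  classical
  have h := hE N
  rw [PMF.toOuterMeasure_apply] at h
  have e : expect (throughChannel N E) (fun xy => if HammingClose p xy.1 xy.2 then 0 else 1) =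
      ∑' xy, Set.indicator {yz : List Bool × List Bool | ¬ HammingClose p yz.1 yz.2}
        (throughChannel N E) xy := by
    rw [expect]
    congr 1
    funext xy
    rw [Set.indicator_apply]
    simp only [Set.mem_ofPred_eq]
    by_cases h : HammingClose p xy.1 xy.2 <;> simp [h]
  rw [e, ← ENNReal.ofReal_toReal (a := ∑' xy, _)]
  · exact ENNReal.ofReal_le_ofReal h
  · rw [← e]
    exact expect_ne_top fun xy => by split <;> simp

/-- The lower bound for `m` in terms of the bias of a block. The locality `k ≤ log n` makes the bias at
least polynomial in `1 / n`, namely `(1 - 2p)^k ≥ n^(-log (1 / (1 - 2p)))`. -/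
theorem bias_le {p q : ℝ} (hp0 : 0 < p) (hp : p < 1 / 2) (hq1 : q < 1 / 2)
    {n m k : ℕ} (hn : 1 ≤ n) (hk : (k : ℝ) ≤ Real.logb 2 n)
    (hm : ((1 - 2 * q) ^ 4)⁻¹ * (n : ℝ) ^ (4 * Real.logb 2 (1 / (1 - 2 * p))) ≤ m) :
    (1 - 2 * p) * (m : ℝ) ^ (-(1 / 4) : ℝ) ≤ (1 - 2 * q) * (1 - 2 * p) ^ (k + 1) := by
  have hp' : 0 < 1 - 2 * p := by linarith
  have hq' : 0 < 1 - 2 * q := by linarith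
  have hn' : (0 : ℝ) < n := by exact_mod_cast hn
  set L := Real.logb 2 (1 / (1 - 2 * p)) with hL
  have h1 : (n : ℝ) ^ (-L) ≤ (1 - 2 * p) ^ k := by
    have h2 : (1 - 2 * p) = (2 : ℝ) ^ (-L) := by
      rw [hL, one_div, Real.logb_inv, neg_neg, Real.rpow_logb two_pos (by norm_num) hp']
    have h3 : (n : ℝ) = (2 : ℝ) ^ Real.logb 2 n := by
      rw [Real.rpow_logb two_pos (by norm_num) hn']
    have hL0 : 0 ≤ L := Real.logb_nonneg one_lt_two (by
      rw [le_div_iff₀ hp']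
      linarith)
    rw [h2, ← Real.rpow_natCast, ← Real.rpow_mul two_pos.le]
    conv_lhs => rw [h3]
    rw [← Real.rpow_mul two_pos.le]
    refine Real.rpow_le_rpow_of_exponent_le one_le_two ?_
    nlinarith
  have h4 : (m : ℝ) ^ (-(1 / 4) : ℝ) ≤ (1 - 2 * q) * (n : ℝ) ^ (-L) := by
    have h5 : 0 < ((1 - 2 * q) ^ 4)⁻¹ * (n : ℝ) ^ (4 * L) := by positivity
    refine (Real.rpow_le_rpow_of_nonpos h5 hm (by norm_num)).trans (le_of_eq ?_)
    rw [Real.mul_rpow (by positivity) (by positivity), ← Real.rpow_mul hn'.le,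
      Real.inv_rpow (by positivity), ← Real.rpow_natCast (1 - 2 * q), ← Real.rpow_mul hq'.le,
      ← Real.rpow_neg hq'.le]
    congr 1
    · norm_num
    · congr 1
      ring
  calc (1 - 2 * p) * (m : ℝ) ^ (-(1 / 4) : ℝ) ≤ (1 - 2 * p) * ((1 - 2 * q) * (1 - 2 * p) ^ k) := by
        gcongr
        exact h4.trans (by gcongr)
    _ = _ := by rw [pow_succ]; ring

/-- For large `m` the exponent of the failure probability with bias `b = d m^(-1/4)` is at most
`-(d² / 8) √m`: the excess of the threshold over `m/2` contributes `d ln(m) m^(1/4)` only. -/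
theorem exponent_le {d : ℝ} (hd : 0 < d) : ∃ m₀ : ℝ, ∀ m : ℕ, m₀ ≤ m → 1 ≤ m →
    d * (m : ℝ) ^ (-(1 / 4) : ℝ) * (Real.log m * Real.sqrt m) -
      m * ((d * (m : ℝ) ^ (-(1 / 4) : ℝ)) ^ 2 / 4) ≤ -(d ^ 2 / 8 * Real.sqrt m) := by
  have h := (isLittleO_log_rpow_atTop (r := 1 / 4) (by norm_num)).bound (c := d / 8) (by positivity)
  obtain ⟨m₀, hm₀⟩ := eventually_atTop.mp h
  refine ⟨m₀, fun m hm h1 => ?_⟩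
  have hpos : (0 : ℝ) < m := by exact_mod_cast h1
  have hl := hm₀ m hm
  have hlog : 0 ≤ Real.log m := Real.log_natCast_nonneg m
  rw [Real.norm_eq_abs, Real.norm_eq_abs, abs_of_nonneg hlog, abs_of_nonneg (by positivity)] at hl
  set a := (m : ℝ) ^ (1 / 4 : ℝ) with ha
  have ha0 : 0 < a := by positivity
  have hinv : (m : ℝ) ^ (-(1 / 4) : ℝ) = a⁻¹ := Real.rpow_neg hpos.le _
  have hsq : Real.sqrt m = a ^ 2 := by
    rw [Real.sqrt_eq_rpow, ha, ← Real.rpow_natCast, ← Real.rpow_mul hpos.le]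
    norm_num
  have hm4 : (m : ℝ) = a ^ 4 := by
    rw [ha, ← Real.rpow_natCast, ← Real.rpow_mul hpos.le]
    norm_num
  rw [hinv, hsq]
  have e1 : d * a⁻¹ * (Real.log m * a ^ 2) = d * (Real.log m * a) := by field_simp
  have e2 : (m : ℝ) * ((d * a⁻¹) ^ 2 / 4) = d ^ 2 / 4 * a ^ 2 := by
    rw [hm4]
    field_simp
  rw [e1, e2]
  have h2 : d * (Real.log m * a) ≤ d * (d / 8 * a * a) := by gcongr
  nlinarith

/-! ### Robustness -/

theorem le_blockLength_left {n m : ℕ} (hm : 1 ≤ m) : n ≤ blockLength n m := by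
  rw [blockLength]
  nlinarith [Nat.zero_le n, Nat.mul_le_mul_right ((n + 1) ^ 2) hm]

/-- Both kinds of channels are covered: the assumption bounds the probability that the channel makes too
many substitutions in a uniformly random string of the block length. -/
theorem prfPRC_isRobust {p q : ℝ} (hp0 : 0 < p) (hp : p < 1 / 2) (hq0 : 0 ≤ q) (hq1 : q < 1 / 2)
    {𝓕 : FunctionFamily} {τ m : ℕ → ℕ} (bn : PolyBounded 𝓕.n) (bm : PolyBounded m)
    (hn : ∀ᶠ lam in atTop, 1 ≤ 𝓕.n lam) (hτ : ∀ lam, (τ lam : ℝ) ≤ Real.logb 2 (𝓕.n lam))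
    (hloc : 𝓕.IsLocal τ)
    (hm : ∀ lam, ((1 - 2 * q) ^ 4)⁻¹ *
      (𝓕.n lam : ℝ) ^ (4 * Real.logb 2 (1 / (1 - 2 * p))) ≤ m lam)
    {c : ℝ} (hc : 0 < c) (hmc : ∀ᶠ lam : ℕ in atTop, (lam : ℝ) ^ c ≤ m lam)
    {𝓔 : ℕ → Set Channel} {ν : ℕ → ℝ} (hν : Negligible ν)
    (h𝓔 : ∀ lam, ∀ E ∈ 𝓔 lam, expect (throughChannel (blockLength (𝓕.n lam) (m lam)) E) (fun xy =>
      open Classical in if HammingClose p xy.1 xy.2 then 0 else 1) ≤ ENNReal.ofReal (ν lam)) :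
    (prfPRC 𝓕 q m).IsRobust 𝓔 := by
  classical
  have hd : 0 < 1 - 2 * p := by linarith
  obtain ⟨m₀, hm₀⟩ := exponent_le hd
  set N : ℕ → ℕ := fun lam => blockLength (𝓕.n lam) (m lam) with hN
  set good : ℕ → Prop := fun lam => 1 ≤ 𝓕.n lam ∧ 1 ≤ m lam ∧ m₀ ≤ m lam with hgood
  set B : ℕ → ℝ := fun lam => (N lam + 1 : ℕ) * Real.exp (-((1 - 2 * p) ^ 2 / 8 * Real.sqrt (m lam)))
    with hB
  have hB0 : ∀ lam, 0 ≤ B lam := fun lam => by positivity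
  -- The estimates need `n ≥ 1` and large `m`, that is, large `λ`; before that, one is a bound.
  refine ⟨fun lam => if good lam then B lam + ν lam else 1, ?_, fun lam msg E hE => ?_⟩
  · have h1 : Negligible fun lam : ℕ => (N lam + 1 : ℕ) *
        Real.exp (-((1 - 2 * p) ^ 2 / 8 * (lam : ℝ) ^ (c / 2))) :=
      (negligible_exp_neg_rpow (by positivity) (by positivity)).polyBounded_mul
        ((polyBounded_blockLength bn bm).add (.const 1))
    refine (h1.add hν).of_eventually_le (fun lam => ?_) ?_
    · split
      · exact add_nonneg (hB0 lam) (hν.1 lam)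
      · exact zero_le_one
    have h2 : Tendsto (fun lam : ℕ => (lam : ℝ) ^ c) atTop atTop :=
      (tendsto_rpow_atTop hc).comp tendsto_natCast_atTop_atTop
    filter_upwards [hn, hmc, h2.eventually_ge_atTop (max 1 m₀)] with lam h3 h4 h5
    have h6 : max 1 m₀ ≤ (m lam : ℝ) := h5.trans h4
    rw [if_pos ⟨h3, by exact_mod_cast (le_max_left _ _).trans h6, (le_max_right _ _).trans h6⟩]
    simp only [hB]
    gcongr
    rw [Real.sqrt_eq_rpow, div_eq_mul_one_div c 2, Real.rpow_mul (Nat.cast_nonneg _)]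
    gcongr
  · refine one_sub_le_toReal (b := expect (unifBits (𝓕.ℓ lam)) fun s => expect (unifBits (N lam))
      fun z => expect (unif (Equiv.Perm (Fin (N lam)))) fun π =>
      expect (encode q (m lam) (𝓕.F lam s) z π) fun c => expect (E (List.ofFn c)) fun y =>
      if y.length = N lam ∧ threshold (m lam) < agreement (m lam) (𝓕.F lam s) z π y then 0 else 1)
      ?_ ?_ ?_
    · dsimp only
      split
      · exact add_nonneg (hB0 lam) (hν.1 lam)
      · exact zero_le_one
    · have hlaw : ((prfPRC 𝓕 q m).Key lam).bind (fun sk => ((prfPRC 𝓕 q m).Enc lam sk msg).bind fun x =>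
          (E (List.ofFn x)).bind fun y => (prfPRC 𝓕 q m).Dec lam sk y) =
          (unifBits (𝓕.ℓ lam)).bind fun s => (unifBits (N lam)).bind fun z =>
            (unif (Equiv.Perm (Fin (N lam)))).bind fun π =>
            (encode q (m lam) (𝓕.F lam s) z π).bind fun x => (E (List.ofFn x)).bind fun y =>
              (prfPRC 𝓕 q m).Dec lam (s, z, π) y := by
        refine (congrArg (PMF.bind · _) (unif_prfKey (𝓕.ℓ lam) (N lam))).trans ?_
        refine (PMF.bind_bind _ _ _).trans (congrArg _ (funext fun s => ?_))
        refine (PMF.bind_bind _ _ _).trans (congrArg _ (funext fun z => ?_))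
        exact PMF.bind_map _ _ _
      rw [hlaw, apply_eq_expect]
      simp only [expect_bind, ← expect_add]
      refine Eq.trans ?_ (expect_const (μ := unifBits (𝓕.ℓ lam)) 1)
      congr 1
      funext s
      refine Eq.trans ?_ (expect_const (μ := unifBits (N lam)) 1)
      congr 1
      funext z
      refine Eq.trans ?_ (expect_const (μ := unif (Equiv.Perm (Fin (N lam)))) 1)
      congr 1
      funext π
      refine Eq.trans ?_ (expect_const (μ := encode q (m lam) (𝓕.F lam s) z π) 1)
      congr 1
      funext x
      refine Eq.trans ?_ (expect_const (μ := E (List.ofFn x)) 1)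
      congr 1
      funext y
      simp only [prfPRC, expect_pure]
      by_cases h : y.length = N lam ∧
          threshold (m lam) < agreement (m lam) (𝓕.F lam s) z π y
      · rw [if_pos h, if_pos h, add_zero]
        exact if_pos (congrArg some (funext fun i => Fin.elim0 i))
      · rw [if_neg h, if_neg h]
        exact (congrArg (· + 1) (if_neg (by simp))).trans (zero_add 1)
    · dsimp only
      split
      · rename_i h
        obtain ⟨g1, g2, g3⟩ := h
        refine expect_le fun s _ => ?_
        -- The block bias is at least `(1 - 2p) m^(-1/4)`.
        obtain ⟨J, hJ, hdep⟩ := hloc lam s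
        have hb := bias_le hp0 hp hq1 g1 (((Nat.cast_le (α := ℝ)).mpr hJ).trans (hτ lam)) (hm lam)
        have hm1 : (m lam : ℝ) ^ (-(1 / 4) : ℝ) ≤ 1 :=
          Real.rpow_le_one_of_one_le_of_nonpos (by exact_mod_cast g2) (by norm_num)
        have hb1 : (1 - 2 * p) * (m lam : ℝ) ^ (-(1 / 4) : ℝ) ≤ 1 :=
          mul_le_one₀ (by linarith) (by positivity) hm1
        refine (expect_decode_le hp0.le hp.le hq0 hq1.le (le_blockLength _ _) (𝓕.F lam s) J hdep
          (by positivity) hb1 hb E).trans ?_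
        rw [ENNReal.ofReal_add (hB0 lam) (hν.1 lam)]
        refine add_le_add ?_ (h𝓔 lam E hE)
        simp only [hB]
        rw [ENNReal.ofReal_mul (Nat.cast_nonneg _), ENNReal.ofReal_natCast]
        gcongr
        exact hm₀ _ g3 g2
      · rw [ENNReal.ofReal_one]
        exact expect_le_one fun s => expect_le_one fun z => expect_le_one fun π =>
          expect_le_one fun x => expect_le_one fun y => by split <;> simp

theorem Negligible.comp_of_rpow_le {ν : ℕ → ℝ} (hν : Negligible ν) {f : ℕ → ℕ} {ε : ℝ} (hε : 0 < ε)
    (hf : ∀ᶠ lam : ℕ in atTop, (lam : ℝ) ^ ε ≤ f lam) : Negligible fun lam => ν (f lam) := by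
  refine ⟨fun lam => hν.1 _, fun C hC => ?_⟩
  obtain ⟨a, ha⟩ := hν.2 (C / ε) (by positivity)
  have h : Tendsto (fun lam : ℕ => (lam : ℝ) ^ ε) atTop atTop :=
    (tendsto_rpow_atTop hε).comp tendsto_natCast_atTop_atTop
  obtain ⟨b, hb⟩ := eventually_atTop.mp
    (hf.and ((h.eventually_gt_atTop (a : ℝ)).and (eventually_ge_atTop 1)))
  refine ⟨b, fun lam hlam => ?_⟩
  obtain ⟨h1, h2, h3⟩ := hb lam hlam.le
  have hpos : (0 : ℝ) < lam := by exact_mod_cast h3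
  refine (ha _ (by exact_mod_cast h2.trans_le h1)).trans ?_
  refine (Real.rpow_le_rpow_of_nonpos (by positivity) h1 (by
    rw [neg_nonpos]
    positivity)).trans (le_of_eq ?_)
  rw [← Real.rpow_mul hpos.le]
  congr 1
  field_simp

/-! ### The representation of keys -/

theorem length_keyBits {ℓ N : ℕ} (sk : PRFKey ℓ N) : (keyBits sk).length = ℓ + (N + N ^ 2) := by
  rw [keyBits_eq, List.length_append, List.length_append, List.length_ofFn, List.length_ofFn,
    List.length_flatten]
  have h : (permRows sk.2.2).map List.length = List.replicate N N := by
    refine List.eq_replicate_iff.mpr ⟨by rw [List.length_map, permRows_length], fun x hx => ?_⟩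
    obtain ⟨l, hl, rfl⟩ := List.mem_map.mp hx
    exact length_of_mem_permRows hl
  rw [h, List.sum_replicate, smul_eq_mul, sq]

theorem keyBits_injective (ℓ N : ℕ) : Injective (keyBits (ℓ := ℓ) (N := N)) := by
  rintro ⟨s, z, π⟩ ⟨s', z', π'⟩ h
  rw [keyBits_eq, keyBits_eq] at h
  obtain ⟨h1, h2⟩ := List.append_inj h (by simp)
  obtain ⟨h2, h3⟩ := List.append_inj h2 (by simp)
  have h4 : permRows π = permRows π' := by
    have hf : ∀ L : List (List Bool), (∀ l ∈ L, l.length = N) → L.length = N →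
        segments N N (L.flatten.map Data.ofBool) = L.map (List.map Data.ofBool) := by
      intro L hL hLN
      have := segments_flatten (c := N) (L.map (List.map Data.ofBool)) (by
        intro l hl
        obtain ⟨l', hl', rfl⟩ := List.mem_map.mp hl
        simpa using hL l' hl') []
      rw [List.length_map, hLN, List.append_nil, ← List.map_flatten] at this
      exact this
    have h5 := hf _ (fun l hl => length_of_mem_permRows hl) (permRows_length π)
    have h6 := hf _ (fun l hl => length_of_mem_permRows hl) (permRows_length π')
    simp only at h3
    rw [h3, h6] at h5
    have hinj : Injective Data.ofBool := fun a b hab => by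
      rw [← Data.toBool_ofBool a, hab, Data.toBool_ofBool]
    exact ((List.map_injective_iff.mpr (List.map_injective_iff.mpr hinj)) h5).symm
  have h7 : π = π' := by
    ext i
    have h8 := congrFun (List.ofFn_injective (congrFun (List.ofFn_injective h4) i)) (π i)
    simp only [decide_true, eq_comm (a := true), decide_eq_true_eq] at h8
    rw [h8]
  exact Prod.ext (List.ofFn_injective h1) (Prod.ext (List.ofFn_injective h2) h7)

/-! ### The construction is a pseudorandom code -/

theorem prfPRC_isPRC {nonuniform : Bool} {p q : ℝ} (hp0 : 0 < p) (hp : p < 1 / 2) (hq0 : 0 ≤ q)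
    (hq1 : q < 1 / 2) {𝓕 : FunctionFamily} {τ : ℕ → ℕ} (bℓ : PolyBounded 𝓕.ℓ)
    (bn : PolyBounded 𝓕.n)
    (hε : ∃ ε : ℝ, 0 < ε ∧ ∀ᶠ lam : ℕ in atTop, (lam : ℝ) ^ ε ≤ 𝓕.n lam)
    (hτ : ∀ lam, (τ lam : ℝ) ≤ Real.logb 2 (𝓕.n lam)) (hloc : 𝓕.IsLocal τ)
    (hF : 𝓕.IsEfficient nonuniform) (hP : 𝓕.IsWeakPRF nonuniform q) {m : ℕ → ℕ}
    (bm : PolyBounded m)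
    (hm : ∀ lam, ((1 - 2 * q) ^ 4)⁻¹ *
      (𝓕.n lam : ℝ) ^ (4 * Real.logb 2 (1 / (1 - 2 * p))) ≤ m lam)
    (cm : IsConstructible nonuniform m)
    (ct : IsConstructible nonuniform fun lam => ⌊threshold (m lam)⌋₊) :
    (prfPRC 𝓕 q m).IsZeroBit ∧
    (prfPRC 𝓕 q m).IsPRC nonuniform q (fun _ => {E | SubstitutionBounded p E}) ∧
    ∀ ν : ℕ → ℝ, Negligible ν →
      (prfPRC 𝓕 q m).IsRobust (fun _ => {E | WeaklySubstitutionBoundedBy p ν E}) := by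
  have hund := prfPRC_isUndetectable bn bm hε hF hP cm ct
  obtain ⟨ε, hε0, hε⟩ := hε
  set L := Real.logb 2 (1 / (1 - 2 * p)) with hL
  have hL0 : 0 < L := Real.logb_pos one_lt_two (by
    rw [lt_div_iff₀ (by linarith)]
    linarith)
  have hc : 0 < ε * (4 * L) := by positivity
  have hmc : ∀ᶠ lam : ℕ in atTop, (lam : ℝ) ^ (ε * (4 * L)) ≤ m lam := by
    filter_upwards [hε] with lam hlam
    have h1 : 1 ≤ ((1 - 2 * q) ^ 4)⁻¹ :=
      (one_le_inv₀ (by have : 0 < 1 - 2 * q := by linarith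
                       positivity)).mpr (pow_le_one₀ (by linarith) (by linarith))
    calc (lam : ℝ) ^ (ε * (4 * L)) = ((lam : ℝ) ^ ε) ^ (4 * L) := Real.rpow_mul (by positivity) _ _
      _ ≤ (𝓕.n lam : ℝ) ^ (4 * L) := Real.rpow_le_rpow (by positivity) hlam (by positivity)
      _ ≤ ((1 - 2 * q) ^ 4)⁻¹ * (𝓕.n lam : ℝ) ^ (4 * L) := le_mul_of_one_le_left (by positivity) h1
      _ ≤ m lam := hm lam
  have hpos : ∀ {f : ℕ → ℕ} {e : ℝ}, 0 < e → (∀ᶠ lam : ℕ in atTop, (lam : ℝ) ^ e ≤ f lam) →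
      ∀ᶠ lam in atTop, 1 ≤ f lam := by
    intro f e he hf
    filter_upwards [hf, eventually_ge_atTop 1] with lam h1 h2
    have h3 : (0 : ℝ) < f lam := lt_of_lt_of_le (by
      have : (0 : ℝ) < lam := by exact_mod_cast h2
      positivity) h1
    exact_mod_cast h3
  have hn1 := hpos hε0 hε
  have bN := polyBounded_blockLength bn bm
  refine ⟨fun _ => rfl, ⟨?_, PolyBounded.const 0, bN, fun lam sk => length_keyBits sk,
    fun lam => keyBits_injective _ _, prfPRC_isEfficient bℓ bn bm hF cm ct, ?_,
    prfPRC_isSound hc hmc, hund⟩, fun ν hν => ?_⟩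
  · have : PolyBounded fun lam => 𝓕.ℓ lam + (blockLength (𝓕.n lam) (m lam) +
        blockLength (𝓕.n lam) (m lam) ^ 2) := by
      simp only [sq]
      exact bℓ.add (bN.add (bN.mul bN))
    exact this
  · exact prfPRC_isRobust hp0 hp hq0 hq1 bn bm hn1 hτ hloc hm hc hmc (ν := fun _ => 0)
      ⟨fun _ => le_rfl, fun C _ => ⟨0, fun lam _ => by positivity⟩⟩
      fun lam E hE => (expect_throughChannel_of_bounded hE _).le.trans zero_le
  · have hN : ∀ᶠ lam : ℕ in atTop, (lam : ℝ) ^ ε ≤ blockLength (𝓕.n lam) (m lam) := by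
      filter_upwards [hε, hpos hc hmc] with lam h1 h2
      exact h1.trans (by exact_mod_cast le_blockLength_left h2)
    exact prfPRC_isRobust hp0 hp hq0 hq1 bn bm hn1 hτ hloc hm hc hmc (hν.comp_of_rpow_le hε0 hN)
      fun lam E hE => expect_throughChannel_of_weaklyBounded hE _

end PRFCode

open PRFCode in
theorem mainTheorem2 :
    ∃ C₀ : ℝ, 0 < C₀ ∧
      ∀ (nonuniform : Bool) (p q : ℝ), 0 < p → p < 1 / 2 → 0 ≤ q → q < 1 / 2 →
      ∀ (𝓕 : FunctionFamily) (τ : ℕ → ℕ),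
        PolyBounded 𝓕.ℓ → PolyBounded 𝓕.n →
        (∃ ε : ℝ, 0 < ε ∧ ∀ᶠ lam : ℕ in Filter.atTop, (lam : ℝ) ^ ε ≤ 𝓕.n lam) →
        (∀ lam, (τ lam : ℝ) ≤ Real.logb 2 (𝓕.n lam)) →
        𝓕.IsLocal τ →
        𝓕.IsEfficient nonuniform →
        𝓕.IsWeakPRF nonuniform q →
      ∀ m : ℕ → ℕ,
        PolyBounded m →
        (∀ lam, C₀ * ((1 - 2 * q) ^ 4)⁻¹ *
          (𝓕.n lam : ℝ) ^ (4 * Real.logb 2 (1 / (1 - 2 * p))) ≤ m lam) →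
        IsConstructible nonuniform m →
        IsConstructible nonuniform (fun lam => ⌊threshold (m lam)⌋₊) →
        (prfPRC 𝓕 q m).IsZeroBit ∧
        (prfPRC 𝓕 q m).IsPRC nonuniform q (fun _ => {E | SubstitutionBounded p E}) ∧
        ∀ ν : ℕ → ℝ, Negligible ν →
          (prfPRC 𝓕 q m).IsRobust (fun _ => {E | WeaklySubstitutionBoundedBy p ν E}) := by
  -- Any positive constant would do: the bias `m ^ (-1/4)` of a block beats the relative excess
  -- `ln(m) / √m` of the threshold by a power of `m`.
  refine ⟨1, one_pos, ?_⟩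
  intro nonuniform p q hp0 hp hq0 hq1 𝓕 τ bℓ bn hε hτ hloc hF hP m bm hm cm ct
  simp only [one_mul] at hm
  exact prfPRC_isPRC hp0 hp hq0 hq1 bℓ bn hε hτ hloc hF hP bm hm cm ct
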